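/- \textbf{Theorem (consistency of the partitioned sample-spacing entropy estimator).} Let $d\ge 1$, let $f$ be a probability density on $\mathbb{R}^d$ that is continuous at almost every point, and let $X_1,X_2,\dots$ be i.i.d. random vectors with density $f$. Assume $\log f\in L^{1+\delta}(f\,dx)$ for some $\delta\in(0,1)$, i.e. $\int |\log f|^{1+\delta} f\,dx<\infty$, and put $H(f)=\mathbb{E}[-\log f(X_1)]$. \emph{Estimator.} Given $X_1,\dots,X_n$ and an integer $\ell\ge 1$, divide the range $[\min_v X_{v,j},\max_v X_{v,j}]$ of each coordinate $j$ into $\ell$ segments of equal width $w_{n,j}=(\max_v X_{v,j}-\min_v X_{v,j})/\ell$; this gives $\ell^d$ rectangular partitions. Let $n_k$ be the number of sample points in partition $k$, $m_k=\lfloor\sqrt{n_k}+1/2\rfloor$, and let $x^k_{j,(1)}\le\dots\le x^k_{j,(n_k)}$ be the ordered $j$-th coordinates of the sample points in partition $k$, with $x^k_{j,(r)}=x^k_{j,(1)}$ for $r<1$ and $x^k_{j,(r)}=x^k_{j,(n_k)}$ for $r>n_k$. Set $\Delta^k_{j,a}=x^k_{j,(a+m_k)}-x^k_{j,(a-m_k)}$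 for $0\le a\le n_k$, $\xi^k_{j,a}=\frac1{2m_k}\sum_{i=a-m_k}^{a+m_k-1}x^k_{j,(i)}$ for $1\le a\le n_k$, $\xi^k_{j,0}=x^k_{j,(1)}$ and $\xi^k_{j,n_k+1}=x^k_{j,(n_k)}$. For $t$ in a partition $k$ with $n_k>1$ let $$\hat f_{n,\ell}(t)=\frac{n_k}{n}\prod_{j=1}^d\frac{2m_k}{n_k\,\Delta^k_{j,a_j}},\qquad \xi^k_{j,a_j}<t_j\le\xi^k_{j,a_j+1}$$ (for $a_j=0$ the interval also includes its left end point), and $\hat f_{n,\ell}(t)=0$ if some $t_j$ lies outside $[\xi^k_{j,0},\xi^k_{j,n_k+1}]$. The entropy estimator is $$\hat H_{n,\ell}=-\frac1n\sum_{v=1}^n\log\hat f_{n,\ell}(X_v),$$ where the sample points that lie in a partition with $n_k=1$, or for which some $\Delta^k_{j,a_j}$ is $0$, are skipped in the sum. \emph{Claim.} Let $\ell=\ell(n)\ge1$ satisfy $\ell(n)^d=o(n)$ as $n\to\infty$, and suppose that the partitions shrink: almost surely, $w_{n,j}\to0$ as $n\to\infty$ for every $j$. Then $$\hat H_{n,\ell(n)}\to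 H(f)\quad\text{almost surely and in } L^1\qquad (n\to\infty).$$ -/

import Mathlib

open MeasureTheory ProbabilityTheory Filter Asymptotics
open scoped Topology ENNReal

namespace PSS

noncomputable section

/-- The probability measure on `ℝ^d` with Lebesgue density `f`. -/
def densityMeasure {d : ℕ} (f : (Fin d → ℝ) → ℝ) : Measure (Fin d → ℝ) :=
  (volume : Measure (Fin d → ℝ)).withDensity (fun x => ENNReal.ofReal (f x))

/-- The differential entropy `H(f) = E[-log f(X)]`, where `X` has density `f`. -/
def entropy {d : ℕ} (f : (Fin d → ℝ) → ℝ) : ℝ :=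
  ∫ x, -Real.log (f x) ∂(densityMeasure f)

/-! ### One-dimensional spacings of a finite multiset of real numbers -/

/-- The order statistic `x_(r)` of the finite multiset `s` (so `x_(1) ≤ ⋯ ≤ x_(N)`, `N = card s`),
with the convention `x_(r) = x_(1)` for `r < 1` and `x_(r) = x_(N)` for `r > N`. -/
def orderStat (s : Multiset ℝ) (r : ℤ) : ℝ :=
  (s.sort (· ≤ ·)).getD (min r (s.card : ℤ) - 1).toNat 0

/-- The `2m`-spacing `Δ_a = x_(a+m) - x_(a-m)`. -/
def spacing (s : Multiset ℝ) (m a : ℕ) : ℝ :=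
  orderStat s ((a : ℤ) + m) - orderStat s ((a : ℤ) - m)

/-- The sub-grid points: `ξ_a = (x_(a-m) + ⋯ + x_(a+m-1)) / (2m)` for `1 ≤ a ≤ N`,
with the outer boundaries `ξ_0 = x_(1)` and `ξ_(N+1) = x_(N)`. -/
def gridPoint (s : Multiset ℝ) (m a : ℕ) : ℝ :=
  if a = 0 then orderStat s 1
  else if s.card < a then orderStat s s.card
  else (∑ i ∈ Finset.range (2 * m), orderStat s ((a : ℤ) - m + i)) / (2 * m)

/-- The intervals of the sub-grid on `[x_(1), x_(N)]`: `(ξ_a, ξ_(a+1)]` for `1 ≤ a ≤ N`, and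
`[ξ_0, ξ_1]` for `a = 0`, so that the smallest point `x_(1) = ξ_0` belongs to the sub-grid. -/
def gridInterval (s : Multiset ℝ) (m a : ℕ) : Set ℝ :=
  if a = 0 then Set.Icc (gridPoint s m 0) (gridPoint s m 1)
  else Set.Ioc (gridPoint s m a) (gridPoint s m (a + 1))

/-- The univariate spacing estimator: `2m / (N Δ_a)` on the `a`-th interval of the sub-grid,
`a = 0, …, N`, and `0` outside `[x_(1), x_(N)]`. (A degenerate interval, with `Δ_a = 0`, gets the
value `0`.) -/
def spacingDensity (s : Multiset ℝ) (m : ℕ) (t : ℝ) : ℝ :=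
  ∑ a ∈ Finset.range (s.card + 1),
    (gridInterval s m a).indicator (fun _ => 2 * (m : ℝ) / (s.card * spacing s m a)) t

/-! ### The partition of the range of a sample `x_0, …, x_(n-1)` of points of `ℝ^d` -/

/-- The width `(max - min) / ℓ` of the `ℓ` segments into which the range of the `j`-th coordinate
of the sample is divided. -/
def segWidth {d n : ℕ} (x : Fin n → Fin d → ℝ) (ℓ : ℕ) (j : Fin d) : ℝ :=
  ((⨆ v, x v j) - ⨅ v, x v j) / ℓ

/-- The partition containing the point `t`, named by the tuple of the numbers (`0, …, ℓ - 1`) of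
the segments containing its coordinates. Segments are closed on the left and open on the right,
except that the last one is closed. -/
def cellIndex {d n : ℕ} (x : Fin n → Fin d → ℝ) (ℓ : ℕ) (t : Fin d → ℝ) : Fin d → ℕ :=
  fun j => min ⌊(t j - ⨅ v, x v j) / segWidth x ℓ j⌋₊ (ℓ - 1)

/-- The (indices of the) sample points in partition `k`. -/
def cellPoints {d n : ℕ} (x : Fin n → Fin d → ℝ) (ℓ : ℕ) (k : Fin d → ℕ) : Finset (Fin n) :=
  Finset.univ.filter (fun v => cellIndex x ℓ (x v) = k)

/-- The number `n_k` of sample points in partition `k`. -/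
def cellCount {d n : ℕ} (x : Fin n → Fin d → ℝ) (ℓ : ℕ) (k : Fin d → ℕ) : ℕ :=
  (cellPoints x ℓ k).card

/-- The multiset of the `j`-th coordinates of the sample points in partition `k`. -/
def cellCoord {d n : ℕ} (x : Fin n → Fin d → ℝ) (ℓ : ℕ) (k : Fin d → ℕ) (j : Fin d) :
    Multiset ℝ :=
  (cellPoints x ℓ k).val.map (fun v => x v j)

/-- The spacing parameter `m = ⌊√N + 1/2⌋` for a partition with `N` sample points. -/
def spacingParam (N : ℕ) : ℕ := ⌊Real.sqrt N + 1 / 2⌋₊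

/-- The partitioned sample-spacing density estimator
`f̂_{n,ℓ}(t) = (n_k / n) ∏_j 2 m_k / (n_k Δ_{j,a_j})`, for `t` in partition `k` with
`t_j ∈ (ξ_{j,a_j}, ξ_{j,a_j+1}]`. Partitions with `n_k ≤ 1` carry no estimate (value `0`). -/
def densityEst {d n : ℕ} (x : Fin n → Fin d → ℝ) (ℓ : ℕ) (t : Fin d → ℝ) : ℝ :=
  let k := cellIndex x ℓ t
  if 2 ≤ cellCount x ℓ k then
    (cellCount x ℓ k : ℝ) / n *
      ∏ j, spacingDensity (cellCoord x ℓ k j) (spacingParam (cellCount x ℓ k)) (t j)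
  else 0

/-- The plug-in entropy estimator `Ĥ_{n,ℓ} = -(1/n) ∑_v log f̂_{n,ℓ}(x_v)`. The sample points
without an estimate (`n_k ≤ 1`, or a vanishing spacing) are skipped. -/
def entropyEst {d n : ℕ} (x : Fin n → Fin d → ℝ) (ℓ : ℕ) : ℝ :=
  -(1 / (n : ℝ)) * ∑ v, if densityEst x ℓ (x v) = 0 then 0 else Real.log (densityEst x ℓ (x v))

end

end PSS

namespace PSS

/-! ### Order statistics -/

/-! The sum defining the estimator is compared with the sum of `log f (X v)`. At all but a small
fraction of the sample points the two logarithms are close, and the remaining points contribute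
little to either sum.

Accurate points. Around a point where `f` is positive and continuous, `f` is almost constant on a
small ball (`flatSet`), hence on the cell of the point once the mesh is small. The estimate is then
accurate as soon as that cell, and the slabs cut out of it by the spacing windows, hold about as
many points as their mass predicts (`abs_log_densityEst_sub_le`). If many points had a cell or slab
with a wrong count, a maximal disjoint subfamily would have a union with a wrong count
(`card_le_of_deviation`). Such a union is determined by few sample points: those naming the cells or
bounding the slabs, and the extremes that fix the grid. Given these, the other points are still
i.i.d., and there are few ways to choose them on an exponential scale, so exponential moments and a
union bound exclude all deviations at once (`ae_eventually_deviation`). Small cells hold few points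
because `ℓ ^ d = o(n)`; windows cut off by the border of a large cell are rare because `m` is of
order `√n_k`.

Remaining points, lower bound. Relative to the reference density `∏ 1 / (1 + t_j ^ 2)`, `log f̂`
splits into a histogram part, spacing parts and a reference part (`log_densityEst_eq`). The first
two are controlled from below by `log t ≤ log c + t / c`, since the relevant ratios have bounded
averages: cells are disjoint in a finite measure, and spacings telescope. The reference part costs
`log (1 + |x_j|)`, which is integrable because a mesh tending to zero with `ℓ ^ d = o(n)` forces a
`d`-th moment (`integrable_pow_abs`).

Remaining points, upper bound. This is the main difficulty, since sample points may cluster. For a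
set `B` of indices a random function, `potential`, is built from the points outside `B`; its
integral against `f dx` is at most 5. By independence the product of its values over `B` has
expectation at most `5 ^ |B|` (`lintegral_prod_decouple`). Summed over all small `B` this is still
at most `exp (η n / 2)`, so Markov and Borel–Cantelli bound all these products by `exp (η n)`
simultaneously, whatever the set of remaining points turns out to be. The potential dominates the
square root of a spacing factor times the histogram factor (`exp_le_potential`); the root is needed
because the reciprocal of a distance is not integrable while its root is. To have neighbours outside
`B`, the points are split by the parity of their rank, the neighbours being those of the other
parity. The few extreme points are treated by a crude estimate for pairs.

Convergence in `L¹`. The same bounds applied to the whole sample dominate the estimator by a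
constant plus errors that vanish in `L¹` (`abs_sum_logEst_le`); with almost sure convergence this
suffices (`tendsto_eLpNorm_one_sub`). -/

lemma orderStat_eq_getElem {s : Multiset ℝ} {r : ℤ}
    (h : (min r (s.card : ℤ) - 1).toNat < (s.sort (· ≤ ·)).length) :
    orderStat s r = (s.sort (· ≤ ·))[(min r (s.card : ℤ) - 1).toNat] := by
  unfold orderStat
  rw [List.getD_eq_getElem]

/-- The `min` and the truncation in `toNat` clamp every integer index, so the default value of
`getD` occurs only for the empty multiset. -/
lemma orderStat_index_lt {s : Multiset ℝ} (r : ℤ) (hs : 0 < s.card) :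
    (min r (s.card : ℤ) - 1).toNat < (s.sort (· ≤ ·)).length := by
  rw [Multiset.length_sort]; omega

lemma orderStat_mem {s : Multiset ℝ} (r : ℤ) (hs : 0 < s.card) : orderStat s r ∈ s := by
  rw [orderStat_eq_getElem (orderStat_index_lt r hs), ← Multiset.mem_sort (r := (· ≤ ·))]
  exact List.getElem_mem _

lemma orderStat_mono (s : Multiset ℝ) : Monotone (orderStat s) := by
  intro r r' hr
  rcases Nat.eq_zero_or_pos s.card with h | h
  · have : s = 0 := by simpa using h
    subst this
    simp [orderStat]
  · rw [orderStat_eq_getElem (orderStat_index_lt r h),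
      orderStat_eq_getElem (orderStat_index_lt r' h)]
    exact (Multiset.pairwise_sort s (· ≤ ·)).sortedLE.getElem_le_getElem_of_le (by omega)

lemma orderStat_of_le_one (s : Multiset ℝ) {r : ℤ} (hr : r ≤ 1) :
    orderStat s r = orderStat s 1 := by
  unfold orderStat; congr 1; omega

lemma orderStat_of_card_le (s : Multiset ℝ) {r : ℤ} (hr : (s.card : ℤ) ≤ r) :
    orderStat s r = orderStat s s.card := by
  unfold orderStat; congr 1; omega

lemma getElem_le_iff_lt_length_filter {L : List ℝ} (hL : L.SortedLE) (t : ℝ) {i : ℕ}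
    (hi : i < L.length) : L[i] ≤ t ↔ i < (L.filter (· ≤ t)).length := by
  induction L generalizing i with
  | nil => simp at hi
  | cons a l ih =>
    have hp := hL.pairwise
    rw [List.pairwise_cons] at hp
    by_cases hat : a ≤ t
    · cases i with
      | zero => simp [hat]
      | succ i => simpa [hat] using ih hp.2.sortedLE (by simpa using hi)
    · have hnil : l.filter (· ≤ t) = [] := by
        rw [List.filter_eq_nil_iff]
        intro b hb
        have := hp.1 b hb
        simp only [decide_eq_true_eq]
        linarith
      have h1 : t < (a :: l)[i] := by
        refine lt_of_lt_of_le (not_le.1 hat) ?_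
        exact hL.getElem_le_getElem_of_le (hi := by simp) (Nat.zero_le i)
      simp [hat, hnil, h1]

/-- Order statistics and counting are adjoint. This replaces the sorted list by cardinalities in
everything about ranks and measurability below. -/
lemma orderStat_le_iff {s : Multiset ℝ} {r : ℤ} (h1 : 1 ≤ r) (h2 : r ≤ s.card) (t : ℝ) :
    orderStat s r ≤ t ↔ r ≤ (s.filter (· ≤ t)).card := by
  have hcard : (s.filter (· ≤ t)).card = ((s.sort (· ≤ ·)).filter (· ≤ t)).length := by
    conv_lhs => rw [← Multiset.sort_eq s (· ≤ ·)]
    rw [Multiset.filter_coe, Multiset.coe_card]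
  have hi := orderStat_index_lt (s := s) r (by omega)
  rw [orderStat_eq_getElem hi, hcard,
    getElem_le_iff_lt_length_filter (Multiset.pairwise_sort s (· ≤ ·)).sortedLE]
  omega

lemma orderStat_one_le {s : Multiset ℝ} {t : ℝ} (ht : t ∈ s) : orderStat s 1 ≤ t := by
  have hs : 0 < s.card := Multiset.card_pos_iff_exists_mem.2 ⟨t, ht⟩
  rw [orderStat_le_iff le_rfl (by omega)]
  have : 0 < (s.filter (· ≤ t)).card :=
    Multiset.card_pos_iff_exists_mem.2 ⟨t, by simp [ht]⟩
  omega

lemma le_orderStat_card {s : Multiset ℝ} {t : ℝ} (ht : t ∈ s) : t ≤ orderStat s s.card := by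
  have hs : 0 < s.card := Multiset.card_pos_iff_exists_mem.2 ⟨t, ht⟩
  have h := (orderStat_le_iff (s := s) (r := s.card) (by omega) le_rfl (orderStat s s.card)).1 le_rfl
  have h2 : s.filter (· ≤ orderStat s s.card) = s :=
    Multiset.eq_of_le_of_card_le (Multiset.filter_le _ _) (by omega)
  rw [← h2] at ht
  exact (Multiset.mem_filter.1 ht).2

/-! ### Ranks -/

section Rank

variable {ι : Type*} {C : Finset ι} {y : ι → ℝ}

/-- The rank of `y v` among the values of `y` on `C`. -/
noncomputable def rank (C : Finset ι) (y : ι → ℝ) (v : ι) : ℕ := by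
  classical exact (C.filter (fun u => y u ≤ y v)).card

lemma rank_eq_card_filter (C : Finset ι) (y : ι → ℝ) (v : ι) :
    rank C y v = ((C.val.map y).filter (· ≤ y v)).card := by
  classical
  rw [Multiset.filter_map, Multiset.card_map]
  unfold rank
  rw [Finset.card_def, Finset.filter_val]
  congr!

lemma rank_le_card (C : Finset ι) (y : ι → ℝ) (v : ι) : rank C y v ≤ C.card := by
  classical
  unfold rank; exact Finset.card_filter_le _ _

lemma one_le_rank {v : ι} (hv : v ∈ C) : 1 ≤ rank C y v := by
  classical
  unfold rank; exact Finset.card_pos.2 ⟨v, by simp [hv]⟩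

lemma rank_le_rank {u v : ι} (huv : y u ≤ y v) : rank C y u ≤ rank C y v := by
  classical
  unfold rank
  apply Finset.card_le_card
  intro w hw
  simp only [Finset.mem_filter] at hw ⊢
  exact ⟨hw.1, hw.2.trans huv⟩

lemma rank_lt_rank {u v : ι} (hv : v ∈ C) (huv : y u < y v) : rank C y u < rank C y v := by
  classical
  unfold rank
  apply Finset.card_lt_card
  refine Finset.ssubset_iff_of_subset ?_ |>.2 ⟨v, by simp [hv], by simp [huv]⟩
  intro w hw
  simp only [Finset.mem_filter] at hw ⊢
  exact ⟨hw.1, hw.2.trans huv.le⟩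

lemma rank_le_rank_iff {u v : ι} (hu : u ∈ C) : rank C y u ≤ rank C y v ↔ y u ≤ y v :=
  ⟨fun h => not_lt.1 fun h' => absurd (rank_lt_rank hu h') (not_lt.2 h), rank_le_rank⟩

lemma rank_injOn (hy : Set.InjOn y C) : Set.InjOn (rank C y) C := by
  intro u hu v hv h
  apply hy hu hv
  exact le_antisymm ((rank_le_rank_iff hu).1 h.le) ((rank_le_rank_iff hv).1 h.ge)

lemma orderStat_le_val_iff {v : ι} {r : ℤ} (h1 : 1 ≤ r) (h2 : r ≤ C.card) :
    orderStat (C.val.map y) r ≤ y v ↔ r ≤ rank C y v := by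
  rw [orderStat_le_iff h1 (by simpa using h2), rank_eq_card_filter]

lemma image_rank (hy : Set.InjOn y C) : C.image (rank C y) = Finset.Icc 1 C.card := by
  apply Finset.eq_of_subset_of_card_le
  · intro r hr
    obtain ⟨v, hv, rfl⟩ := Finset.mem_image.1 hr
    exact Finset.mem_Icc.2 ⟨one_le_rank hv, rank_le_card _ _ _⟩
  · rw [Finset.card_image_of_injOn (rank_injOn hy)]; simp

lemma exists_rank_eq (hy : Set.InjOn y C) {r : ℕ} (h1 : 1 ≤ r) (h2 : r ≤ C.card) :
    ∃ v ∈ C, rank C y v = r := by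
  have : r ∈ C.image (rank C y) := by rw [image_rank hy]; exact Finset.mem_Icc.2 ⟨h1, h2⟩
  simpa using this

/-- Ties are harmless: the rank counts all values not exceeding `y v`. For the lower bound, the
order statistic is itself some value `y w`, and `w` then has at least the rank of `v`. -/
lemma orderStat_rank {v : ι} (hv : v ∈ C) :
    orderStat (C.val.map y) (rank C y v) = y v := by
  have h1 : (1 : ℤ) ≤ rank C y v := by exact_mod_cast one_le_rank hv
  have h2 : (rank C y v : ℤ) ≤ C.card := by exact_mod_cast rank_le_card C y v
  apply le_antisymm
  · exact (orderStat_le_val_iff h1 h2).2 le_rfl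
  · have hm : orderStat (C.val.map y) (rank C y v) ∈ C.val.map y :=
      orderStat_mem _ (by rw [Multiset.card_map]; exact Finset.card_pos.2 ⟨v, hv⟩)
    obtain ⟨w, hw, hwe⟩ := Multiset.mem_map.1 hm
    rw [← hwe]
    have := (orderStat_le_val_iff (v := w) (y := y) h1 h2).1 hwe.ge
    exact (rank_le_rank_iff hv).1 (by exact_mod_cast this)

/-- A sum of a function of the ranks is a sum over `1, …, N`. -/
lemma sum_rank {M : Type*} [AddCommMonoid M] (hy : Set.InjOn y C) (F : ℕ → M) :
    ∑ v ∈ C, F (rank C y v) = ∑ r ∈ Finset.Icc 1 C.card, F r := by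
  rw [← image_rank hy, Finset.sum_image (rank_injOn hy)]

/-- Integer end points allow windows that stick out of `1, …, N`, where only an upper bound for the
count remains. -/
lemma card_rank_mem_Icc_le (hy : Set.InjOn y C) (p q : ℤ) (hpq : p ≤ q + 1)
    [DecidablePred fun v => p ≤ (rank C y v : ℤ) ∧ (rank C y v : ℤ) ≤ q] :
    ((C.filter fun v => p ≤ (rank C y v : ℤ) ∧ (rank C y v : ℤ) ≤ q).card : ℤ) ≤ q + 1 - p := by
  have : (C.filter fun v => p ≤ (rank C y v : ℤ) ∧ (rank C y v : ℤ) ≤ q).card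
      ≤ (Finset.Icc p q).card := by
    apply Finset.card_le_card_of_injOn (fun v => (rank C y v : ℤ))
    · intro v hv
      simpa using (Finset.mem_filter.1 hv).2
    · intro u hu v hv h
      simp only [Nat.cast_inj] at h
      exact rank_injOn hy (Finset.mem_filter.1 hu).1 (Finset.mem_filter.1 hv).1 h
  rw [Int.card_Icc] at this
  omega

lemma card_rank_mem_Icc_eq (hy : Set.InjOn y C) {p q : ℕ} (hp : 1 ≤ p) (hq : q ≤ C.card)
    [DecidablePred fun v => p ≤ rank C y v ∧ rank C y v ≤ q] :
    (C.filter fun v => p ≤ rank C y v ∧ rank C y v ≤ q).card = q + 1 - p := by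
  rw [← Nat.card_Icc, ← Finset.card_image_of_injOn (f := rank C y) (s := C.filter _)]
  · congr 1
    ext r
    simp only [Finset.mem_image, Finset.mem_filter, Finset.mem_Icc]
    constructor
    · rintro ⟨v, ⟨_, h⟩, rfl⟩; exact h
    · intro h
      obtain ⟨v, hv, rfl⟩ := exists_rank_eq hy (hp.trans h.1) (h.2.trans hq)
      exact ⟨v, ⟨hv, h⟩, rfl⟩
  · intro u hu v hv h
    exact rank_injOn hy (Finset.mem_filter.1 hu).1 (Finset.mem_filter.1 hv).1 h

end Rank

end PSS

namespace PSS

/-! ### The sub-grid -/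

lemma orderStat_one_le_orderStat (s : Multiset ℝ) (r : ℤ) : orderStat s 1 ≤ orderStat s r := by
  rcases le_total r 1 with h | h
  · exact (orderStat_of_le_one s h).ge
  · exact orderStat_mono s h

lemma orderStat_le_orderStat_card (s : Multiset ℝ) (r : ℤ) :
    orderStat s r ≤ orderStat s s.card := by
  rcases le_total r s.card with h | h
  · exact orderStat_mono s h
  · exact (orderStat_of_card_le s h).le

lemma le_sum_div {m : ℕ} (hm : 1 ≤ m) {g : ℕ → ℝ} {c : ℝ} (h : ∀ i < 2 * m, c ≤ g i) :
    c ≤ (∑ i ∈ Finset.range (2 * m), g i) / (2 * m) := by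
  have hm' : (0 : ℝ) < 2 * m := by positivity
  rw [le_div_iff₀ hm']
  calc c * (2 * m) = ∑ i ∈ Finset.range (2 * m), c := by simp; ring
    _ ≤ _ := Finset.sum_le_sum fun i hi => h i (Finset.mem_range.1 hi)

lemma sum_div_le {m : ℕ} (hm : 1 ≤ m) {g : ℕ → ℝ} {c : ℝ} (h : ∀ i < 2 * m, g i ≤ c) :
    (∑ i ∈ Finset.range (2 * m), g i) / (2 * m) ≤ c := by
  have hm' : (0 : ℝ) < 2 * m := by positivity
  rw [div_le_iff₀ hm']
  calc _ ≤ ∑ i ∈ Finset.range (2 * m), c :=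
        Finset.sum_le_sum fun i hi => h i (Finset.mem_range.1 hi)
    _ = c * (2 * m) := by simp; ring

section Grid

variable {s : Multiset ℝ} {m : ℕ}

lemma gridPoint_zero (s : Multiset ℝ) (m : ℕ) : gridPoint s m 0 = orderStat s 1 := by
  simp [gridPoint]

lemma gridPoint_card_succ (s : Multiset ℝ) (m : ℕ) :
    gridPoint s m (s.card + 1) = orderStat s s.card := by
  simp [gridPoint]

lemma gridPoint_of_mem (s : Multiset ℝ) (m : ℕ) {a : ℕ} (h1 : 1 ≤ a) (h2 : a ≤ s.card) :
    gridPoint s m a = (∑ i ∈ Finset.range (2 * m), orderStat s ((a : ℤ) - m + i)) / (2 * m) := by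
  rw [gridPoint, if_neg (by omega), if_neg (by omega)]

/-- The average `ξ_a` runs over the ranks from `a - m` to `a + m - 1`. Together with
`gridPoint_succ_le_orderStat` this places the `a`-th interval inside the window whose length is
`Δ_a`. -/
lemma orderStat_le_gridPoint (hm : 1 ≤ m) {a : ℕ} (ha : a ≤ s.card) :
    orderStat s ((a : ℤ) - m) ≤ gridPoint s m a := by
  rcases Nat.eq_zero_or_pos a with rfl | h
  · rw [gridPoint_zero, orderStat_of_le_one s (by omega)]
  · rw [gridPoint_of_mem s m h ha]
    exact le_sum_div hm fun i _ => orderStat_mono s (by omega)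

lemma gridPoint_succ_le_orderStat (hm : 1 ≤ m) {a : ℕ} (ha : a ≤ s.card) :
    gridPoint s m (a + 1) ≤ orderStat s ((a : ℤ) + m) := by
  rcases eq_or_lt_of_le ha with rfl | h
  · rw [gridPoint_card_succ]
    exact orderStat_mono s (by omega)
  · rw [gridPoint_of_mem s m (by omega) h]
    exact sum_div_le hm fun i hi => orderStat_mono s (by push_cast; omega)

lemma gridPoint_le_succ (hs : 0 < s.card) (hm : 1 ≤ m) {a : ℕ} (ha : a ≤ s.card) :
    gridPoint s m a ≤ gridPoint s m (a + 1) := by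
  rcases Nat.eq_zero_or_pos a with rfl | h0
  · rw [gridPoint_zero, gridPoint_of_mem s m le_rfl hs]
    exact le_sum_div hm fun i _ => orderStat_one_le_orderStat s _
  rw [gridPoint_of_mem s m h0 ha]
  rcases eq_or_lt_of_le ha with rfl | h
  · rw [gridPoint_card_succ]
    exact sum_div_le hm fun i _ => orderStat_le_orderStat_card s _
  · rw [gridPoint_of_mem s m (by omega) h]
    gcongr with i hi
    exact orderStat_mono s (by push_cast; omega)

lemma gridPoint_mono (hs : 0 < s.card) (hm : 1 ≤ m) {a b : ℕ} (hab : a ≤ b)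
    (hb : b ≤ s.card + 1) : gridPoint s m a ≤ gridPoint s m b := by
  induction b, hab using Nat.le_induction with
  | base => exact le_rfl
  | succ b hab ih =>
    exact (ih (by omega)).trans (gridPoint_le_succ hs hm (by omega))

lemma mem_gridInterval_zero {t : ℝ} :
    t ∈ gridInterval s m 0 ↔ gridPoint s m 0 ≤ t ∧ t ≤ gridPoint s m 1 := by
  simp [gridInterval]

lemma mem_gridInterval_pos {t : ℝ} {a : ℕ} (ha : 1 ≤ a) :
    t ∈ gridInterval s m a ↔ gridPoint s m a < t ∧ t ≤ gridPoint s m (a + 1) := by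
  rw [gridInterval, if_neg (by omega)]; rfl

lemma mem_gridInterval_bounds {t : ℝ} {a : ℕ} (h : t ∈ gridInterval s m a) :
    gridPoint s m a ≤ t ∧ t ≤ gridPoint s m (a + 1) := by
  rcases Nat.eq_zero_or_pos a with rfl | h0
  · exact mem_gridInterval_zero.1 h
  · exact ⟨((mem_gridInterval_pos h0).1 h).1.le, ((mem_gridInterval_pos h0).1 h).2⟩

lemma gridInterval_unique (hs : 0 < s.card) (hm : 1 ≤ m) {t : ℝ} {a b : ℕ} (hab : a < b)
    (hb : b ≤ s.card) (hta : t ∈ gridInterval s m a) : t ∉ gridInterval s m b := by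
  intro htb
  have h1 := (mem_gridInterval_bounds hta).2
  have h2 := ((mem_gridInterval_pos (by omega)).1 htb).1
  have h3 := gridPoint_mono (m := m) hs hm (show a + 1 ≤ b by omega) (by omega)
  linarith

lemma exists_mem_gridInterval {t : ℝ} (h1 : orderStat s 1 ≤ t)
    (h2 : t ≤ orderStat s s.card) : ∃ a ≤ s.card, t ∈ gridInterval s m a := by
  classical
  have hex : ∃ b, t ≤ gridPoint s m (b + 1) := ⟨s.card, by rwa [gridPoint_card_succ]⟩
  refine ⟨Nat.find hex, Nat.find_min' hex (by rwa [gridPoint_card_succ]), ?_⟩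
  rcases Nat.eq_zero_or_pos (Nat.find hex) with h0 | h0
  · have := Nat.find_spec hex
    rw [h0] at this ⊢
    exact mem_gridInterval_zero.2 ⟨by rwa [gridPoint_zero], this⟩
  · rw [mem_gridInterval_pos h0]
    refine ⟨?_, Nat.find_spec hex⟩
    have := Nat.find_min hex (m := Nat.find hex - 1) (by omega)
    rw [Nat.sub_add_cancel h0] at this
    exact not_le.1 this

/-- On the range of the data, the spacing density is the value on the one interval of the sub-grid
that contains the point. -/
lemma exists_spacingDensity_eq (hs : 0 < s.card) (hm : 1 ≤ m) {t : ℝ} (h1 : orderStat s 1 ≤ t)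
    (h2 : t ≤ orderStat s s.card) :
    ∃ a ≤ s.card, spacingDensity s m t = 2 * (m : ℝ) / (s.card * spacing s m a) ∧
      orderStat s ((a : ℤ) - m) ≤ t ∧ t ≤ orderStat s ((a : ℤ) + m) := by
  obtain ⟨a, ha, hta⟩ := exists_mem_gridInterval (m := m) h1 h2
  have hb := mem_gridInterval_bounds hta
  refine ⟨a, ha, ?_, (orderStat_le_gridPoint hm ha).trans hb.1,
    hb.2.trans (gridPoint_succ_le_orderStat hm ha)⟩
  rw [spacingDensity, Finset.sum_eq_single a, Set.indicator_of_mem hta]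
  · intro b hb hba
    rw [Finset.mem_range] at hb
    apply Set.indicator_of_notMem
    intro htb
    rcases lt_or_gt_of_ne hba with h | h
    · exact gridInterval_unique hs hm h ha htb hta
    · exact gridInterval_unique hs hm h (by omega) hta htb
  · intro h; exact absurd (Finset.mem_range.2 (by omega)) h

end Grid

/-! ### Sums over shifted ranks -/

/-- Each unit shift drops the first term, which is nonnegative, and adds one copy of the terminal
value. -/
lemma sum_shift_up_le (ψ : ℤ → ℝ) (h0 : ∀ r, 0 ≤ ψ r) (N : ℕ)
    (hup : ∀ r : ℤ, (N : ℤ) ≤ r → ψ r = ψ N) (h : ℕ) :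
    ∑ i ∈ Finset.range N, ψ ((i : ℤ) + 1 + h) ≤
      ∑ i ∈ Finset.range N, ψ ((i : ℤ) + 1) + h * ψ N := by
  induction h with
  | zero => simp
  | succ h ih =>
    have h1 := Finset.sum_range_succ' (fun i : ℕ => ψ ((i : ℤ) + 1 + h)) N
    have h2 := Finset.sum_range_succ (fun i : ℕ => ψ ((i : ℤ) + 1 + h)) N
    have h3 : ψ ((N : ℤ) + 1 + h) = ψ N := hup _ (by omega)
    have h4 := h0 (((0 : ℕ) : ℤ) + 1 + h)
    have h5 : ∑ i ∈ Finset.range N, ψ ((i : ℤ) + 1 + ((h + 1 : ℕ) : ℤ)) =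
        ∑ i ∈ Finset.range N, ψ (((i + 1 : ℕ) : ℤ) + 1 + h) :=
      Finset.sum_congr rfl fun i _ => by congr 1; push_cast; ring
    rw [h5]; push_cast at *; linarith

lemma sum_shift_down_le (ψ : ℤ → ℝ) (h0 : ∀ r, 0 ≤ ψ r) (N : ℕ)
    (hdown : ∀ r : ℤ, r ≤ 1 → ψ r = ψ 1) (h : ℕ) :
    ∑ i ∈ Finset.range N, ψ ((i : ℤ) + 1 - h) ≤
      ∑ i ∈ Finset.range N, ψ ((i : ℤ) + 1) + h * ψ 1 := by
  induction h with
  | zero => simp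
  | succ h ih =>
    have h1 := Finset.sum_range_succ' (fun i : ℕ => ψ ((i : ℤ) - h)) N
    have h2 := Finset.sum_range_succ (fun i : ℕ => ψ ((i : ℤ) - h)) N
    have h3 : ψ (((0 : ℕ) : ℤ) - h) = ψ 1 := hdown _ (by omega)
    have h4 := h0 ((N : ℤ) - h)
    have h5 : ∑ i ∈ Finset.range N, ψ ((i : ℤ) + 1 - ((h + 1 : ℕ) : ℤ)) =
        ∑ i ∈ Finset.range N, ψ ((i : ℤ) - h) :=
      Finset.sum_congr rfl fun i _ => by congr 1; push_cast; ring
    rw [h5]; push_cast at *; linarith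

/-- The sum telescopes: only the clamped values at the two ends survive the shifts. It says that
overlapping spacings cover the range of the data a bounded number of times, in proportion to their
width. -/
lemma sum_shift_sub_le (φ : ℤ → ℝ) (hφ : Monotone φ) (N : ℕ)
    (hdown : ∀ r : ℤ, r ≤ 1 → φ r = φ 1) (hup : ∀ r : ℤ, (N : ℤ) ≤ r → φ r = φ N) (h : ℕ) :
    ∑ i ∈ Finset.range N, (φ ((i : ℤ) + 1 + h) - φ ((i : ℤ) + 1 - h)) ≤
      2 * h * (φ N - φ 1) := by
  have hmin : ∀ r, φ 1 ≤ φ r := fun r => by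
    rcases le_total r 1 with h | h
    · exact (hdown r h).ge
    · exact hφ h
  have hmax : ∀ r, φ r ≤ φ N := fun r => by
    rcases le_total r N with h | h
    · exact hφ h
    · exact (hup r h).le
  have h1 := sum_shift_up_le (fun r => φ r - φ 1) (fun r => sub_nonneg.2 (hmin r)) N
    (fun r hr => by simp only [hup r hr]) h
  have h2 := sum_shift_down_le (fun r => φ N - φ r) (fun r => sub_nonneg.2 (hmax r)) N
    (fun r hr => by simp only [hdown r hr]) h
  simp only [Finset.sum_sub_distrib] at *
  linarith

lemma sum_Icc_one_eq_sum_range {M : Type*} [AddCommMonoid M] (F : ℕ → M) (N : ℕ) :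
    ∑ r ∈ Finset.Icc 1 N, F r = ∑ i ∈ Finset.range N, F (i + 1) := by
  rw [Finset.sum_bij' (i := fun r _ => r - 1) (j := fun i _ => i + 1)]
  all_goals intro a ha; simp only [Finset.mem_Icc, Finset.mem_range] at *
  any_goals omega
  congr 1; omega

/-! ### The spacing parameter -/

lemma spacingParam_le (N : ℕ) : (spacingParam N : ℝ) ≤ Real.sqrt N + 1 / 2 :=
  Nat.floor_le (by positivity)

lemma sqrt_lt_spacingParam (N : ℕ) : Real.sqrt N < spacingParam N + 1 / 2 := by
  have := Nat.lt_floor_add_one (Real.sqrt N + 1 / 2)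
  unfold spacingParam
  linarith

lemma one_le_spacingParam {N : ℕ} (hN : 1 ≤ N) : 1 ≤ spacingParam N := by
  have h1 : (1 : ℝ) ≤ Real.sqrt N := Real.one_le_sqrt.2 (by exact_mod_cast hN)
  exact Nat.le_floor (by push_cast; linarith)

lemma spacingParam_le_self {N : ℕ} (hN : 1 ≤ N) : spacingParam N ≤ N := by
  have h1 : Real.sqrt N ≤ N := by
    have h : (1 : ℝ) ≤ N := by exact_mod_cast hN
    rw [Real.sqrt_le_left (by positivity)]
    nlinarith
  have h2 := spacingParam_le N
  have h3 : (spacingParam N : ℝ) < N + 1 := by linarith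
  exact Nat.lt_succ_iff.1 (by exact_mod_cast h3)

/-! ### Sample points in a window of the sub-grid -/

section Window

variable {ι : Type*} {C : Finset ι} {y : ι → ℝ}

/-- Distinct values realise every rank, so the points of ranks `p0, p0 + 2, …` exist, with `p0` the
first rank from `p` on of the required parity. -/
lemma card_rank_parity (hy : Set.InjOn y C) {p q : ℕ} (hp : 1 ≤ p) (hq : q ≤ C.card) (e : ℕ)
    (he : e < 2) [DecidablePred fun v => (p ≤ rank C y v ∧ rank C y v ≤ q) ∧ rank C y v % 2 = e] :
    (q + 1 - p) / 2 ≤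
      (C.filter fun v => (p ≤ rank C y v ∧ rank C y v ≤ q) ∧ rank C y v % 2 = e).card := by
  classical
  rw [← Finset.card_range ((q + 1 - p) / 2)]
  set p0 := if p % 2 = e then p else p + 1 with hp0
  have hp0' : p0 % 2 = e ∧ p ≤ p0 ∧ p0 ≤ p + 1 := by
    rw [hp0]; split_ifs <;> omega
  have key : ∀ i ∈ Finset.range ((q + 1 - p) / 2), ∃ v ∈ C, rank C y v = p0 + 2 * i := by
    intro i hi
    rw [Finset.mem_range] at hi
    exact exists_rank_eq hy (by omega) (by omega)
  rcases C.eq_empty_or_nonempty with rfl | ⟨v0, -⟩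
  · simp only [Finset.card_empty] at hq
    rw [Finset.card_range, show (q + 1 - p) / 2 = 0 by omega]
    exact Nat.zero_le _
  have : Nonempty _ := ⟨v0⟩
  choose! g hg using key
  apply Finset.card_le_card_of_injOn g
  · intro i hi
    have hi' := Finset.mem_range.1 (Finset.mem_coe.1 hi)
    obtain ⟨h1, h2⟩ := hg i hi
    simp only [Finset.coe_filter, Set.mem_ofPred_eq, h1, h2, true_and]
    omega
  · intro i hi j hj hij
    have h1 := (hg i hi).2
    have h2 := (hg j hj).2
    rw [hij, h2] at h1
    omega

/-- A window of the sub-grid with a positive spacing contains at least `max 1 (m / 2)` sample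
points whose rank has a given parity. -/
lemma card_window_parity (hy : Set.InjOn y C) (hC : C.Nonempty) {a : ℕ} (ha : a ≤ C.card)
    (hpos : 0 < spacing (C.val.map y) (spacingParam C.card) a) (e : ℕ) (he : e < 2)
    [DecidablePred fun v => (orderStat (C.val.map y) ((a : ℤ) - spacingParam C.card) ≤ y v ∧
      y v ≤ orderStat (C.val.map y) ((a : ℤ) + spacingParam C.card)) ∧ rank C y v % 2 = e] :
    max 1 (spacingParam C.card / 2) ≤
      (C.filter fun v => (orderStat (C.val.map y) ((a : ℤ) - spacingParam C.card) ≤ y v ∧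
      y v ≤ orderStat (C.val.map y) ((a : ℤ) + spacingParam C.card)) ∧
        rank C y v % 2 = e).card := by
  classical
  set m := spacingParam C.card with hm
  have hN : 1 ≤ C.card := hC.card_pos
  have hm1 : 1 ≤ m := one_le_spacingParam hN
  have hmN : m ≤ C.card := spacingParam_le_self hN
  set s := C.val.map y with hs
  have hcard : s.card = C.card := by simp [hs]
  set p : ℕ := max 1 ((a : ℤ) - m).toNat with hp
  set q : ℕ := min C.card (a + m) with hq
  have hOSp : orderStat s ((a : ℤ) - m) = orderStat s p := by
    rcases le_total ((a : ℤ) - m) 1 with h | h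
    · rw [orderStat_of_le_one s h, orderStat_of_le_one s (r := p) (by omega)]
    · congr 1; omega
  have hOSq : orderStat s ((a : ℤ) + m) = orderStat s q := by
    rcases le_total (C.card : ℤ) ((a : ℤ) + m) with h | h
    · rw [orderStat_of_card_le s (by omega), orderStat_of_card_le s (r := q) (by omega)]
    · congr 1; omega
  -- A positive spacing makes the clamped window contain at least two ranks, hence one of each
  -- parity.
  have hpq : p < q := by
    by_contra hcon
    have := orderStat_mono s (show (q : ℤ) ≤ p by omega)
    rw [spacing, hOSp, hOSq] at hpos
    linarith
  have hcount := card_rank_parity hy (p := p) (q := q) (by omega) (by omega) e he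
  refine le_trans (le_trans ?_ hcount) (Finset.card_le_card ?_)
  · have : 1 ≤ (q + 1 - p) / 2 := by omega
    -- Even when clamped to `1, …, N`, the window retains at least `m` ranks, because `m ≤ N`.
    have h2 : m / 2 ≤ (q + 1 - p) / 2 := by
      apply Nat.div_le_div_right; omega
    exact max_le this h2
  · intro v hv
    simp only [Finset.mem_filter] at hv ⊢
    refine ⟨hv.1, ⟨?_, ?_⟩, hv.2.2⟩
    · rw [hOSp, orderStat_le_val_iff (by omega) (by omega)]
      exact_mod_cast hv.2.1.1
    · rw [hOSq, ← orderStat_rank (y := y) hv.1]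
      exact orderStat_mono _ (by exact_mod_cast hv.2.1.2)

/-- If `y v` lies in the window around `a`, then the rank of `v` is within `m` of `a`. -/
lemma rank_mem_window (hy : Set.InjOn y C) {v : ι} (hv : v ∈ C) {a m : ℕ} (hm : 1 ≤ m) (ha : a ≤ C.card)
    (h1 : orderStat (C.val.map y) ((a : ℤ) - m) ≤ y v)
    (h2 : y v ≤ orderStat (C.val.map y) ((a : ℤ) + m)) :
    (a : ℤ) - m ≤ rank C y v ∧ (rank C y v : ℤ) ≤ a + m := by
  constructor
  · rcases le_total ((a : ℤ) - m) 1 with h | h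
    · have := one_le_rank (y := y) hv; omega
    · exact (orderStat_le_val_iff h (by omega)).1 h1
  · rcases le_total (C.card : ℤ) ((a : ℤ) + m) with h | h
    · have := rank_le_card C y v; omega
    · obtain ⟨w, hw, hwr⟩ := exists_rank_eq hy (r := a + m) (by omega) (by omega)
      have h3 := orderStat_rank (y := y) hw
      rw [hwr] at h3
      push_cast at h3
      rw [h3] at h2
      have := rank_le_rank (C := C) h2
      omega

end Window

end PSS

namespace PSS

noncomputable section

/-! ### Products of independent terms -/

/-- Tonelli, one coordinate at a time. -/
lemma lmarginal_prod_le {n : ℕ} {α : Type*} [MeasurableSpace α] (μ : Measure α) [SigmaFinite μ]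
    (B : Finset (Fin n)) (g : Fin n → α → ℝ≥0∞) (hg : ∀ v, Measurable (g v)) (x : Fin n → α) :
    lmarginal (fun _ => μ) B (fun y => ∏ v ∈ B, g v (y v)) x = ∏ v ∈ B, ∫⁻ t, g v t ∂μ := by
  classical
  induction B using Finset.induction_on generalizing x with
  | empty => simp
  | insert i s hi ih =>
    have hm : Measurable fun y : Fin n → α => ∏ v ∈ insert i s, g v (y v) :=
      Finset.measurable_prod _ fun v _ => (hg v).comp (measurable_pi_apply v)
    rw [lmarginal_insert' _ hm hi]
    have h1 : (fun x : Fin n → α => ∫⁻ t, ∏ v ∈ insert i s, g v (Function.update x i t v) ∂μ)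
        = fun x => (∫⁻ t, g i t ∂μ) * ∏ v ∈ s, g v (x v) := by
      ext x
      rw [← lintegral_mul_const _ (hg i)]
      refine lintegral_congr fun t => ?_
      rw [Finset.prod_insert hi, Function.update_self]
      congr 1
      refine Finset.prod_congr rfl fun v hv => ?_
      rw [Function.update_of_ne (by rintro rfl; exact hi hv)]
    rw [h1, Finset.prod_insert hi, ← ih x]
    unfold lmarginal
    rw [lintegral_const_mul]
    exact (Finset.measurable_prod _ fun v _ => (hg v).comp (measurable_pi_apply v)).comp
      measurable_updateFinset

/-- Decoupling: if `ψ t y` does not depend on the coordinates of `y` in `B` and integrates to at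
most `K` in `t`, then the product of the `ψ (y v) y`, `v ∈ B`, integrates to at most `K ^ |B|`. -/
theorem lintegral_prod_decouple {n : ℕ} {α : Type*} [MeasurableSpace α] (μ : Measure α)
    [IsProbabilityMeasure μ] (B : Finset (Fin n)) (ψ : Fin n → α → (Fin n → α) → ℝ≥0∞)
    (hm : ∀ v, Measurable (Function.uncurry (ψ v)))
    (hdep : ∀ v t y y', (∀ u ∉ B, y u = y' u) → ψ v t y = ψ v t y') (K : ℝ≥0∞)
    (hK : ∀ v y, ∫⁻ t, ψ v t y ∂μ ≤ K) :
    ∫⁻ y, ∏ v ∈ B, ψ v (y v) y ∂(Measure.pi fun _ : Fin n => μ) ≤ K ^ B.card := by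
  classical
  have hmeas : Measurable fun y : Fin n → α => ∏ v ∈ B, ψ v (y v) y :=
    Finset.measurable_prod _ fun v _ =>
      Measurable.comp (g := Function.uncurry (ψ v)) (f := fun y : Fin n → α => (y v, y)) (hm v)
        ((measurable_pi_apply v).prodMk measurable_id)
  calc ∫⁻ y, ∏ v ∈ B, ψ v (y v) y ∂(Measure.pi fun _ : Fin n => μ)
      ≤ ∫⁻ y, K ^ B.card ∂(Measure.pi fun _ : Fin n => μ) := by
        refine lintegral_le_of_lmarginal_le B hmeas measurable_const ?_
        intro x
        -- With the coordinates outside `B` frozen at `x`, the second argument of `ψ` may be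
        -- replaced by `x`, and the factors become functions of separate variables.
        have h1 : lmarginal (fun _ => μ) B (fun y => ∏ v ∈ B, ψ v (y v) y) x =
            lmarginal (fun _ => μ) B (fun y => ∏ v ∈ B, ψ v (y v) x) x := by
          unfold lmarginal
          refine lintegral_congr fun z => Finset.prod_congr rfl fun v _ => ?_
          exact hdep _ _ _ _ fun u hu => by simp [Function.updateFinset, hu]
        rw [h1, lmarginal_prod_le μ B (fun v t => ψ v t x) (fun v =>
          (hm v).comp (measurable_id.prodMk measurable_const))]
        have h2 : lmarginal (fun _ => μ) B (fun _ : Fin n → α => K ^ B.card) x = K ^ B.card := by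
          unfold lmarginal; simp
        rw [h2]
        exact Finset.prod_le_pow_card _ _ _ fun v _ => hK v x
    _ = K ^ B.card := by simp

/-! ### The reference measure -/

/-- The measure with density `1 / (1 + t²)`. -/
def refMeasure : Measure ℝ := volume.withDensity fun t => ENNReal.ofReal (1 / (1 + t ^ 2))

lemma measurable_refDensity : Measurable fun t : ℝ => ENNReal.ofReal (1 / (1 + t ^ 2)) := by
  fun_prop

/-- Change of variables by `arctan`, whose derivative is the reference density. Reference lengths of
intervals are therefore differences of arctangents, and the total mass is at most `π`. -/
lemma refMeasure_apply {s : Set ℝ} (hs : MeasurableSet s) :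
    refMeasure s = volume (Real.arctan '' s) := by
  rw [refMeasure, withDensity_apply _ hs]
  have := lintegral_image_eq_lintegral_abs_deriv_mul (f := Real.arctan)
    (f' := fun x => 1 / (1 + x ^ 2)) hs
    (fun x _ => (Real.hasDerivAt_arctan x).hasDerivWithinAt) Real.arctan_injective.injOn
    (fun _ => 1)
  simp only [lintegral_const, MeasurableSet.univ, Measure.restrict_apply, Set.univ_inter, one_mul,
    mul_one] at this
  rw [this]
  refine lintegral_congr fun x => ?_
  rw [abs_of_nonneg (by positivity)]

lemma refMeasure_univ_le : refMeasure Set.univ ≤ ENNReal.ofReal Real.pi := by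
  rw [refMeasure_apply MeasurableSet.univ]
  refine (measure_mono (t := Set.Ioo (-(Real.pi / 2)) (Real.pi / 2)) ?_).trans ?_
  · rintro _ ⟨x, -, rfl⟩
    exact ⟨Real.neg_pi_div_two_lt_arctan x, Real.arctan_lt_pi_div_two x⟩
  · rw [Real.volume_Ioo]; apply le_of_eq; congr 1; ring

instance : IsFiniteMeasure refMeasure :=
  ⟨refMeasure_univ_le.trans_lt ENNReal.ofReal_lt_top⟩

lemma refMeasure_near_le (a u : ℝ) :
    refMeasure {s | |a - Real.arctan s| ≤ u} ≤ ENNReal.ofReal (2 * u) := by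
  rw [refMeasure_apply (measurableSet_le (by fun_prop) measurable_const)]
  refine (measure_mono (t := Set.Icc (a - u) (a + u)) ?_).trans ?_
  · rintro _ ⟨x, hx, rfl⟩
    have := abs_le.1 (show |a - Real.arctan x| ≤ u by simpa using hx)
    exact ⟨by linarith, by linarith⟩
  · rw [Real.volume_Icc]; apply le_of_eq; congr 1; ring

lemma le_refMeasure_Icc {a b : ℝ} (hab : a ≤ b) :
    Real.arctan b - Real.arctan a ≤ refMeasure.real (Set.Icc a b) := by
  rw [Measure.real, refMeasure_apply measurableSet_Icc]
  have h : Set.Icc (Real.arctan a) (Real.arctan b) ⊆ Real.arctan '' Set.Icc a b :=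
    intermediate_value_Icc hab Real.continuous_arctan.continuousOn
  have h2 := measure_mono (μ := volume) h
  rw [Real.volume_Icc] at h2
  rw [← ENNReal.ofReal_le_iff_le_toReal] 
  · exact h2
  · rw [← refMeasure_apply measurableSet_Icc]; exact measure_ne_top _ _

variable {d : ℕ}

/-- The reference density on `ℝ^d`. -/
def refDensity (t : Fin d → ℝ) : ℝ := ∏ j, (1 / (1 + t j ^ 2))

lemma refDensity_pos (t : Fin d → ℝ) : 0 < refDensity t :=
  Finset.prod_pos fun j _ => by positivity

lemma measurable_refDensity_pi : Measurable (refDensity (d := d)) := by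
  unfold refDensity; fun_prop

/-- The reference measure on `ℝ^d`. -/
def refPi (d : ℕ) : Measure (Fin d → ℝ) := Measure.pi fun _ => refMeasure

instance : IsFiniteMeasure (refPi d) := by unfold refPi; infer_instance

lemma refPi_eq_withDensity :
    refPi d = (volume : Measure (Fin d → ℝ)).withDensity
      fun t => ENNReal.ofReal (refDensity t) := by
  classical
  refine Measure.pi_eq fun S hS => ?_
  rw [withDensity_apply _ (MeasurableSet.univ_pi hS), ← lintegral_indicator (MeasurableSet.univ_pi hS)]
  have h1 : ∀ t : Fin d → ℝ, (Set.univ.pi S).indicator (fun t => ENNReal.ofReal (refDensity t)) t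
      = ∏ j, (S j).indicator (fun s => ENNReal.ofReal (1 / (1 + s ^ 2))) (t j) := by
    intro t
    by_cases ht : t ∈ Set.univ.pi S
    · rw [Set.indicator_of_mem ht, refDensity, ENNReal.ofReal_prod_of_nonneg
        (fun j _ => by positivity)]
      exact Finset.prod_congr rfl fun j _ => by
        rw [Set.indicator_of_mem (ht j (Set.mem_univ j))]
    · rw [Set.indicator_of_notMem ht]
      simp only [Set.mem_pi, Set.mem_univ, true_imp_iff, not_forall] at ht
      obtain ⟨j, hj⟩ := ht
      exact (Finset.prod_eq_zero (Finset.mem_univ j) (Set.indicator_of_notMem hj _)).symm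
  simp_rw [h1]
  have h2 := lmarginal_prod_le (volume : Measure ℝ) Finset.univ
    (fun j : Fin d => (S j).indicator fun s => ENNReal.ofReal (1 / (1 + s ^ 2)))
    (fun j => measurable_refDensity.indicator (hS j)) (fun _ => 0)
  rw [← lintegral_eq_lmarginal_univ] at h2
  rw [volume_pi, h2]
  exact Finset.prod_congr rfl fun j _ => by
    rw [lintegral_indicator (hS j), refMeasure, withDensity_apply _ (hS j)]

lemma refPi_univ_le : refPi d Set.univ ≤ ENNReal.ofReal (Real.pi ^ d) := by
  rw [refPi, Measure.pi_univ, ENNReal.ofReal_pow Real.pi_pos.le]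
  exact (Finset.prod_le_pow_card _ _ _ fun j _ => refMeasure_univ_le).trans (by simp)

/-! ### Cells of a grid -/

/-- The number of the segment containing `s` when `[lo, hi]` is divided into `ℓ` segments. -/
def segIndex (lo hi : ℝ) (ℓ : ℕ) (s : ℝ) : ℕ := min ⌊(s - lo) / ((hi - lo) / ℓ)⌋₊ (ℓ - 1)

variable {n : ℕ}

/-- Lower end of the range of the points with index in `E`. -/
def lowOn (E : Finset (Fin n)) (y : Fin n → Fin d → ℝ) (j : Fin d) : ℝ := ⨅ v : E, y v j

/-- Upper end of the range of the points with index in `E`. -/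
def highOn (E : Finset (Fin n)) (y : Fin n → Fin d → ℝ) (j : Fin d) : ℝ := ⨆ v : E, y v j

/-- The index of the cell containing `t`, for the grid given by the points with index in `E`. -/
def cellOn (E : Finset (Fin n)) (y : Fin n → Fin d → ℝ) (ℓ : ℕ) (t : Fin d → ℝ) : Fin d → ℕ :=
  fun j => segIndex (lowOn E y j) (highOn E y j) ℓ (t j)

lemma lowOn_congr {E : Finset (Fin n)} {y y' : Fin n → Fin d → ℝ} (h : ∀ v ∈ E, y v = y' v)
    (j : Fin d) : lowOn E y j = lowOn E y' j := by
  unfold lowOn; congr 1; ext v; rw [h v v.2]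

lemma highOn_congr {E : Finset (Fin n)} {y y' : Fin n → Fin d → ℝ} (h : ∀ v ∈ E, y v = y' v)
    (j : Fin d) : highOn E y j = highOn E y' j := by
  unfold highOn; congr 1; ext v; rw [h v v.2]

lemma cellOn_congr {E : Finset (Fin n)} {y y' : Fin n → Fin d → ℝ} (h : ∀ v ∈ E, y v = y' v)
    (ℓ : ℕ) (t : Fin d → ℝ) : cellOn E y ℓ t = cellOn E y' ℓ t := by
  ext j; simp only [cellOn, lowOn_congr h, highOn_congr h]

lemma measurable_lowOn (E : Finset (Fin n)) (j : Fin d) :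
    Measurable fun y : Fin n → Fin d → ℝ => lowOn E y j :=
  Measurable.iInf fun v => (measurable_pi_apply j).comp (measurable_pi_apply (v : Fin n))

lemma measurable_highOn (E : Finset (Fin n)) (j : Fin d) :
    Measurable fun y : Fin n → Fin d → ℝ => highOn E y j :=
  Measurable.iSup fun v => (measurable_pi_apply j).comp (measurable_pi_apply (v : Fin n))

lemma _root_.Measurable.segIndex {α : Type*} [MeasurableSpace α] {lo hi s : α → ℝ}
    (hlo : Measurable lo) (hhi : Measurable hi) (hs : Measurable s) (ℓ : ℕ) :
    Measurable fun a => segIndex (lo a) (hi a) ℓ (s a) := by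
  unfold PSS.segIndex
  exact (Nat.measurable_floor.comp ((hs.sub hlo).div ((hhi.sub hlo).div_const _))).min
    measurable_const

lemma _root_.Measurable.cellOn {α : Type*} [MeasurableSpace α] (E : Finset (Fin n)) (ℓ : ℕ)
    {y : α → Fin n → Fin d → ℝ} {t : α → Fin d → ℝ} (hy : Measurable y) (ht : Measurable t) :
    Measurable fun a => cellOn E (y a) ℓ (t a) :=
  measurable_pi_lambda _ fun j =>
    ((measurable_lowOn E j).comp hy).segIndex ((measurable_highOn E j).comp hy)
      ((measurable_pi_apply j).comp ht) ℓ

end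

end PSS

namespace PSS

noncomputable section

variable {d n : ℕ}

/-! ### The comparison potential -/

/-- The number of points with index in `E` in the cell of `t`. -/
def cellCnt (E : Finset (Fin n)) (y : Fin n → Fin d → ℝ) (ℓ : ℕ) (t : Fin d → ℝ) : ℕ :=
  (E.filter fun e => cellOn E y ℓ (y e) = cellOn E y ℓ t).card

/-- The `j`-th side of the cell of `t`. -/
def segSet (E : Finset (Fin n)) (y : Fin n → Fin d → ℝ) (ℓ : ℕ) (t : Fin d → ℝ) (j : Fin d) :
    Set ℝ :=
  {s | segIndex (lowOn E y j) (highOn E y j) ℓ s = cellOn E y ℓ t j}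

/-- The cell of `t`. -/
def cellSet (E : Finset (Fin n)) (y : Fin n → Fin d → ℝ) (ℓ : ℕ) (t : Fin d → ℝ) :
    Set (Fin d → ℝ) :=
  {t' | cellOn E y ℓ t' = cellOn E y ℓ t}

lemma mem_segSet {E : Finset (Fin n)} {y : Fin n → Fin d → ℝ} {ℓ : ℕ} {t : Fin d → ℝ} {j : Fin d}
    {s : ℝ} : s ∈ segSet E y ℓ t j ↔
      segIndex (lowOn E y j) (highOn E y j) ℓ s = cellOn E y ℓ t j := Iff.rfl

lemma mem_cellSet {E : Finset (Fin n)} {y : Fin n → Fin d → ℝ} {ℓ : ℕ} {t t' : Fin d → ℝ} :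
    t' ∈ cellSet E y ℓ t ↔ cellOn E y ℓ t' = cellOn E y ℓ t := Iff.rfl

lemma cellSet_eq_pi (E : Finset (Fin n)) (y : Fin n → Fin d → ℝ) (ℓ : ℕ) (t : Fin d → ℝ) :
    cellSet E y ℓ t = Set.univ.pi (segSet E y ℓ t) := by
  ext t'
  simp only [mem_cellSet, Set.mem_univ_pi, mem_segSet]
  exact funext_iff

lemma measurableSet_segSet (E : Finset (Fin n)) (y : Fin n → Fin d → ℝ) (ℓ : ℕ) (t : Fin d → ℝ)
    (j : Fin d) : MeasurableSet (segSet E y ℓ t j) :=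
  (measurable_const.segIndex measurable_const measurable_id ℓ) (measurableSet_singleton _)

lemma measurableSet_cellSet (E : Finset (Fin n)) (y : Fin n → Fin d → ℝ) (ℓ : ℕ)
    (t : Fin d → ℝ) : MeasurableSet (cellSet E y ℓ t) := by
  rw [cellSet_eq_pi]
  exact MeasurableSet.univ_pi fun j => measurableSet_segSet E y ℓ t j

/-- The number of neighbours used at a point of a cell with `c` points. -/
def nbrCount (c : ℕ) : ℕ := max 1 ⌊Real.sqrt c / 4⌋₊

/-- The radius at which a cell is expected to contain `nbrCount` points. -/
def nbrRadius (E : Finset (Fin n)) (y : Fin n → Fin d → ℝ) (ℓ : ℕ) (j : Fin d) (t : Fin d → ℝ) :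
    ℝ :=
  refMeasure.real (segSet E y ℓ t j) * (nbrCount (cellCnt E y ℓ t) / cellCnt E y ℓ t)

/-- The contribution of a sample point to the potential. -/
def nbrWeight (E : Finset (Fin n)) (y : Fin n → Fin d → ℝ) (ℓ : ℕ) (j : Fin d)
    (x t : Fin d → ℝ) : ℝ≥0∞ :=
  if cellOn E y ℓ x = cellOn E y ℓ t then
    (refPi d (cellSet E y ℓ x))⁻¹ *
      -- The weights `2 ^ p` at the radii `r / 4 ^ p` form a step function comparable to `√(r /
      -- distance)`: singular at distance zero, yet integrable.
      (1 + ∑' p : ℕ, if |Real.arctan (x j) - Real.arctan (t j)| ≤ nbrRadius E y ℓ j x / 4 ^ p then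
        ENNReal.ofReal (2 ^ p * (cellCnt E y ℓ x / nbrCount (cellCnt E y ℓ x))) else 0)
  else 0

/-- A random function, built from the points with index in `E`, that dominates the square root
of the `j`-th factor of the spacing estimator. -/
def potential (f : (Fin d → ℝ) → ℝ) (ℓ : ℕ) (j : Fin d) (E : Finset (Fin n)) (t : Fin d → ℝ)
    (y : Fin n → Fin d → ℝ) : ℝ≥0∞ :=
  -- The quotient turns integration against `f dx` into integration against the reference measure.
  ENNReal.ofReal (refDensity t / f t) * ((n : ℝ≥0∞)⁻¹ * ∑ e ∈ E, nbrWeight E y ℓ j (y e) t)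

section Congr

variable {E : Finset (Fin n)} {y y' : Fin n → Fin d → ℝ}

lemma cellCnt_congr (h : ∀ v ∈ E, y v = y' v) (ℓ : ℕ) (t : Fin d → ℝ) :
    cellCnt E y ℓ t = cellCnt E y' ℓ t := by
  unfold cellCnt
  congr 1
  refine Finset.filter_congr fun e he => ?_
  rw [cellOn_congr h, cellOn_congr h, h e he]

lemma segSet_congr (h : ∀ v ∈ E, y v = y' v) (ℓ : ℕ) (t : Fin d → ℝ) (j : Fin d) :
    segSet E y ℓ t j = segSet E y' ℓ t j := by
  unfold segSet
  rw [lowOn_congr h, highOn_congr h, cellOn_congr h]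

lemma cellSet_congr (h : ∀ v ∈ E, y v = y' v) (ℓ : ℕ) (t : Fin d → ℝ) :
    cellSet E y ℓ t = cellSet E y' ℓ t := by
  rw [cellSet_eq_pi, cellSet_eq_pi]
  congr 1
  ext1 j
  exact segSet_congr h ℓ t j

lemma nbrRadius_congr (h : ∀ v ∈ E, y v = y' v) (ℓ : ℕ) (j : Fin d) (t : Fin d → ℝ) :
    nbrRadius E y ℓ j t = nbrRadius E y' ℓ j t := by
  unfold nbrRadius
  rw [segSet_congr h, cellCnt_congr h]

lemma nbrWeight_congr (h : ∀ v ∈ E, y v = y' v) (ℓ : ℕ) (j : Fin d) (x t : Fin d → ℝ) :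
    nbrWeight E y ℓ j x t = nbrWeight E y' ℓ j x t := by
  unfold nbrWeight
  rw [cellOn_congr h, cellOn_congr h, cellSet_congr h, nbrRadius_congr h, cellCnt_congr h]

lemma potential_congr (f : (Fin d → ℝ) → ℝ) (h : ∀ v ∈ E, y v = y' v) (ℓ : ℕ) (j : Fin d)
    (t : Fin d → ℝ) : potential f ℓ j E t y = potential f ℓ j E t y' := by
  unfold potential
  congr 2
  refine Finset.sum_congr rfl fun e he => ?_
  rw [nbrWeight_congr h, h e he]

end Congr

section Meas

variable {α : Type*} [MeasurableSpace α] (E : Finset (Fin n)) (ℓ : ℕ)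
  {y : α → Fin n → Fin d → ℝ} {t x : α → Fin d → ℝ}

lemma _root_.Measurable.cellCnt (hy : Measurable y) (ht : Measurable t) :
    Measurable fun a => cellCnt E (y a) ℓ (t a) := by
  unfold PSS.cellCnt
  simp_rw [Finset.card_filter]
  refine Finset.measurable_sum _ fun e _ => Measurable.ite ?_ measurable_const measurable_const
  exact measurableSet_eq_fun (Measurable.cellOn E ℓ hy ((measurable_pi_apply e).comp hy))
    (Measurable.cellOn E ℓ hy ht)

lemma measurable_refMeasure_segSet (hy : Measurable y) (ht : Measurable t) (j : Fin d) :
    Measurable fun a => refMeasure (segSet E (y a) ℓ (t a) j) := by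
  have hm : MeasurableSet {p : α × ℝ | segIndex (lowOn E (y p.1) j) (highOn E (y p.1) j) ℓ p.2
      = cellOn E (y p.1) ℓ (t p.1) j} := by
    refine measurableSet_eq_fun ?_ ?_
    · exact ((measurable_lowOn E j).comp (hy.comp measurable_fst)).segIndex
        ((measurable_highOn E j).comp (hy.comp measurable_fst)) measurable_snd ℓ
    · exact (measurable_pi_apply j).comp
        (Measurable.cellOn E ℓ (hy.comp measurable_fst) (ht.comp measurable_fst))
  exact measurable_measure_prodMk_left hm

lemma measurable_refPi_cellSet (hy : Measurable y) (ht : Measurable t) :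
    Measurable fun a => refPi d (cellSet E (y a) ℓ (t a)) := by
  simp_rw [cellSet_eq_pi, refPi, Measure.pi_pi]
  exact Finset.measurable_prod _ fun j _ => measurable_refMeasure_segSet E ℓ hy ht j

lemma _root_.Measurable.nbrRadius (hy : Measurable y) (ht : Measurable t) (j : Fin d) :
    Measurable fun a => nbrRadius E (y a) ℓ j (t a) := by
  unfold PSS.nbrRadius
  have h1 : Measurable fun a => refMeasure.real (segSet E (y a) ℓ (t a) j) :=
    (measurable_refMeasure_segSet E ℓ hy ht j).ennreal_toReal
  have h2 : Measurable fun a =>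
      ((nbrCount (cellCnt E (y a) ℓ (t a)) : ℝ) / cellCnt E (y a) ℓ (t a)) :=
    (measurable_of_countable fun c : ℕ => ((nbrCount c : ℝ) / c)).comp
      (Measurable.cellCnt E ℓ hy ht)
  exact h1.mul h2

lemma _root_.Measurable.nbrWeight (hy : Measurable y) (hx : Measurable x) (ht : Measurable t)
    (j : Fin d) : Measurable fun a => nbrWeight E (y a) ℓ j (x a) (t a) := by
  unfold PSS.nbrWeight
  refine Measurable.ite (measurableSet_eq_fun (Measurable.cellOn E ℓ hy hx)
    (Measurable.cellOn E ℓ hy ht)) ?_ measurable_const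
  refine (measurable_refPi_cellSet E ℓ hy hx).inv.mul (Measurable.const_add ?_ 1)
  refine Measurable.tsum fun p => Measurable.ite ?_ ?_ measurable_const
  · refine measurableSet_le ?_ ((Measurable.nbrRadius E ℓ hy hx j).div_const _)
    have h1 := (measurable_pi_apply j).comp hx
    have h2 := (measurable_pi_apply j).comp ht
    exact ((Real.measurable_arctan.comp h1).sub (Real.measurable_arctan.comp h2)).abs
  · exact (measurable_of_countable fun c : ℕ => ENNReal.ofReal (2 ^ p * ((c : ℝ) / nbrCount c))).comp
      (Measurable.cellCnt E ℓ hy hx)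

lemma _root_.Measurable.potential {f : (Fin d → ℝ) → ℝ} (hf : Measurable f) (hy : Measurable y)
    (ht : Measurable t) (j : Fin d) :
    Measurable fun a => potential f ℓ j E (t a) (y a) := by
  unfold PSS.potential
  refine ((measurable_refDensity_pi.comp ht).div (hf.comp ht)).ennreal_ofReal.mul
    (measurable_const.mul ?_)
  exact Finset.measurable_sum _ fun e _ =>
    Measurable.nbrWeight E ℓ hy ((measurable_pi_apply e).comp hy) ht j

end Meas

/-- A cell is a product and the constraint cuts only its `j`-th side. The inequality is multiplied
through by the measure of that side so as not to divide by a possible zero. -/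
lemma refPi_near_le (E : Finset (Fin n)) (y : Fin n → Fin d → ℝ) (ℓ : ℕ) (x : Fin d → ℝ)
    (j : Fin d) (a u : ℝ) :
    refPi d {t | cellOn E y ℓ x = cellOn E y ℓ t ∧ |a - Real.arctan (t j)| ≤ u} *
      refMeasure (segSet E y ℓ x j) ≤ refPi d (cellSet E y ℓ x) * ENNReal.ofReal (2 * u) := by
  classical
  have h1 : {t | cellOn E y ℓ x = cellOn E y ℓ t ∧ |a - Real.arctan (t j)| ≤ u} =
      Set.univ.pi (Function.update (segSet E y ℓ x) j
        (segSet E y ℓ x j ∩ {s | |a - Real.arctan s| ≤ u})) := by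
    ext t
    have h2 : cellOn E y ℓ x = cellOn E y ℓ t ↔ ∀ i, t i ∈ segSet E y ℓ x i := by
      rw [eq_comm, ← mem_cellSet, cellSet_eq_pi, Set.mem_univ_pi]
    rw [Set.mem_univ_pi]
    constructor
    · rintro ⟨h3, h4⟩ i
      rw [h2] at h3
      by_cases hi : i = j
      · subst hi; rw [Function.update_self]; exact ⟨h3 i, h4⟩
      · rw [Function.update_of_ne hi]; exact h3 i
    · intro h3
      have hj := h3 j
      rw [Function.update_self] at hj
      refine ⟨h2.2 fun i => ?_, hj.2⟩
      by_cases hi : i = j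
      · subst hi; exact hj.1
      · have := h3 i; rwa [Function.update_of_ne hi] at this
  rw [h1, cellSet_eq_pi, refPi, Measure.pi_pi, Measure.pi_pi,
    ← Finset.mul_prod_erase _ _ (Finset.mem_univ j),
    ← Finset.mul_prod_erase (f := fun i => refMeasure (segSet E y ℓ x i)) _ (Finset.mem_univ j),
    Function.update_self]
  have h3 : ∏ i ∈ Finset.univ.erase j, refMeasure (Function.update (segSet E y ℓ x) j
      (segSet E y ℓ x j ∩ {s | |a - Real.arctan s| ≤ u}) i) =
      ∏ i ∈ Finset.univ.erase j, refMeasure (segSet E y ℓ x i) :=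
    Finset.prod_congr rfl fun i hi => by
      rw [Function.update_of_ne (Finset.ne_of_mem_erase hi)]
  rw [h3]
  have h4 : refMeasure (segSet E y ℓ x j ∩ {s | |a - Real.arctan s| ≤ u}) ≤
      ENNReal.ofReal (2 * u) := (measure_mono Set.inter_subset_right).trans (refMeasure_near_le a u)
  calc _ = refMeasure (segSet E y ℓ x j ∩ {s | |a - Real.arctan s| ≤ u}) *
        (refMeasure (segSet E y ℓ x j) * ∏ i ∈ Finset.univ.erase j, refMeasure (segSet E y ℓ x i)) := by
        ring
    _ ≤ ENNReal.ofReal (2 * u) *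
        (refMeasure (segSet E y ℓ x j) * ∏ i ∈ Finset.univ.erase j, refMeasure (segSet E y ℓ x i)) := by
        gcongr
    _ = _ := by ring

/-- The constant term contributes at most 1. The radius is chosen so that the factor `c / q`
cancels, and the `p`-th term contributes at most `2 ^ p * (2 / 4 ^ p) = 2 * 2⁻¹ ^ p`; these add up
to 4. -/
lemma lintegral_nbrWeight_le (E : Finset (Fin n)) (y : Fin n → Fin d → ℝ) (ℓ : ℕ) (j : Fin d)
    (x : Fin d → ℝ) : ∫⁻ t, nbrWeight E y ℓ j x t ∂(refPi d) ≤ 5 := by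
  set A := cellSet E y ℓ x with hA
  set c : ℝ := (cellCnt E y ℓ x : ℝ) with hc
  set q : ℝ := (nbrCount (cellCnt E y ℓ x) : ℝ) with hq
  have hq1 : 1 ≤ q := by rw [hq]; exact_mod_cast le_max_left _ _
  have hc0 : 0 ≤ c := Nat.cast_nonneg _
  set r := nbrRadius E y ℓ j x with hr
  have hr0 : 0 ≤ r := by rw [hr, nbrRadius]; positivity
  set Np : ℕ → Set (Fin d → ℝ) := fun p =>
    {t | cellOn E y ℓ x = cellOn E y ℓ t ∧ |Real.arctan (x j) - Real.arctan (t j)| ≤ r / 4 ^ p}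
    with hNp
  have hNm : ∀ p, MeasurableSet (Np p) := fun p => by
    refine (measurableSet_eq_fun measurable_const
      (Measurable.cellOn E ℓ measurable_const measurable_id)).inter ?_
    have : Measurable fun t : Fin d → ℝ => |Real.arctan (x j) - Real.arctan (t j)| := by fun_prop
    exact measurableSet_le this measurable_const
  have hAm : MeasurableSet A := measurableSet_cellSet E y ℓ x
  have h1 : ∀ t, nbrWeight E y ℓ j x t = (refPi d A)⁻¹ * (A.indicator 1 t +
      ∑' p : ℕ, (Np p).indicator (fun _ => ENNReal.ofReal (2 ^ p * (c / q))) t) := by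
    intro t
    unfold nbrWeight
    by_cases h : cellOn E y ℓ x = cellOn E y ℓ t
    · rw [if_pos h, Set.indicator_of_mem (show t ∈ A from h.symm)]
      simp only [Pi.one_apply, Set.indicator_apply, hNp]
      congr 3
      ext p
      congr 1
      exact propext ⟨fun h' => ⟨h, h'⟩, fun h' => h'.2⟩
    · have h2 : t ∉ A := fun h' => h (mem_cellSet.1 h').symm
      have h3 : ∀ p, t ∉ Np p := fun p h' => h h'.1
      rw [if_neg h, Set.indicator_of_notMem h2]
      simp [Set.indicator_of_notMem (h3 _)]
  simp_rw [h1]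
  have hmt : Measurable fun t => ∑' p : ℕ,
      (Np p).indicator (fun _ => ENNReal.ofReal (2 ^ p * (c / q))) t :=
    Measurable.tsum fun p => measurable_const.indicator (hNm p)
  have hma : Measurable fun t => A.indicator (1 : (Fin d → ℝ) → ℝ≥0∞) t :=
    measurable_one.indicator hAm
  rw [lintegral_const_mul _ (Measurable.add hma hmt : Measurable fun t => A.indicator 1 t + _),
    lintegral_add_left hma, lintegral_indicator_one hAm,
    lintegral_tsum fun p => (measurable_const.indicator (hNm p)).aemeasurable, mul_add]
  simp_rw [lintegral_indicator_const (hNm _)]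
  rw [← ENNReal.tsum_mul_left]
  have h5 : ∀ p : ℕ, (refPi d A)⁻¹ * (ENNReal.ofReal (2 ^ p * (c / q)) * refPi d (Np p)) ≤
      2 * (2⁻¹ : ℝ≥0∞) ^ p := by
    intro p
    rcases hc0.eq_or_lt with h0 | h0
    · rw [← h0]; simp
    by_cases hA0 : refPi d A = 0
    · have : refPi d (Np p) = 0 :=
        measure_mono_null (fun t ht => show t ∈ A from ht.1.symm) hA0
      rw [this]; simp
    have hκ0 : refMeasure (segSet E y ℓ x j) ≠ 0 := by
      intro h0
      apply hA0
      rw [hA, cellSet_eq_pi, refPi, Measure.pi_pi]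
      exact Finset.prod_eq_zero (Finset.mem_univ j) h0
    have hκt : refMeasure (segSet E y ℓ x j) ≠ ∞ := measure_ne_top _ _
    have hAt : refPi d A ≠ ∞ := measure_ne_top _ _
    have h6 := refPi_near_le E y ℓ x j (Real.arctan (x j)) (r / 4 ^ p)
    have h7 : ENNReal.ofReal (2 ^ p * (c / q)) * ENNReal.ofReal (2 * (r / 4 ^ p)) =
        refMeasure (segSet E y ℓ x j) * (2 * (2⁻¹ : ℝ≥0∞) ^ p) := by
      rw [← ENNReal.ofReal_mul (by positivity)]
      have : 2 ^ p * (c / q) * (2 * (r / 4 ^ p)) =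
          refMeasure.real (segSet E y ℓ x j) * (2 * (2⁻¹) ^ p) := by
        rw [hr, nbrRadius, ← hc, ← hq, show (4 : ℝ) = 2 * 2 by norm_num, mul_pow, inv_pow]
        field_simp
      rw [this, ENNReal.ofReal_mul (by positivity), Measure.real, ENNReal.ofReal_toReal hκt,
        ENNReal.ofReal_mul (by norm_num), ENNReal.ofReal_pow (by norm_num),
        ENNReal.ofReal_inv_of_pos (by norm_num)]
      norm_num
    rw [← ENNReal.mul_le_mul_iff_right hκ0 hκt]
    calc refMeasure (segSet E y ℓ x j) * ((refPi d A)⁻¹ *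
          (ENNReal.ofReal (2 ^ p * (c / q)) * refPi d (Np p)))
        = (refPi d A)⁻¹ * ENNReal.ofReal (2 ^ p * (c / q)) *
          (refPi d (Np p) * refMeasure (segSet E y ℓ x j)) := by ring
      _ ≤ (refPi d A)⁻¹ * ENNReal.ofReal (2 ^ p * (c / q)) *
          (refPi d A * ENNReal.ofReal (2 * (r / 4 ^ p))) := by gcongr
      _ = ((refPi d A)⁻¹ * refPi d A) *
          (ENNReal.ofReal (2 ^ p * (c / q)) * ENNReal.ofReal (2 * (r / 4 ^ p))) := by ring
      _ = _ := by rw [ENNReal.inv_mul_cancel hA0 hAt, h7, one_mul]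
  calc _ ≤ (1 : ℝ≥0∞) + ∑' p : ℕ, 2 * (2⁻¹ : ℝ≥0∞) ^ p := by
        exact add_le_add (ENNReal.inv_mul_le_one _) (ENNReal.tsum_le_tsum h5)
    _ = 5 := by
        rw [ENNReal.tsum_mul_left, ENNReal.tsum_geometric]
        have : (1 - 2⁻¹ : ℝ≥0∞)⁻¹ = 2 := by
          rw [ENNReal.one_sub_inv_two, inv_inv]
        rw [this]; norm_num

/-- The density cancels, leaving at most `n` weights of integral at most 5, divided by `n`. The
bound is uniform in the sample, as decoupling requires. -/
lemma lintegral_potential_le {f : (Fin d → ℝ) → ℝ} (hf : Measurable f) (hf0 : ∀ x, 0 ≤ f x)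
    (ℓ : ℕ) (j : Fin d) (E : Finset (Fin n)) (y : Fin n → Fin d → ℝ) :
    ∫⁻ t, potential f ℓ j E t y ∂(densityMeasure f) ≤ 5 := by
  have hW : Measurable fun t => ∑ e ∈ E, nbrWeight E y ℓ j (y e) t :=
    Finset.measurable_sum _ fun e _ =>
      Measurable.nbrWeight E ℓ measurable_const measurable_const measurable_id j
  have hP : Measurable fun t => potential f ℓ j E t y :=
    Measurable.potential E ℓ hf measurable_const measurable_id j
  rw [densityMeasure, lintegral_withDensity_eq_lintegral_mul _ hf.ennreal_ofReal hP]
  calc ∫⁻ t, ((fun t => ENNReal.ofReal (f t)) * fun t => potential f ℓ j E t y) t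
      ≤ ∫⁻ t, ((fun t => ENNReal.ofReal (refDensity t) : (Fin d → ℝ) → ℝ≥0∞) *
          (fun t => (n : ℝ≥0∞)⁻¹ * ∑ e ∈ E, nbrWeight E y ℓ j (y e) t)) t := by
        refine lintegral_mono fun t => ?_
        simp only [Pi.mul_apply, potential]
        rw [← mul_assoc, ← ENNReal.ofReal_mul (hf0 t)]
        refine mul_le_mul_left (ENNReal.ofReal_le_ofReal ?_) _
        rcases (hf0 t).eq_or_lt with h | h
        -- Where `f` vanishes the quotient is zero by convention, so only an inequality holds.
        · rw [← h]; simp [(refDensity_pos t).le]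
        · rw [mul_div_cancel₀ _ h.ne']
    _ = ∫⁻ t, ((n : ℝ≥0∞)⁻¹ * ∑ e ∈ E, nbrWeight E y ℓ j (y e) t) ∂(refPi d) := by
        rw [refPi_eq_withDensity, lintegral_withDensity_eq_lintegral_mul _
          measurable_refDensity_pi.ennreal_ofReal (hW.const_mul _)]
    _ = (n : ℝ≥0∞)⁻¹ * ∑ e ∈ E, ∫⁻ t, nbrWeight E y ℓ j (y e) t ∂(refPi d) := by
        rw [lintegral_const_mul _ hW, lintegral_finsetSum]
        exact fun e _ => Measurable.nbrWeight E ℓ measurable_const measurable_const measurable_id j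
    _ ≤ (n : ℝ≥0∞)⁻¹ * ∑ e ∈ E, 5 := by
        gcongr with e he
        exact lintegral_nbrWeight_le E y ℓ j (y e)
    _ ≤ (n : ℝ≥0∞)⁻¹ * (n * 5) := by
        rw [Finset.sum_const, nsmul_eq_mul]
        gcongr
        simpa using Finset.card_le_univ E
    _ ≤ 5 := by
        rw [← mul_assoc]
        calc _ ≤ 1 * (5 : ℝ≥0∞) := by gcongr; exact ENNReal.inv_mul_le_one _
          _ = 5 := one_mul _

end

end PSS

namespace PSS

noncomputable section

variable {d n : ℕ}

/-! ### The cell of a sample point -/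

lemma lowOn_univ (x : Fin n → Fin d → ℝ) (j : Fin d) : lowOn Finset.univ x j = ⨅ v, x v j :=
  (Equiv.subtypeUnivEquiv (p := fun v : Fin n => v ∈ Finset.univ)
    (fun v => Finset.mem_univ v)).iInf_comp (g := fun v => x v j)

lemma highOn_univ (x : Fin n → Fin d → ℝ) (j : Fin d) : highOn Finset.univ x j = ⨆ v, x v j :=
  (Equiv.subtypeUnivEquiv (p := fun v : Fin n => v ∈ Finset.univ)
    (fun v => Finset.mem_univ v)).iSup_comp (g := fun v => x v j)

lemma cellIndex_eq_cellOn (x : Fin n → Fin d → ℝ) (ℓ : ℕ) (t : Fin d → ℝ) :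
    cellIndex x ℓ t = cellOn Finset.univ x ℓ t := by
  ext j
  simp only [cellIndex, cellOn, segIndex, segWidth, lowOn_univ, highOn_univ]

/-- The sample points in the cell of the `v`-th sample point. -/
def pts (x : Fin n → Fin d → ℝ) (ℓ : ℕ) (v : Fin n) : Finset (Fin n) :=
  cellPoints x ℓ (cellIndex x ℓ (x v))

lemma mem_pts {x : Fin n → Fin d → ℝ} {ℓ : ℕ} {u v : Fin n} :
    u ∈ pts x ℓ v ↔ cellIndex x ℓ (x u) = cellIndex x ℓ (x v) := by
  simp [pts, cellPoints]

lemma self_mem_pts (x : Fin n → Fin d → ℝ) (ℓ : ℕ) (v : Fin n) : v ∈ pts x ℓ v := mem_pts.2 rfl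

lemma pts_congr {x : Fin n → Fin d → ℝ} {ℓ : ℕ} {u v : Fin n} (h : u ∈ pts x ℓ v) :
    pts x ℓ u = pts x ℓ v := by
  unfold pts; rw [mem_pts.1 h]

/-- The number of sample points in the cell of the `v`-th sample point. -/
def cnt (x : Fin n → Fin d → ℝ) (ℓ : ℕ) (v : Fin n) : ℕ := (pts x ℓ v).card

lemma one_le_cnt (x : Fin n → Fin d → ℝ) (ℓ : ℕ) (v : Fin n) : 1 ≤ cnt x ℓ v :=
  Finset.card_pos.2 ⟨v, self_mem_pts x ℓ v⟩

lemma cnt_congr {x : Fin n → Fin d → ℝ} {ℓ : ℕ} {u v : Fin n} (h : u ∈ pts x ℓ v) :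
    cnt x ℓ u = cnt x ℓ v := by
  unfold cnt; rw [pts_congr h]

/-- The spacing parameter of the cell of the `v`-th sample point. -/
def par (x : Fin n → Fin d → ℝ) (ℓ : ℕ) (v : Fin n) : ℕ := spacingParam (cnt x ℓ v)

lemma one_le_par (x : Fin n → Fin d → ℝ) (ℓ : ℕ) (v : Fin n) : 1 ≤ par x ℓ v :=
  one_le_spacingParam (one_le_cnt x ℓ v)

lemma par_congr {x : Fin n → Fin d → ℝ} {ℓ : ℕ} {u v : Fin n} (h : u ∈ pts x ℓ v) :
    par x ℓ u = par x ℓ v := by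
  unfold par; rw [cnt_congr h]

/-- The `j`-th coordinates of the sample points in the cell of the `v`-th sample point. -/
def crd (x : Fin n → Fin d → ℝ) (ℓ : ℕ) (v : Fin n) (j : Fin d) : Multiset ℝ :=
  (pts x ℓ v).val.map fun u => x u j

lemma crd_congr {x : Fin n → Fin d → ℝ} {ℓ : ℕ} {u v : Fin n} (h : u ∈ pts x ℓ v) (j : Fin d) :
    crd x ℓ u j = crd x ℓ v j := by
  unfold crd; rw [pts_congr h]

lemma card_crd (x : Fin n → Fin d → ℝ) (ℓ : ℕ) (v : Fin n) (j : Fin d) :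
    (crd x ℓ v j).card = cnt x ℓ v := by simp [crd, cnt]

/-- The order statistics of the `j`-th coordinates in the cell of the `v`-th sample point. -/
def os (x : Fin n → Fin d → ℝ) (ℓ : ℕ) (v : Fin n) (j : Fin d) (r : ℤ) : ℝ :=
  orderStat (crd x ℓ v j) r

lemma os_congr {x : Fin n → Fin d → ℝ} {ℓ : ℕ} {u v : Fin n} (h : u ∈ pts x ℓ v) (j : Fin d)
    (r : ℤ) : os x ℓ u j r = os x ℓ v j r := by
  unfold os; rw [crd_congr h]

/-- The rank of the `v`-th sample point in its cell, in the direction `j`. -/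
def rk (x : Fin n → Fin d → ℝ) (ℓ : ℕ) (j : Fin d) (v : Fin n) : ℕ :=
  rank (pts x ℓ v) (fun u => x u j) v

/-- A choice of the interval of the sub-grid for every sample point and direction. -/
structure IsWindow (x : Fin n → Fin d → ℝ) (ℓ : ℕ) (a : Fin n → Fin d → ℕ) : Prop where
  le_cnt : ∀ v j, a v j ≤ cnt x ℓ v
  eq : ∀ v j, spacingDensity (crd x ℓ v j) (par x ℓ v) (x v j) =
    2 * (par x ℓ v : ℝ) / (cnt x ℓ v *
      (os x ℓ v j ((a v j : ℤ) + par x ℓ v) - os x ℓ v j ((a v j : ℤ) - par x ℓ v)))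
  lo_le : ∀ v j, os x ℓ v j ((a v j : ℤ) - par x ℓ v) ≤ x v j
  le_hi : ∀ v j, x v j ≤ os x ℓ v j ((a v j : ℤ) + par x ℓ v)

lemma val_mem_crd (x : Fin n → Fin d → ℝ) (ℓ : ℕ) (v : Fin n) (j : Fin d) :
    x v j ∈ crd x ℓ v j :=
  Multiset.mem_map.2 ⟨v, self_mem_pts x ℓ v, rfl⟩

lemma exists_isWindow (x : Fin n → Fin d → ℝ) (ℓ : ℕ) : ∃ a, IsWindow x ℓ a := by
  have key : ∀ v j, ∃ a : ℕ, a ≤ cnt x ℓ v ∧ spacingDensity (crd x ℓ v j) (par x ℓ v) (x v j) =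
    2 * (par x ℓ v : ℝ) / (cnt x ℓ v *
      (os x ℓ v j ((a : ℤ) + par x ℓ v) - os x ℓ v j ((a : ℤ) - par x ℓ v))) ∧
    os x ℓ v j ((a : ℤ) - par x ℓ v) ≤ x v j ∧ x v j ≤ os x ℓ v j ((a : ℤ) + par x ℓ v) := by
    intro v j
    have h := exists_spacingDensity_eq (s := crd x ℓ v j) (m := par x ℓ v) (t := x v j)
      (by rw [card_crd]; exact one_le_cnt x ℓ v) (one_le_par x ℓ v)
      (orderStat_one_le (val_mem_crd x ℓ v j)) (le_orderStat_card (val_mem_crd x ℓ v j))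
    rwa [card_crd] at h
  choose a ha using key
  exact ⟨a, fun v j => (ha v j).1, fun v j => (ha v j).2.1, fun v j => (ha v j).2.2.1,
    fun v j => (ha v j).2.2.2⟩

/-- The spacing used at the `v`-th sample point in the direction `j`. -/
def gap (x : Fin n → Fin d → ℝ) (ℓ : ℕ) (a : Fin n → Fin d → ℕ) (v : Fin n) (j : Fin d) : ℝ :=
  os x ℓ v j ((a v j : ℤ) + par x ℓ v) - os x ℓ v j ((a v j : ℤ) - par x ℓ v)

/-- The spacing used at the `v`-th sample point, after the change of variables `arctan`. -/
def agap (x : Fin n → Fin d → ℝ) (ℓ : ℕ) (a : Fin n → Fin d → ℕ) (v : Fin n) (j : Fin d) : ℝ :=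
  Real.arctan (os x ℓ v j ((a v j : ℤ) + par x ℓ v)) -
    Real.arctan (os x ℓ v j ((a v j : ℤ) - par x ℓ v))

section Window

variable {x : Fin n → Fin d → ℝ} {ℓ : ℕ} {a : Fin n → Fin d → ℕ}

lemma densityEst_eq (ha : IsWindow x ℓ a) {v : Fin n} (hv : 2 ≤ cnt x ℓ v) :
    densityEst x ℓ (x v) =
      (cnt x ℓ v : ℝ) / n * ∏ j, (2 * (par x ℓ v : ℝ) / (cnt x ℓ v * gap x ℓ a v j)) := by
  have h : densityEst x ℓ (x v) = (cnt x ℓ v : ℝ) / n *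
      ∏ j, spacingDensity (crd x ℓ v j) (par x ℓ v) (x v j) := by
    unfold densityEst
    exact if_pos hv
  rw [h]
  congr 1
  exact Finset.prod_congr rfl fun j _ => ha.eq v j

lemma two_le_cnt_of_densityEst_ne_zero {v : Fin n} (hv : densityEst x ℓ (x v) ≠ 0) :
    2 ≤ cnt x ℓ v := by
  by_contra h
  exact hv (if_neg h)

lemma gap_nonneg (ha : IsWindow x ℓ a) (v : Fin n) (j : Fin d) : 0 ≤ gap x ℓ a v j :=
  sub_nonneg.2 ((ha.lo_le v j).trans (ha.le_hi v j))

lemma agap_nonneg (ha : IsWindow x ℓ a) (v : Fin n) (j : Fin d) : 0 ≤ agap x ℓ a v j :=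
  sub_nonneg.2 (Real.arctan_mono ((ha.lo_le v j).trans (ha.le_hi v j)))

lemma gap_pos (ha : IsWindow x ℓ a) {v : Fin n} (hv : densityEst x ℓ (x v) ≠ 0) (j : Fin d) :
    0 < gap x ℓ a v j := by
  refine (gap_nonneg ha v j).lt_of_ne fun h => hv ?_
  rw [densityEst_eq ha (two_le_cnt_of_densityEst_ne_zero hv),
    Finset.prod_eq_zero (Finset.mem_univ j) (by rw [← h]; simp), mul_zero]

lemma agap_pos (ha : IsWindow x ℓ a) {v : Fin n} (hv : densityEst x ℓ (x v) ≠ 0) (j : Fin d) :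
    0 < agap x ℓ a v j :=
  sub_pos.2 (Real.arctan_strictMono (sub_pos.1 (gap_pos ha hv j)))

lemma densityEst_ne_zero_iff (ha : IsWindow x ℓ a) {v : Fin n} (h2 : 2 ≤ cnt x ℓ v)
    (hg : ∀ j, 0 < gap x ℓ a v j) : densityEst x ℓ (x v) ≠ 0 := by
  rw [densityEst_eq ha h2]
  have hn : (0 : ℝ) < n := by exact_mod_cast v.pos
  have hc : (0 : ℝ) < cnt x ℓ v := by exact_mod_cast one_le_cnt x ℓ v
  have hp : (0 : ℝ) < par x ℓ v := by exact_mod_cast one_le_par x ℓ v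
  refine (mul_pos (by positivity) (Finset.prod_pos fun j _ => ?_)).ne'
  have := hg j
  positivity

lemma log_densityEst (ha : IsWindow x ℓ a) {v : Fin n} (hv : densityEst x ℓ (x v) ≠ 0) :
    Real.log (densityEst x ℓ (x v)) = Real.log ((cnt x ℓ v : ℝ) / n) +
      ∑ j, Real.log (2 * (par x ℓ v : ℝ) / (cnt x ℓ v * gap x ℓ a v j)) := by
  have hn : (0 : ℝ) < n := by exact_mod_cast v.pos
  have hc : (0 : ℝ) < cnt x ℓ v := by exact_mod_cast one_le_cnt x ℓ v
  have hp : (0 : ℝ) < par x ℓ v := by exact_mod_cast one_le_par x ℓ v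
  have hg : ∀ j, 0 < 2 * (par x ℓ v : ℝ) / (cnt x ℓ v * gap x ℓ a v j) := fun j => by
    have := gap_pos ha hv j
    positivity
  rw [densityEst_eq ha (two_le_cnt_of_densityEst_ne_zero hv), Real.log_mul (by positivity)
    (Finset.prod_pos fun j _ => hg j).ne', Real.log_prod fun j _ => (hg j).ne']

end Window

/-! ### Segments -/

lemma segIndex_mono (lo hi : ℝ) (h : lo ≤ hi) (ℓ : ℕ) : Monotone (segIndex lo hi ℓ) := by
  intro s t hst
  unfold segIndex
  refine min_le_min_right _ (Nat.floor_mono ?_)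
  have : 0 ≤ (hi - lo) / ℓ := div_nonneg (by linarith) (Nat.cast_nonneg _)
  exact div_le_div_of_nonneg_right (by linarith) this

lemma lowOn_le_highOn (E : Finset (Fin n)) (y : Fin n → Fin d → ℝ) (j : Fin d) :
    lowOn E y j ≤ highOn E y j := by
  unfold lowOn highOn
  rcases isEmpty_or_nonempty E with h | h
  · simp
  · exact ciInf_le_ciSup (Set.finite_range _).bddBelow (Set.finite_range _).bddAbove

lemma ordConnected_segSet (E : Finset (Fin n)) (y : Fin n → Fin d → ℝ) (ℓ : ℕ) (t : Fin d → ℝ)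
    (j : Fin d) : (segSet E y ℓ t j).OrdConnected := by
  constructor
  intro s hs s' hs' u hu
  rw [mem_segSet] at *
  have hm := segIndex_mono _ _ (lowOn_le_highOn E y j) ℓ
  exact le_antisymm ((hm hu.2).trans hs'.le) (hs.ge.trans (hm hu.1))

lemma abs_sub_le_of_segIndex_eq {lo hi s t : ℝ} {ℓ : ℕ} (hℓ : 1 ≤ ℓ) (hs : lo ≤ s) (hs' : s ≤ hi)
    (ht : lo ≤ t) (ht' : t ≤ hi) (h : segIndex lo hi ℓ s = segIndex lo hi ℓ t) :
    |s - t| ≤ (hi - lo) / ℓ := by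
  have hℓ' : (0 : ℝ) < ℓ := by exact_mod_cast hℓ
  set w := (hi - lo) / ℓ with hw
  have hhi : hi - lo = ℓ * w := by rw [hw]; field_simp
  -- A zero width means that the range is a single point.
  rcases (show 0 ≤ w from div_nonneg (by linarith) hℓ'.le).eq_or_lt with h0 | h0
  · rw [← h0, mul_zero] at hhi
    rw [← h0, show s - t = 0 by linarith]; simp
  have key : ∀ s, lo ≤ s → s ≤ hi → lo + segIndex lo hi ℓ s * w ≤ s ∧
      s ≤ lo + (segIndex lo hi ℓ s + 1) * w := by
    intro s hs hs'
    unfold segIndex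
    rw [← hw]
    have h1 : (⌊(s - lo) / w⌋₊ : ℝ) ≤ (s - lo) / w := Nat.floor_le (div_nonneg (by linarith) h0.le)
    have h2 := Nat.lt_floor_add_one ((s - lo) / w)
    rw [le_div_iff₀ h0] at h1
    rw [div_lt_iff₀ h0] at h2
    rcases le_total ⌊(s - lo) / w⌋₊ (ℓ - 1) with h | h
    · rw [min_eq_left h]; constructor <;> linarith
    -- The cap at `ℓ - 1` assigns the right end point of the range to the last segment, whose upper
    -- end is `lo + ℓ * w = hi`.
    · rw [min_eq_right h]
      have h3 : ((ℓ - 1 : ℕ) : ℝ) ≤ ⌊(s - lo) / w⌋₊ := by exact_mod_cast h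
      have h4 : ((ℓ - 1 : ℕ) : ℝ) + 1 = ℓ := by
        rw [Nat.cast_sub hℓ]; simp
      rw [h4]
      have := mul_le_mul_of_nonneg_right h3 h0.le
      constructor <;> linarith
  have h1 := key s hs hs'
  have h2 := key t ht ht'
  rw [h] at h1
  rw [abs_le]; constructor <;> linarith [h1.1, h1.2, h2.1, h2.2]

lemma lowOn_le {E : Finset (Fin n)} (y : Fin n → Fin d → ℝ) {v : Fin n} (hv : v ∈ E) (j : Fin d) :
    lowOn E y j ≤ y v j :=
  ciInf_le (Set.finite_range fun v : E => y v j).bddBelow ⟨v, hv⟩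

lemma le_highOn {E : Finset (Fin n)} (y : Fin n → Fin d → ℝ) {v : Fin n} (hv : v ∈ E) (j : Fin d) :
    y v j ≤ highOn E y j :=
  le_ciSup (Set.finite_range fun v : E => y v j).bddAbove ⟨v, hv⟩

lemma segWidth_eq (x : Fin n → Fin d → ℝ) (ℓ : ℕ) (j : Fin d) :
    segWidth x ℓ j = (highOn Finset.univ x j - lowOn Finset.univ x j) / ℓ := by
  rw [segWidth, lowOn_univ, highOn_univ]

lemma segWidth_nonneg (x : Fin n → Fin d → ℝ) (ℓ : ℕ) (j : Fin d) : 0 ≤ segWidth x ℓ j := by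
  rw [segWidth_eq]
  exact div_nonneg (sub_nonneg.2 (lowOn_le_highOn _ _ _)) (Nat.cast_nonneg _)

lemma abs_sub_le_segWidth {x : Fin n → Fin d → ℝ} {ℓ : ℕ} (hℓ : 1 ≤ ℓ) {u v : Fin n}
    (h : u ∈ pts x ℓ v) (j : Fin d) : |x u j - x v j| ≤ segWidth x ℓ j := by
  rw [segWidth_eq]
  refine abs_sub_le_of_segIndex_eq hℓ (lowOn_le _ (Finset.mem_univ _) j)
    (le_highOn _ (Finset.mem_univ _) j) (lowOn_le _ (Finset.mem_univ _) j)
    (le_highOn _ (Finset.mem_univ _) j) ?_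
  have := mem_pts.1 h
  rw [cellIndex_eq_cellOn, cellIndex_eq_cellOn] at this
  exact congr_fun this j

/-- The extreme points of a sample determine the grid. -/
lemma exists_extremes (x : Fin n → Fin d → ℝ) :
    ∃ E₀ : Finset (Fin n), E₀.card ≤ 2 * d ∧ ∀ E, E₀ ⊆ E →
      (∀ j, lowOn E x j = lowOn Finset.univ x j) ∧ ∀ j, highOn E x j = highOn Finset.univ x j := by
  classical
  rcases Nat.eq_zero_or_pos n with rfl | hn
  · refine ⟨∅, by simp, fun E _ => ?_⟩
    have : E = Finset.univ := Finset.eq_univ_of_forall fun v => v.elim0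
    rw [this]; simp
  have hne : Nonempty (Fin n) := ⟨⟨0, hn⟩⟩
  have h1 : ∀ j, ∃ v, ∀ u, x v j ≤ x u j := fun j => Finite.exists_min fun v => x v j
  have h2 : ∀ j, ∃ v, ∀ u, x u j ≤ x v j := fun j => Finite.exists_max fun v => x v j
  choose p hp using h1
  choose q hq using h2
  refine ⟨Finset.univ.image p ∪ Finset.univ.image q, ?_, fun E hE => ⟨fun j => ?_, fun j => ?_⟩⟩
  · refine (Finset.card_union_le _ _).trans ?_
    have h3 := Finset.card_image_le (s := (Finset.univ : Finset (Fin d))) (f := p)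
    have h4 := Finset.card_image_le (s := (Finset.univ : Finset (Fin d))) (f := q)
    simp only [Finset.card_univ, Fintype.card_fin] at h3 h4
    omega
  · have hpE : p j ∈ E := hE (Finset.mem_union_left _ (Finset.mem_image_of_mem _ (Finset.mem_univ j)))
    have : Nonempty E := ⟨⟨p j, hpE⟩⟩
    have : Nonempty (Finset.univ : Finset (Fin n)) := ⟨⟨p j, Finset.mem_univ _⟩⟩
    exact le_antisymm ((lowOn_le x hpE j).trans (le_ciInf fun v => hp j v))
      ((lowOn_le x (Finset.mem_univ (p j)) j).trans (le_ciInf fun v => hp j v))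
  · have hqE : q j ∈ E := hE (Finset.mem_union_right _ (Finset.mem_image_of_mem _ (Finset.mem_univ j)))
    have : Nonempty E := ⟨⟨q j, hqE⟩⟩
    have : Nonempty (Finset.univ : Finset (Fin n)) := ⟨⟨q j, Finset.mem_univ _⟩⟩
    exact le_antisymm (le_trans (ciSup_le fun v => hq j v) (le_highOn x (Finset.mem_univ (q j)) j))
      (le_trans (ciSup_le fun v => hq j v) (le_highOn x hqE j))

/-- The measure of the `j`-th side of the cell of the `v`-th sample point. -/
def side (x : Fin n → Fin d → ℝ) (ℓ : ℕ) (v : Fin n) (j : Fin d) : ℝ :=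
  refMeasure.real (segSet Finset.univ x ℓ (x v) j)

lemma os_mem_segSet (x : Fin n → Fin d → ℝ) (ℓ : ℕ) (v : Fin n) (j : Fin d) (r : ℤ) :
    os x ℓ v j r ∈ segSet Finset.univ x ℓ (x v) j := by
  have h := orderStat_mem (s := crd x ℓ v j) r (by rw [card_crd]; exact one_le_cnt x ℓ v)
  obtain ⟨u, hu, hue⟩ := Multiset.mem_map.1 h
  have h2 := mem_pts.1 (show u ∈ pts x ℓ v from hu)
  rw [cellIndex_eq_cellOn, cellIndex_eq_cellOn] at h2
  rw [mem_segSet, os, ← hue]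
  exact congr_fun h2 j

/-- Both order statistics lie in the same side of the cell, which is an interval, so the segment
between them does too. -/
lemma arctan_sub_le_side (x : Fin n → Fin d → ℝ) (ℓ : ℕ) (v : Fin n) (j : Fin d) {r r' : ℤ}
    (h : r ≤ r') :
    Real.arctan (os x ℓ v j r') - Real.arctan (os x ℓ v j r) ≤ side x ℓ v j := by
  refine (le_refMeasure_Icc (orderStat_mono _ h)).trans (measureReal_mono ?_ (measure_ne_top _ _))
  exact (ordConnected_segSet Finset.univ x ℓ (x v) j).out (os_mem_segSet x ℓ v j r)
    (os_mem_segSet x ℓ v j r')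

lemma side_pos {x : Fin n → Fin d → ℝ} {ℓ : ℕ} {a : Fin n → Fin d → ℕ} (ha : IsWindow x ℓ a)
    {v : Fin n} (hv : densityEst x ℓ (x v) ≠ 0) (j : Fin d) : 0 < side x ℓ v j :=
  (agap_pos ha hv j).trans_le (arctan_sub_le_side x ℓ v j (by omega))

end

end PSS

namespace PSS

noncomputable section

variable {d n : ℕ}

/-! ### Elementary inequalities -/

/-- The tangent of the logarithm at `c`. If `t` has bounded average over the sample, then over a
small set of points `log t` sums to at most (size of the set) `* log c` plus `O(n / c)`; `c` is
chosen large first, then the set small. -/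
lemma log_le_log_add_div {t c : ℝ} (ht : 0 < t) (hc : 0 < c) : Real.log t ≤ Real.log c + t / c := by
  have h := Real.log_le_sub_one_of_pos (div_pos ht hc)
  rw [Real.log_div ht.ne' hc.ne'] at h
  linarith

lemma exists_arctan_sub_eq {a b : ℝ} (hab : a < b) :
    ∃ c ∈ Set.Ioo a b, Real.arctan b - Real.arctan a = (b - a) / (1 + c ^ 2) := by
  obtain ⟨c, hc, h⟩ := exists_hasDerivAt_eq_slope Real.arctan (fun x => 1 / (1 + x ^ 2)) hab
    Real.continuous_arctan.continuousOn fun x _ => Real.hasDerivAt_arctan x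
  refine ⟨c, hc, ?_⟩
  have : b - a ≠ 0 := (sub_pos.2 hab).ne'
  have h3 : (Real.arctan b - Real.arctan a) = 1 / (1 + c ^ 2) * (b - a) := by
    rw [h]; field_simp
  rw [h3]; ring

lemma log_arctan_sub_div_nonpos {a b : ℝ} (hab : a < b) :
    Real.log ((Real.arctan b - Real.arctan a) / (b - a)) ≤ 0 := by
  obtain ⟨c, -, h⟩ := exists_arctan_sub_eq hab
  have hb : 0 < b - a := sub_pos.2 hab
  rw [h, show (b - a) / (1 + c ^ 2) / (b - a) = 1 / (1 + c ^ 2) by field_simp]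
  refine Real.log_nonpos (by positivity) ?_
  rw [div_le_one (by positivity)]
  nlinarith [sq_nonneg c]

/-- By the mean value theorem the slope of `arctan` is `1 / (1 + c ^ 2)` at an intermediate point,
and `1 + c ^ 2 ≤ (1 + |c|) ^ 2`. -/
lemma neg_le_log_arctan_sub_div {a b : ℝ} (hab : a < b) :
    -(2 * Real.log (1 + max |a| |b|)) ≤
      Real.log ((Real.arctan b - Real.arctan a) / (b - a)) := by
  obtain ⟨c, hc, h⟩ := exists_arctan_sub_eq hab
  have hb : 0 < b - a := sub_pos.2 hab
  rw [h, show (b - a) / (1 + c ^ 2) / (b - a) = (1 + c ^ 2)⁻¹ by field_simp, Real.log_inv,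
    neg_le_neg_iff]
  have hcm : |c| ≤ max |a| |b| := abs_le_max_abs_abs hc.1.le hc.2.le
  have h1 : 1 + c ^ 2 ≤ (1 + max |a| |b|) ^ 2 := by
    rw [← sq_abs]; nlinarith [abs_nonneg c]
  calc Real.log (1 + c ^ 2) ≤ Real.log ((1 + max |a| |b|) ^ 2) := Real.log_le_log (by positivity) h1
    _ = _ := by rw [Real.log_pow]; norm_num

lemma log_one_add_abs_add_le {s t : ℝ} (ht : 0 ≤ t) :
    Real.log (1 + (|s| + t)) ≤ Real.log (1 + |s|) + Real.log (1 + t) := by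
  rw [← Real.log_mul (by positivity) (by positivity)]
  refine Real.log_le_log (by positivity) ?_
  nlinarith [abs_nonneg s]

lemma log_one_add_max_le {s t : ℝ} :
    Real.log (1 + max |s| |t|) ≤ Real.log (1 + |s|) + Real.log (1 + |t|) := by
  refine le_trans (Real.log_le_log (by positivity) ?_) (log_one_add_abs_add_le (abs_nonneg t))
  have := max_le_add_of_nonneg (abs_nonneg s) (abs_nonneg t)
  linarith

/-! ### Sums over cells -/

lemma sum_le_sum_of_pts (x : Fin n → Fin d → ℝ) (ℓ : ℕ) (F G : Fin n → ℝ)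
    (h : ∀ v, ∑ u ∈ pts x ℓ v, F u ≤ ∑ u ∈ pts x ℓ v, G u) : ∑ v, F v ≤ ∑ v, G v := by
  classical
  have hm : ∀ v ∈ (Finset.univ : Finset (Fin n)), cellIndex x ℓ (x v) ∈
      Finset.univ.image fun v => cellIndex x ℓ (x v) := fun v hv => Finset.mem_image_of_mem _ hv
  rw [← Finset.sum_fiberwise_of_maps_to hm, ← Finset.sum_fiberwise_of_maps_to hm]
  refine Finset.sum_le_sum fun k hk => ?_
  obtain ⟨v, -, rfl⟩ := Finset.mem_image.1 hk
  exact h v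

lemma sum_pts_rk (x : Fin n → Fin d → ℝ) (ℓ : ℕ) (v : Fin n) (j : Fin d)
    (hinj : Function.Injective fun v => x v j) (F : ℕ → ℝ) :
    ∑ u ∈ pts x ℓ v, F (rk x ℓ j u) = ∑ i ∈ Finset.range (cnt x ℓ v), F (i + 1) := by
  rw [cnt, ← sum_Icc_one_eq_sum_range, ← sum_rank (C := pts x ℓ v) (y := fun u => x u j) hinj.injOn]
  refine Finset.sum_congr rfl fun u hu => ?_
  rw [rk, pts_congr hu]

lemma os_of_le_one (x : Fin n → Fin d → ℝ) (ℓ : ℕ) (v : Fin n) (j : Fin d) {r : ℤ} (hr : r ≤ 1) :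
    os x ℓ v j r = os x ℓ v j 1 := orderStat_of_le_one _ hr

lemma os_of_cnt_le (x : Fin n → Fin d → ℝ) (ℓ : ℕ) (v : Fin n) (j : Fin d) {r : ℤ}
    (hr : (cnt x ℓ v : ℤ) ≤ r) : os x ℓ v j r = os x ℓ v j (cnt x ℓ v) := by
  have := orderStat_of_card_le (crd x ℓ v j) (r := r) (by rwa [card_crd])
  rwa [card_crd] at this

lemma os_rk (x : Fin n → Fin d → ℝ) (ℓ : ℕ) (v : Fin n) (j : Fin d) :
    os x ℓ v j (rk x ℓ j v) = x v j :=
  orderStat_rank (y := fun u => x u j) (self_mem_pts x ℓ v)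

lemma os_mono (x : Fin n → Fin d → ℝ) (ℓ : ℕ) (v : Fin n) (j : Fin d) : Monotone (os x ℓ v j) :=
  orderStat_mono _

section Window

variable {x : Fin n → Fin d → ℝ} {ℓ : ℕ} {a : Fin n → Fin d → ℕ}

lemma rk_mem_window (ha : IsWindow x ℓ a) (v : Fin n) (j : Fin d)
    (hinj : Function.Injective fun v => x v j) :
    (a v j : ℤ) - par x ℓ v ≤ rk x ℓ j v ∧ (rk x ℓ j v : ℤ) ≤ a v j + par x ℓ v :=
  rank_mem_window (C := pts x ℓ v) (y := fun u => x u j) hinj.injOn (self_mem_pts x ℓ v)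
    (one_le_par x ℓ v) (ha.le_cnt v j) (ha.lo_le v j) (ha.le_hi v j)

/-- The volume of the cell of the `v`-th sample point for the reference measure. -/
def cellVol (x : Fin n → Fin d → ℝ) (ℓ : ℕ) (v : Fin n) : ℝ := ∏ j, side x ℓ v j

lemma cellVol_eq (x : Fin n → Fin d → ℝ) (ℓ : ℕ) (v : Fin n) :
    cellVol x ℓ v = (refPi d).real (cellSet Finset.univ x ℓ (x v)) := by
  rw [cellSet_eq_pi, refPi, Measure.real, Measure.pi_pi, ENNReal.toReal_prod]
  rfl

/-- The points of one cell together contribute its volume, once; the cells are disjoint and the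
reference mass is at most `π ^ d`. -/
lemma sum_cellVol_div_cnt_le (x : Fin n → Fin d → ℝ) (ℓ : ℕ) :
    ∑ v, cellVol x ℓ v / cnt x ℓ v ≤ Real.pi ^ d := by
  classical
  have hm : ∀ v ∈ (Finset.univ : Finset (Fin n)), cellIndex x ℓ (x v) ∈
      Finset.univ.image fun v => cellIndex x ℓ (x v) := fun v hv => Finset.mem_image_of_mem _ hv
  rw [← Finset.sum_fiberwise_of_maps_to hm]
  set A : (Fin d → ℕ) → Set (Fin d → ℝ) := fun k => {t | cellIndex x ℓ t = k} with hA
  have hAm : ∀ k, MeasurableSet (A k) := fun k => by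
    simp only [hA, cellIndex_eq_cellOn]
    exact measurableSet_eq_fun (Measurable.cellOn _ ℓ measurable_const measurable_id)
      measurable_const
  have h1 : ∀ k ∈ Finset.univ.image fun v => cellIndex x ℓ (x v),
      ∑ v ∈ Finset.univ.filter (fun v => cellIndex x ℓ (x v) = k), cellVol x ℓ v / cnt x ℓ v =
        (refPi d).real (A k) := by
    intro k hk
    obtain ⟨v, -, rfl⟩ := Finset.mem_image.1 hk
    have hc : (0 : ℝ) < cnt x ℓ v := by exact_mod_cast one_le_cnt x ℓ v
    have h2 : ∀ u ∈ pts x ℓ v, cellVol x ℓ u / cnt x ℓ u =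
        (refPi d).real (A (cellIndex x ℓ (x v))) / cnt x ℓ v := by
      intro u hu
      rw [cnt_congr hu, cellVol_eq]
      congr 2
      ext t
      simp only [mem_cellSet, ← cellIndex_eq_cellOn, mem_pts.1 hu, hA]
      rfl
    calc _ = ∑ u ∈ pts x ℓ v, (refPi d).real (A (cellIndex x ℓ (x v))) / cnt x ℓ v :=
          Finset.sum_congr rfl h2
      _ = _ := by
          rw [Finset.sum_const, nsmul_eq_mul]
          change (cnt x ℓ v : ℝ) * _ = _
          field_simp
  rw [Finset.sum_congr rfl h1, ← measureReal_biUnion_finset]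
  · refine (measureReal_mono (Set.subset_univ _) (measure_ne_top _ _)).trans ?_
    exact ENNReal.toReal_le_of_le_ofReal (by positivity) refPi_univ_le
  · intro k _ k' _ hkk'
    rw [Function.onFun, Set.disjoint_left]
    intro t ht ht'
    exact hkk' (Eq.trans (Eq.symm ht) ht')
  · exact fun k _ => hAm k

/-- The window used at a point reaches at most `2 m` ranks away from its own rank. Within a cell the
enlarged spacings telescope to at most `4 m` times the side, that is `2 N` after normalisation. -/
lemma sum_agap_le (ha : IsWindow x ℓ a) (j : Fin d) (hinj : Function.Injective fun v => x v j) :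
    ∑ v, cnt x ℓ v * agap x ℓ a v j / (2 * par x ℓ v * side x ℓ v j) ≤ 2 * n := by
  have h := sum_le_sum_of_pts x ℓ
    (fun v => cnt x ℓ v * agap x ℓ a v j / (2 * par x ℓ v * side x ℓ v j)) (fun _ => 2) ?_
  · simpa [mul_comm] using h
  intro v
  set N := cnt x ℓ v with hN
  set m := par x ℓ v with hm
  set φ : ℤ → ℝ := fun r => Real.arctan (os x ℓ v j r) with hφ
  have hmpos : (0 : ℝ) < m := by exact_mod_cast one_le_par x ℓ v
  have h1 : ∀ u ∈ pts x ℓ v, agap x ℓ a u j ≤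
      φ ((rk x ℓ j u : ℤ) + (2 * m : ℕ)) - φ ((rk x ℓ j u : ℤ) - (2 * m : ℕ)) := by
    intro u hu
    have hr := rk_mem_window ha u j hinj
    have hp := par_congr hu
    rw [agap, os_congr hu, os_congr hu]
    rw [hp] at hr ⊢
    refine sub_le_sub (Real.arctan_mono (os_mono x ℓ v j ?_)) (Real.arctan_mono (os_mono x ℓ v j ?_))
    · push_cast; omega
    · push_cast; omega
  have h2 : ∑ u ∈ pts x ℓ v, agap x ℓ a u j ≤ 4 * m * side x ℓ v j := by
    refine (Finset.sum_le_sum h1).trans ?_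
    rw [sum_pts_rk x ℓ v j hinj fun r =>
      φ ((r : ℤ) + (2 * m : ℕ)) - φ ((r : ℤ) - (2 * m : ℕ))]
    have h3 := sum_shift_sub_le φ (fun r s hrs => Real.arctan_mono (os_mono x ℓ v j hrs)) N
      (fun r hr => by simp only [hφ, os_of_le_one x ℓ v j hr])
      (fun r hr => by simp only [hφ, os_of_cnt_le x ℓ v j hr, hN]) (2 * m)
    have h4 : φ N - φ 1 ≤ side x ℓ v j := arctan_sub_le_side x ℓ v j (by
      have := one_le_cnt x ℓ v; omega)
    push_cast at h3 ⊢
    refine h3.trans ?_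
    have := mul_le_mul_of_nonneg_left h4 (show (0 : ℝ) ≤ 2 * (2 * m) by positivity)
    linarith
  have hs0 : 0 ≤ side x ℓ v j := measureReal_nonneg
  have h5 : ∀ u ∈ pts x ℓ v, cnt x ℓ u * agap x ℓ a u j / (2 * par x ℓ u * side x ℓ u j) =
      N / (2 * m * side x ℓ v j) * agap x ℓ a u j := by
    intro u hu
    have : side x ℓ u j = side x ℓ v j := by
      have := mem_pts.1 hu
      rw [cellIndex_eq_cellOn, cellIndex_eq_cellOn] at this
      unfold side segSet; rw [this]
    rw [cnt_congr hu, par_congr hu, this]; ring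
  rw [Finset.sum_congr rfl h5, ← Finset.mul_sum, Finset.sum_const, nsmul_eq_mul]
  change _ ≤ (N : ℝ) * 2
  rcases hs0.eq_or_lt with h0 | h0
  · rw [← h0]; simp
  calc (N : ℝ) / (2 * m * side x ℓ v j) * ∑ u ∈ pts x ℓ v, agap x ℓ a u j
      ≤ (N : ℝ) / (2 * m * side x ℓ v j) * (4 * m * side x ℓ v j) := by gcongr
    _ = N * 2 := by field_simp; norm_num

/-! ### The decomposition of the logarithm of the estimator -/

/-- The logarithm of the histogram density with respect to the reference measure. -/
def logHist (x : Fin n → Fin d → ℝ) (ℓ : ℕ) (v : Fin n) : ℝ :=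
  Real.log (cnt x ℓ v / (n * cellVol x ℓ v))

/-- The logarithm of a spacing factor, relative to the uniform distribution on its cell. -/
def logSpac (x : Fin n → Fin d → ℝ) (ℓ : ℕ) (a : Fin n → Fin d → ℕ) (v : Fin n) (j : Fin d) : ℝ :=
  Real.log (2 * par x ℓ v * side x ℓ v j / (cnt x ℓ v * agap x ℓ a v j))

/-- The logarithm of the mean of the reference density on an interval of the sub-grid. -/
def logRef (x : Fin n → Fin d → ℝ) (ℓ : ℕ) (a : Fin n → Fin d → ℕ) (v : Fin n) (j : Fin d) : ℝ :=
  Real.log (agap x ℓ a v j / gap x ℓ a v j)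

lemma cellVol_pos (ha : IsWindow x ℓ a) {v : Fin n} (hv : densityEst x ℓ (x v) ≠ 0) :
    0 < cellVol x ℓ v := Finset.prod_pos fun j _ => side_pos ha hv j

/-- The sides inserted into the spacing factors cancel against the volume of the cell in the
histogram factor, and each `agap` cancels between its spacing and its reference factor. -/
lemma log_densityEst_eq (ha : IsWindow x ℓ a) {v : Fin n} (hv : densityEst x ℓ (x v) ≠ 0) :
    Real.log (densityEst x ℓ (x v)) =
      logHist x ℓ v + ∑ j, logSpac x ℓ a v j + ∑ j, logRef x ℓ a v j := by
  have hn : (0 : ℝ) < n := by exact_mod_cast v.pos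
  have hc : (0 : ℝ) < cnt x ℓ v := by exact_mod_cast one_le_cnt x ℓ v
  have hp : (0 : ℝ) < par x ℓ v := by exact_mod_cast one_le_par x ℓ v
  have hV := cellVol_pos ha hv
  rw [log_densityEst ha hv, logHist]
  have h1 : ∀ j, Real.log (2 * (par x ℓ v : ℝ) / (cnt x ℓ v * gap x ℓ a v j)) =
      logSpac x ℓ a v j + logRef x ℓ a v j - Real.log (side x ℓ v j) := by
    intro j
    have hg := gap_pos ha hv j
    have hg' := agap_pos ha hv j
    have hs := side_pos ha hv j
    rw [logSpac, logRef, ← Real.log_mul (by positivity) (by positivity),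
      ← Real.log_div (by positivity) (by positivity)]
    congr 1; field_simp
  have h2 : Real.log (cellVol x ℓ v) = ∑ j, Real.log (side x ℓ v j) :=
    Real.log_prod fun j _ => (side_pos ha hv j).ne'
  rw [Finset.sum_congr rfl fun j _ => h1 j, Finset.sum_sub_distrib, Finset.sum_add_distrib, ← h2,
    Real.log_div hc.ne' hn.ne', Real.log_div hc.ne' (by positivity),
    Real.log_mul hn.ne' hV.ne']
  ring

lemma logRef_nonpos (ha : IsWindow x ℓ a) {v : Fin n} (hv : densityEst x ℓ (x v) ≠ 0) (j : Fin d) :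
    logRef x ℓ a v j ≤ 0 := log_arctan_sub_div_nonpos (sub_pos.1 (gap_pos ha hv j))

/-- The tangent inequality applied to `n * cellVol / cnt`, whose sum over the whole sample is at
most `n π ^ d`. -/
lemma neg_le_sum_logHist (ha : IsWindow x ℓ a) (B : Finset (Fin n))
    (hB : ∀ v ∈ B, densityEst x ℓ (x v) ≠ 0) {c : ℝ} (hc : 1 ≤ c) :
    -(B.card * Real.log c + n * Real.pi ^ d / c) ≤ ∑ v ∈ B, logHist x ℓ v := by
  have hc0 : 0 < c := by linarith
  have h1 : ∀ v ∈ B, -logHist x ℓ v ≤ Real.log c + n / c * (cellVol x ℓ v / cnt x ℓ v) := by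
    intro v hv
    have hn : (0 : ℝ) < n := by exact_mod_cast v.pos
    have hct : (0 : ℝ) < cnt x ℓ v := by exact_mod_cast one_le_cnt x ℓ v
    have hV := cellVol_pos ha (hB v hv)
    rw [logHist, ← Real.log_inv, inv_div]
    refine (log_le_log_add_div (by positivity) hc0).trans (le_of_eq ?_)
    congr 1; field_simp
  have h2 := Finset.sum_le_sum h1
  rw [Finset.sum_neg_distrib, Finset.sum_add_distrib, ← Finset.mul_sum, Finset.sum_const,
    nsmul_eq_mul] at h2
  have h3 : ∑ v ∈ B, cellVol x ℓ v / cnt x ℓ v ≤ Real.pi ^ d :=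
    (Finset.sum_le_sum_of_subset_of_nonneg (Finset.subset_univ B) fun v _ _ =>
      div_nonneg (Finset.prod_nonneg fun j _ => measureReal_nonneg) (Nat.cast_nonneg _)).trans
      (sum_cellVol_div_cnt_le x ℓ)
  have h4 := mul_le_mul_of_nonneg_left h3 (show (0 : ℝ) ≤ n / c by positivity)
  have h5 : (n : ℝ) / c * Real.pi ^ d = n * Real.pi ^ d / c := by ring
  linarith

/-- The tangent inequality applied to the reciprocal spacing factor, whose sum is at most `2 n` by
`sum_agap_le`. -/
lemma neg_le_sum_logSpac (ha : IsWindow x ℓ a) (j : Fin d)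
    (hinj : Function.Injective fun v => x v j) (B : Finset (Fin n))
    (hB : ∀ v ∈ B, densityEst x ℓ (x v) ≠ 0) {c : ℝ} (hc : 1 ≤ c) :
    -(B.card * Real.log c + 2 * n / c) ≤ ∑ v ∈ B, logSpac x ℓ a v j := by
  have hc0 : 0 < c := by linarith
  have h1 : ∀ v ∈ B, -logSpac x ℓ a v j ≤ Real.log c +
      1 / c * (cnt x ℓ v * agap x ℓ a v j / (2 * par x ℓ v * side x ℓ v j)) := by
    intro v hv
    have hct : (0 : ℝ) < cnt x ℓ v := by exact_mod_cast one_le_cnt x ℓ v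
    have hp : (0 : ℝ) < par x ℓ v := by exact_mod_cast one_le_par x ℓ v
    have hg := agap_pos ha (hB v hv) j
    have hs := side_pos ha (hB v hv) j
    rw [logSpac, ← Real.log_inv, inv_div]
    refine (log_le_log_add_div (by positivity) hc0).trans (le_of_eq ?_)
    congr 1; field_simp
  have h2 := Finset.sum_le_sum h1
  rw [Finset.sum_neg_distrib, Finset.sum_add_distrib, ← Finset.mul_sum, Finset.sum_const,
    nsmul_eq_mul] at h2
  have h3 : ∑ v ∈ B, cnt x ℓ v * agap x ℓ a v j / (2 * par x ℓ v * side x ℓ v j) ≤ 2 * n :=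
    (Finset.sum_le_sum_of_subset_of_nonneg (Finset.subset_univ B) fun v _ _ =>
      div_nonneg (mul_nonneg (Nat.cast_nonneg _) (agap_nonneg ha v j))
        (mul_nonneg (by positivity) measureReal_nonneg)).trans (sum_agap_le ha j hinj)
  have h4 := mul_le_mul_of_nonneg_left h3 (show (0 : ℝ) ≤ 1 / c by positivity)
  have h5 : 1 / c * (2 * n) = 2 * n / c := by ring
  linarith

lemma os_abs_sub_le (hℓ : 1 ≤ ℓ) (x : Fin n → Fin d → ℝ) (v : Fin n) (j : Fin d) (r : ℤ) :
    |os x ℓ v j r| ≤ |x v j| + segWidth x ℓ j := by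
  have h := orderStat_mem (s := crd x ℓ v j) r (by rw [card_crd]; exact one_le_cnt x ℓ v)
  obtain ⟨u, hu, hue⟩ := Multiset.mem_map.1 h
  have h1 := abs_sub_le_segWidth hℓ (show u ∈ pts x ℓ v from hu) j
  rw [os, ← hue]
  have := abs_sub_abs_le_abs_sub (x u j) (x v j)
  linarith

lemma neg_le_logRef (hℓ : 1 ≤ ℓ) (ha : IsWindow x ℓ a) {v : Fin n}
    (hv : densityEst x ℓ (x v) ≠ 0) (j : Fin d) :
    -(2 * Real.log (1 + |x v j|) + 2 * Real.log (1 + segWidth x ℓ j)) ≤ logRef x ℓ a v j := by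
  have h1 := neg_le_log_arctan_sub_div (sub_pos.1 (gap_pos ha hv j))
  refine le_trans ?_ h1
  have h2 := max_le (os_abs_sub_le hℓ x v j ((a v j : ℤ) - par x ℓ v))
    (os_abs_sub_le hℓ x v j ((a v j : ℤ) + par x ℓ v))
  have h3 := Real.log_le_log (by positivity) (add_le_add_right h2 1)
  have h4 := log_one_add_abs_add_le (s := x v j) (segWidth_nonneg x ℓ j)
  linarith

/-- A lower bound for the contribution of a set of sample points to the estimator. -/
lemma neg_le_sum_log_densityEst (hℓ : 1 ≤ ℓ) (hinj : ∀ j, Function.Injective fun v => x v j)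
    (B : Finset (Fin n)) (hB : ∀ v ∈ B, densityEst x ℓ (x v) ≠ 0) {c : ℝ} (hc : 1 ≤ c) :
    -((d + 1) * (B.card * Real.log c) + n * (Real.pi ^ d + 2 * d) / c +
      ∑ v ∈ B, ∑ j, (2 * Real.log (1 + |x v j|) + 2 * Real.log (1 + segWidth x ℓ j))) ≤
      ∑ v ∈ B, Real.log (densityEst x ℓ (x v)) := by
  obtain ⟨a, ha⟩ := exists_isWindow x ℓ
  rw [Finset.sum_congr rfl fun v hv => log_densityEst_eq ha (hB v hv), Finset.sum_add_distrib,
    Finset.sum_add_distrib, Finset.sum_comm (f := fun v j => logSpac x ℓ a v j)]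
  have h1 := neg_le_sum_logHist ha B hB hc
  have h2 : ∑ j : Fin d, -(B.card * Real.log c + 2 * n / c) ≤
      ∑ j, ∑ v ∈ B, logSpac x ℓ a v j :=
    Finset.sum_le_sum fun j _ => neg_le_sum_logSpac ha j (hinj j) B hB hc
  have h3 : -∑ v ∈ B, ∑ j, (2 * Real.log (1 + |x v j|) + 2 * Real.log (1 + segWidth x ℓ j)) ≤
      ∑ v ∈ B, ∑ j, logRef x ℓ a v j := by
    rw [← Finset.sum_neg_distrib]
    refine Finset.sum_le_sum fun v hv => ?_
    rw [← Finset.sum_neg_distrib]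
    exact Finset.sum_le_sum fun j _ => neg_le_logRef hℓ ha (hB v hv) j
  rw [Finset.sum_const, Finset.card_univ, Fintype.card_fin, nsmul_eq_mul] at h2
  have h4 : n * (Real.pi ^ d + 2 * d) / c = n * Real.pi ^ d / c + d * (2 * n / c) := by ring
  rw [h4]
  linarith

/-- A lower bound for the whole estimator, in which the mesh enters with a small factor only. -/
lemma neg_le_sum_log_densityEst_all (hℓ : 1 ≤ ℓ) (hinj : ∀ j, Function.Injective fun v => x v j)
    (B : Finset (Fin n)) (hB : ∀ v ∈ B, densityEst x ℓ (x v) ≠ 0) :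
    -(n * (Real.pi ^ d + 2 * d) + 16 * ∑ v, ∑ j, Real.log (1 + |x v j|) +
      8 * (∑ v, (par x ℓ v : ℝ) / cnt x ℓ v) * ∑ j, Real.log (1 + segWidth x ℓ j)) ≤
      ∑ v ∈ B, Real.log (densityEst x ℓ (x v)) := by
  obtain ⟨a, ha⟩ := exists_isWindow x ℓ
  rw [Finset.sum_congr rfl fun v hv => log_densityEst_eq ha (hB v hv), Finset.sum_add_distrib,
    Finset.sum_add_distrib, Finset.sum_comm (f := fun v j => logSpac x ℓ a v j),
    Finset.sum_comm (f := fun v j => logRef x ℓ a v j)]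
  have h1 := neg_le_sum_logHist ha B hB (c := 1) le_rfl
  have h2 : ∑ j : Fin d, -(B.card * Real.log 1 + 2 * n / 1) ≤
      ∑ j, ∑ v ∈ B, logSpac x ℓ a v j :=
    Finset.sum_le_sum fun j _ => neg_le_sum_logSpac ha j (hinj j) B hB le_rfl
  have h3 : ∀ j, -(16 * ∑ v, Real.log (1 + |x v j|) +
      8 * (∑ v, (par x ℓ v : ℝ) / cnt x ℓ v) * Real.log (1 + segWidth x ℓ j)) ≤
      ∑ v ∈ B, logRef x ℓ a v j := by
    intro j
    set W := Real.log (1 + segWidth x ℓ j) with hW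
    have hW0 : 0 ≤ W := Real.log_nonneg (by linarith [segWidth_nonneg x ℓ j])
    set ψ : Fin n → ℤ → ℝ := fun v r => Real.log (1 + |os x ℓ v j r|) with hψ
    have hψ0 : ∀ v r, 0 ≤ ψ v r := fun v r => Real.log_nonneg (by linarith [abs_nonneg (os x ℓ v j r)])
    have hψrk : ∀ v, ψ v (rk x ℓ j v) = Real.log (1 + |x v j|) := fun v => by
      simp only [hψ, os_rk]
    -- The ends of the window lie between the point and the order statistics `2 m` ranks away.
    -- Summed over a cell these shifted terms reproduce the unshifted sum, except for the extreme
    -- order statistics.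
    set F : Fin n → ℝ := fun v => 2 * (ψ v ((rk x ℓ j v : ℤ) - (2 * par x ℓ v : ℕ)) +
      ψ v ((rk x ℓ j v : ℤ) + (2 * par x ℓ v : ℕ)) + 2 * Real.log (1 + |x v j|)) with hF
    have hF0 : ∀ v, 0 ≤ F v := fun v => by
      have h1 := hψ0 v ((rk x ℓ j v : ℤ) - (2 * par x ℓ v : ℕ))
      have h2 := hψ0 v ((rk x ℓ j v : ℤ) + (2 * par x ℓ v : ℕ))
      have h3 : 0 ≤ Real.log (1 + |x v j|) := Real.log_nonneg (by linarith [abs_nonneg (x v j)])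
      simp only [hF]; linarith
    have hlow : ∀ v ∈ B, -F v ≤ logRef x ℓ a v j := by
      intro v hv
      have hg := gap_pos ha (hB v hv) j
      refine le_trans ?_ (neg_le_log_arctan_sub_div (sub_pos.1 hg))
      have hr := rk_mem_window ha v j (hinj j)
      have e1 : |os x ℓ v j ((a v j : ℤ) - par x ℓ v)| ≤
          max |os x ℓ v j ((rk x ℓ j v : ℤ) - (2 * par x ℓ v : ℕ))| |x v j| :=
        abs_le_max_abs_abs (os_mono x ℓ v j (by push_cast; omega)) (ha.lo_le v j)
      have e2 : |os x ℓ v j ((a v j : ℤ) + par x ℓ v)| ≤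
          max |x v j| |os x ℓ v j ((rk x ℓ j v : ℤ) + (2 * par x ℓ v : ℕ))| :=
        abs_le_max_abs_abs (ha.le_hi v j) (os_mono x ℓ v j (by push_cast; omega))
      have e3 := log_one_add_max_le (s := os x ℓ v j ((a v j : ℤ) - par x ℓ v))
        (t := os x ℓ v j ((a v j : ℤ) + par x ℓ v))
      have e4 := (Real.log_le_log (by positivity) (add_le_add_right e1 1)).trans log_one_add_max_le
      have e5 := (Real.log_le_log (by positivity) (add_le_add_right e2 1)).trans log_one_add_max_le
      simp only [hF, hψ]
      linarith
    have hsum : ∑ v, F v ≤ ∑ v, (16 * Real.log (1 + |x v j|) +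
        8 * ((par x ℓ v : ℝ) / cnt x ℓ v) * W) := by
      apply sum_le_sum_of_pts x ℓ
      intro v
      set N := cnt x ℓ v with hN
      set m := par x ℓ v with hm
      have hNpos : (0 : ℝ) < N := by exact_mod_cast one_le_cnt x ℓ v
      have hmN : (m : ℝ) ≤ N := by exact_mod_cast spacingParam_le_self (one_le_cnt x ℓ v)
      set T := ∑ u ∈ pts x ℓ v, Real.log (1 + |x u j|) with hT
      have hTeq : T = ∑ i ∈ Finset.range N, ψ v ((i : ℤ) + 1) := by
        have h5 := sum_pts_rk x ℓ v j (hinj j) (fun r => ψ v (r : ℤ))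
        push_cast at h5
        rw [hT, hN, ← h5]
        refine Finset.sum_congr rfl fun u hu => ?_
        rw [← hψrk u]
        simp only [hψ, os_congr hu]
      have hA : ∑ u ∈ pts x ℓ v, ψ u ((rk x ℓ j u : ℤ) - (2 * par x ℓ u : ℕ)) ≤
          T + (2 * m : ℕ) * ψ v 1 := by
        have h5 := sum_shift_down_le (ψ v) (hψ0 v) N
          (fun r hr => by simp only [hψ, os_of_le_one x ℓ v j hr]) (2 * m)
        rw [hTeq]
        refine le_trans (le_of_eq ?_) h5
        have := sum_pts_rk x ℓ v j (hinj j) (fun r => ψ v ((r : ℤ) - (2 * m : ℕ)))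
        push_cast at this ⊢
        rw [← this]
        refine Finset.sum_congr rfl fun u hu => ?_
        simp only [hψ, os_congr hu, par_congr hu]; rfl
      have hBd : ∑ u ∈ pts x ℓ v, ψ u ((rk x ℓ j u : ℤ) + (2 * par x ℓ u : ℕ)) ≤
          T + (2 * m : ℕ) * ψ v N := by
        have h5 := sum_shift_up_le (ψ v) (hψ0 v) N
          (fun r hr => by simp only [hψ, os_of_cnt_le x ℓ v j hr, hN]) (2 * m)
        rw [hTeq]
        refine le_trans (le_of_eq ?_) h5
        have := sum_pts_rk x ℓ v j (hinj j) (fun r => ψ v ((r : ℤ) + (2 * m : ℕ)))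
        push_cast at this ⊢
        rw [← this]
        refine Finset.sum_congr rfl fun u hu => ?_
        simp only [hψ, os_congr hu, par_congr hu]; rfl
      have hedge : ∀ r, N * ψ v r ≤ T + N * W := by
        intro r
        have h6 : ∀ u ∈ pts x ℓ v, ψ v r ≤ Real.log (1 + |x u j|) + W := by
          intro u hu
          have h7 := os_abs_sub_le hℓ x u j r
          rw [os_congr hu] at h7
          exact (Real.log_le_log (by positivity) (add_le_add_right h7 1)).trans
            (log_one_add_abs_add_le (segWidth_nonneg x ℓ j))
        have h8 := Finset.sum_le_sum h6
        rw [Finset.sum_const, Finset.sum_add_distrib, Finset.sum_const, nsmul_eq_mul,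
          nsmul_eq_mul] at h8
        exact h8
      -- An extreme order statistic is within one mesh width of every point of the cell, so its term
      -- is at most the cell average plus `W`. It occurs only in proportion to `m`, which is why the
      -- mesh is weighted by `m / N` per point.
      have hedge' : ∀ r, m * ψ v r ≤ T + m * W := by
        intro r
        have h9 := hedge r
        have hT0 : 0 ≤ T := Finset.sum_nonneg fun u _ =>
          Real.log_nonneg (by linarith [abs_nonneg (x u j)])
        have h10 : ψ v r ≤ T / N + W := by
          rw [div_add' _ _ _ hNpos.ne', le_div_iff₀ hNpos]; linarith
        calc m * ψ v r ≤ m * (T / N + W) := by gcongr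
          _ = m / N * T + m * W := by ring
          _ ≤ 1 * T + m * W := by
              gcongr
              rwa [div_le_one hNpos]
          _ = _ := by ring
      have hR : ∑ u ∈ pts x ℓ v, (16 * Real.log (1 + |x u j|) +
          8 * ((par x ℓ u : ℝ) / cnt x ℓ u) * W) = 16 * T + 8 * m * W := by
        rw [Finset.sum_add_distrib, ← Finset.mul_sum]
        congr 1
        rw [Finset.sum_congr rfl fun u hu => by rw [par_congr hu, cnt_congr hu],
          Finset.sum_const, nsmul_eq_mul]
        change (N : ℝ) * _ = _
        rw [← hm, ← hN]
        field_simp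
      rw [hR]
      simp only [hF]
      rw [← Finset.mul_sum, Finset.sum_add_distrib, Finset.sum_add_distrib, ← Finset.mul_sum, ← hT]
      have e1 := hedge' 1
      have e2 := hedge' N
      push_cast at hA hBd
      push_cast
      linarith
    calc -(16 * ∑ v, Real.log (1 + |x v j|) + 8 * (∑ v, (par x ℓ v : ℝ) / cnt x ℓ v) * W)
        = -∑ v, (16 * Real.log (1 + |x v j|) + 8 * ((par x ℓ v : ℝ) / cnt x ℓ v) * W) := by
          rw [Finset.sum_add_distrib, ← Finset.mul_sum, ← Finset.sum_mul, ← Finset.mul_sum]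
      _ ≤ -∑ v, F v := neg_le_neg hsum
      _ ≤ -∑ v ∈ B, F v := neg_le_neg (Finset.sum_le_sum_of_subset_of_nonneg
          (Finset.subset_univ B) fun v _ _ => hF0 v)
      _ = ∑ v ∈ B, -F v := by rw [Finset.sum_neg_distrib]
      _ ≤ _ := Finset.sum_le_sum hlow
  have h4 := Finset.sum_le_sum fun j (_ : j ∈ (Finset.univ : Finset (Fin d))) => h3 j
  rw [Finset.sum_neg_distrib, Finset.sum_add_distrib, ← Finset.mul_sum, ← Finset.mul_sum,
    Finset.sum_comm] at h4
  rw [Finset.sum_const, Finset.card_univ, Fintype.card_fin, nsmul_eq_mul, Real.log_one] at h2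
  rw [Real.log_one] at h1
  have h5 : (n : ℝ) * (Real.pi ^ d + 2 * d) = n * Real.pi ^ d / 1 + d * (2 * n / 1) := by ring
  rw [h5]
  linarith

end Window

end

end PSS

/-! ### Upper bounds for the estimator in terms of the potential -/

namespace PSS

noncomputable section

variable {d n : ℕ}

/-- The dominating function of a single observation. -/
def domFun (f : (Fin d → ℝ) → ℝ) (t : Fin d → ℝ) : ℝ :=
  |Real.log (f t)| + ∑ j, 2 * Real.log (1 + |t j|)

lemma log_one_add_abs_nonneg (s : ℝ) : 0 ≤ Real.log (1 + |s|) :=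
  Real.log_nonneg (by linarith [abs_nonneg s])

lemma domFun_nonneg (f : (Fin d → ℝ) → ℝ) (t : Fin d → ℝ) : 0 ≤ domFun f t :=
  add_nonneg (abs_nonneg _) (Finset.sum_nonneg fun _ _ =>
    mul_nonneg zero_le_two (log_one_add_abs_nonneg _))

/-- The factor `refDensity / f` of the potential must be removed when logarithms are taken; since `1
+ t ^ 2 ≤ (1 + |t|) ^ 2`, its cost is an integrable function of one observation. -/
lemma neg_domFun_le (f : (Fin d → ℝ) → ℝ) (t : Fin d → ℝ) :
    -domFun f t ≤ Real.log (refDensity t) - Real.log (f t) := by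
  have h1 : -∑ j, 2 * Real.log (1 + |t j|) ≤ Real.log (refDensity t) := by
    unfold refDensity
    rw [Real.log_prod (fun j _ => by positivity), ← Finset.sum_neg_distrib]
    refine Finset.sum_le_sum fun j _ => ?_
    rw [one_div, Real.log_inv, neg_le_neg_iff]
    have : (2 : ℝ) * Real.log (1 + |t j|) = Real.log ((1 + |t j|) ^ 2) := by
      rw [Real.log_pow]; norm_num
    rw [this]
    refine Real.log_le_log (by positivity) ?_
    nlinarith [abs_nonneg (t j), sq_abs (t j)]
  have := le_abs_self (Real.log (f t))
  unfold domFun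
  linarith

/-- A single term suffices: for `4 ^ p ≤ r / θ < 4 ^ (p + 1)` the weight `2 ^ p` is at least half
the root. If `r < θ`, the constant term is enough. -/
lemma half_sqrt_le_one_add_tsum {r θ c : ℝ} (hθ : 0 < θ) (hc : 0 ≤ c) :
    ENNReal.ofReal (c * √(r / θ) / 2) ≤
      ENNReal.ofReal c + ∑' p : ℕ, if θ ≤ r / 4 ^ p then ENNReal.ofReal (2 ^ p * c) else 0 := by
  rcases le_or_gt 1 (r / θ) with h | h
  · obtain ⟨p, hp1, hp2⟩ := exists_nat_pow_near h (by norm_num : (1 : ℝ) < 4)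
    refine le_trans ?_ (le_add_left (ENNReal.le_tsum p))
    have h1 : θ ≤ r / 4 ^ p := by
      rw [le_div_iff₀ (by positivity)]
      rw [le_div_iff₀ hθ] at hp1; linarith
    rw [if_pos h1]
    refine ENNReal.ofReal_le_ofReal ?_
    have h2 : √(r / θ) ≤ 2 * 2 ^ p := by
      rw [Real.sqrt_le_left (by positivity)]
      refine hp2.le.trans (le_of_eq ?_)
      rw [mul_pow, ← pow_mul, mul_comm p 2, pow_mul, pow_succ]; norm_num; ring
    nlinarith
  · refine le_trans (ENNReal.ofReal_le_ofReal ?_) le_self_add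
    have h2 : √(r / θ) ≤ 1 := by
      rw [Real.sqrt_le_left (by positivity)]; linarith
    nlinarith [Real.sqrt_nonneg (r / θ)]

lemma nbrCount_pos (c : ℕ) : 1 ≤ nbrCount c := le_max_left _ _

lemma sqrt_le_nbrCount (c : ℕ) : √c ≤ 8 * nbrCount c := by
  have h1 := Nat.lt_floor_add_one (√c / 4)
  have h2 : (⌊√(c : ℝ) / 4⌋₊ : ℝ) ≤ nbrCount c := by exact_mod_cast le_max_right _ _
  have h3 : (1 : ℝ) ≤ nbrCount c := by exact_mod_cast nbrCount_pos c
  linarith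

/-- The right-hand side is the number of points of one parity guaranteed in a window by
`card_window_parity`; the factor `1 / 4` in `nbrCount` is chosen for this. -/
lemma nbrCount_le {c N : ℕ} (hcN : c ≤ N) : nbrCount c ≤ max 1 (spacingParam N / 2) := by
  refine max_le_max le_rfl ?_
  have h0 := sqrt_lt_spacingParam N
  have h1 : √(c : ℝ) ≤ √N := Real.sqrt_le_sqrt (by exact_mod_cast hcN)
  have h2 : (⌊√(c : ℝ) / 4⌋₊ : ℝ) ≤ √c / 4 := Nat.floor_le (by positivity)
  have h3 : (4 * (⌊√(c : ℝ) / 4⌋₊ : ℝ)) < spacingParam N + 1 := by linarith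
  have h4 : 4 * ⌊√(c : ℝ) / 4⌋₊ < spacingParam N + 1 := by exact_mod_cast h3
  omega

lemma two_mul_spacingParam_le {c N : ℕ} (hcN : N ≤ 3 * c) :
    2 * (spacingParam N : ℝ) ≤ 30 * nbrCount c := by
  have h0 := spacingParam_le N
  have h1 := sqrt_le_nbrCount c
  have h3 : (1 : ℝ) ≤ nbrCount c := by exact_mod_cast nbrCount_pos c
  have h2 : √(N : ℝ) ≤ 1.75 * √c := by
    rw [Real.sqrt_le_left (by positivity), mul_pow, Real.sq_sqrt (by positivity)]
    have : (N : ℝ) ≤ 3 * c := by exact_mod_cast hcN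
    have : (0 : ℝ) ≤ c := by positivity
    nlinarith
  linarith

variable {x : Fin n → Fin d → ℝ} {ℓ : ℕ} {a : Fin n → Fin d → ℕ}

lemma cellOn_eq_cellIndex {E : Finset (Fin n)}
    (hlo : ∀ j, lowOn E x j = lowOn Finset.univ x j)
    (hhi : ∀ j, highOn E x j = highOn Finset.univ x j) (t : Fin d → ℝ) :
    cellOn E x ℓ t = cellIndex x ℓ t := by
  rw [cellIndex_eq_cellOn]; unfold cellOn; simp only [hlo, hhi]

/-- The potential of the points of one parity dominates a spacing factor. -/
lemma exp_le_potential {f : (Fin d → ℝ) → ℝ} (ha : IsWindow x ℓ a) (j : Fin d)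
    (hinj : Function.Injective fun v => x v j) {v : Fin n} (hv : densityEst x ℓ (x v) ≠ 0)
    (hfv : 0 < f (x v)) {E : Finset (Fin n)}
    (hlo : ∀ j, lowOn E x j = lowOn Finset.univ x j)
    (hhi : ∀ j, highOn E x j = highOn Finset.univ x j) {e : ℕ} (he : e < 2)
    (hE : ∀ u ∈ pts x ℓ v, rk x ℓ j u % 2 = e → u ∈ E) :
    ENNReal.ofReal (Real.exp (Real.log (refDensity (x v)) - Real.log (f (x v)) + logHist x ℓ v +
      logSpac x ℓ a v j / 2 - 4)) ≤ potential f ℓ j E (x v) x := by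
  classical
  have hcell := cellOn_eq_cellIndex (ℓ := ℓ) hlo hhi
  set D := E.filter fun u => cellOn E x ℓ (x u) = cellOn E x ℓ (x v) with hD
  set c := D.card with hc
  set N := cnt x ℓ v with hN
  set m := par x ℓ v with hm
  set θ := agap x ℓ a v j with hθ
  have hθ0 : 0 < θ := agap_pos ha hv j
  set σ := side x ℓ v j with hσ
  have hσ0 : 0 < σ := side_pos ha hv j
  have hV0 : 0 < cellVol x ℓ v := cellVol_pos ha hv
  have hN2 : 2 ≤ N := two_le_cnt_of_densityEst_ne_zero hv
  have hDpts : ∀ u, u ∈ D ↔ u ∈ E ∧ u ∈ pts x ℓ v := by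
    intro u
    simp only [hD, Finset.mem_filter, hcell, mem_pts]
  have hcN : c ≤ N := Finset.card_le_card fun u hu => ((hDpts u).1 hu).2
  -- The points of parity `e` in the cell all belong to `D`, and there are at least `⌊N / 2⌋` of
  -- them; `N ≥ 2` turns this into a third.
  have hNc : N ≤ 3 * c := by
    have h1 := card_rank_parity (C := pts x ℓ v) (y := fun u => x u j) hinj.injOn le_rfl
      (le_refl (pts x ℓ v).card) e he
    have h2 : ((pts x ℓ v).filter fun u => (1 ≤ rank (pts x ℓ v) (fun u => x u j) u ∧
        rank (pts x ℓ v) (fun u => x u j) u ≤ (pts x ℓ v).card) ∧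
        rank (pts x ℓ v) (fun u => x u j) u % 2 = e).card ≤ c := by
      refine Finset.card_le_card fun u hu => ?_
      obtain ⟨hu1, _, hu3⟩ := Finset.mem_filter.1 hu
      refine (hDpts u).2 ⟨hE u hu1 ?_, hu1⟩
      unfold rk; rw [pts_congr hu1]; exact hu3
    have h3 : N = (pts x ℓ v).card := rfl
    omega
  have hc1 : 1 ≤ c := by omega
  set q := nbrCount c with hq
  have hq1 : (1 : ℝ) ≤ q := by exact_mod_cast nbrCount_pos c
  have hcR : (1 : ℝ) ≤ c := by exact_mod_cast hc1
  set r := σ * (q / c) with hr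
  have hr0 : 0 < r := by positivity
  -- the neighbours
  set W := (pts x ℓ v).filter fun u => (os x ℓ v j ((a v j : ℤ) - m) ≤ x u j ∧
      x u j ≤ os x ℓ v j ((a v j : ℤ) + m)) ∧ rk x ℓ j u % 2 = e with hW
  have hWq : q ≤ W.card := by
    have h1 := card_window_parity (C := pts x ℓ v) (y := fun u => x u j) hinj.injOn
      ⟨v, self_mem_pts x ℓ v⟩ (a := a v j) (ha.le_cnt v j) (gap_pos ha hv j) e he
    refine (nbrCount_le hcN).trans (h1.trans (Finset.card_le_card fun u hu => ?_))
    obtain ⟨hu1, hu2, hu3⟩ := Finset.mem_filter.1 hu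
    refine Finset.mem_filter.2 ⟨hu1, hu2, ?_⟩
    unfold rk; rw [pts_congr hu1]; exact hu3
  have hWD : W ⊆ D := fun u hu => by
    obtain ⟨hu1, _, hu3⟩ := Finset.mem_filter.1 hu
    exact (hDpts u).2 ⟨hE u hu1 hu3, hu1⟩
  have hnear : ∀ u ∈ W, |Real.arctan (x u j) - Real.arctan (x v j)| ≤ θ := by
    intro u hu
    obtain ⟨_, ⟨h1, h2⟩, _⟩ := Finset.mem_filter.1 hu
    have g1 := Real.arctan_mono h1
    have g2 := Real.arctan_mono h2
    have g3 := Real.arctan_mono (ha.lo_le v j)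
    have g4 := Real.arctan_mono (ha.le_hi v j)
    rw [hθ, abs_le]; unfold agap; constructor <;> linarith
  set T : ℝ≥0∞ := ∑' p : ℕ, if θ ≤ r / 4 ^ p then ENNReal.ofReal (2 ^ p * (c / q : ℝ)) else 0 with hT
  set V := ENNReal.ofReal (cellVol x ℓ v) with hV
  have hcellcnt : ∀ u ∈ D, cellCnt E x ℓ (x u) = c := by
    intro u hu
    have h1 := (Finset.mem_filter.1 hu).2
    unfold cellCnt; rw [h1]
  have hvol : ∀ u ∈ D, refPi d (cellSet E x ℓ (x u)) = V := by
    intro u hu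
    have h1 := (Finset.mem_filter.1 hu).2
    rw [hV, cellVol_eq, ofReal_measureReal]
    congr 1
    unfold cellSet
    rw [h1]; simp only [hcell, cellIndex_eq_cellOn]
  have hrad : ∀ u ∈ D, nbrRadius E x ℓ j (x u) = r := by
    intro u hu
    have h1 := (Finset.mem_filter.1 hu).2
    unfold nbrRadius
    rw [hcellcnt u hu, hr, hσ]
    congr 1
    unfold side segSet
    rw [h1, hcell, cellIndex_eq_cellOn, hlo, hhi]
  have hw1 : ∀ u ∈ D, V⁻¹ * (1 + if u ∈ W then T else 0) ≤ nbrWeight E x ℓ j (x u) (x v) := by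
    intro u hu
    have h1 := (Finset.mem_filter.1 hu).2
    unfold nbrWeight
    rw [if_pos h1, hvol u hu, hrad u hu, hcellcnt u hu]
    gcongr
    split_ifs with huW
    · refine ENNReal.tsum_le_tsum fun p => ?_
      split_ifs with h2 h3
      · exact le_rfl
      · exact absurd ((hnear u huW).trans h2) h3
      · exact zero_le
      · exact zero_le
    · exact zero_le
  -- Each of the `c` points of the cell supplies the constant 1, and each of at least `q` neighbours
  -- in the window supplies the whole series, since its distance is at most `θ`. The factor `c / q`
  -- in the weights restores `c`.
  have hsum : V⁻¹ * (ENNReal.ofReal (c * √(r / θ) / 2)) ≤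
      ∑ u ∈ E, nbrWeight E x ℓ j (x u) (x v) := by
    refine le_trans ?_ (Finset.sum_le_sum_of_subset (Finset.filter_subset _ _ : D ⊆ E))
    refine le_trans ?_ (Finset.sum_le_sum hw1)
    rw [← Finset.mul_sum, Finset.sum_add_distrib, Finset.sum_ite_mem,
      Finset.inter_eq_right.2 hWD]
    gcongr
    refine (half_sqrt_le_one_add_tsum hθ0 (by positivity)).trans ?_
    simp only [Finset.sum_const, nsmul_eq_mul, mul_one]
    refine add_le_add (by rw [ENNReal.ofReal_natCast]) ?_
    refine le_trans ?_ (mul_le_mul_left (show ((q : ℕ) : ℝ≥0∞) ≤ (W.card : ℝ≥0∞) by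
      exact_mod_cast hWq) _)
    rw [hT, ← ENNReal.tsum_mul_left]
    refine ENNReal.tsum_le_tsum fun p => ?_
    split_ifs
    · rw [← ENNReal.ofReal_natCast, ← ENNReal.ofReal_mul (by positivity)]
      refine ENNReal.ofReal_le_ofReal (le_of_eq ?_)
      field_simp
    · simp
  have hnpos : 0 < n := Fin.pos v
  have hnR : (0 : ℝ) < n := by exact_mod_cast hnpos
  have hNR : (2 : ℝ) ≤ N := by exact_mod_cast hN2
  have hmR : (1 : ℝ) ≤ m := by exact_mod_cast one_le_par x ℓ v
  unfold potential
  calc ENNReal.ofReal (Real.exp (Real.log (refDensity (x v)) - Real.log (f (x v)) +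
        logHist x ℓ v + logSpac x ℓ a v j / 2 - 4))
      ≤ ENNReal.ofReal (refDensity (x v) / f (x v) *
          ((n : ℝ)⁻¹ * ((cellVol x ℓ v)⁻¹ * (c * √(r / θ) / 2)))) := by
        refine ENNReal.ofReal_le_ofReal ?_
        have e1 : Real.exp (logHist x ℓ v) = N / (n * cellVol x ℓ v) :=
          Real.exp_log (by positivity)
        have e2 : Real.exp (logSpac x ℓ a v j / 2) = √(2 * m * σ / (N * θ)) := by
          rw [Real.exp_half, logSpac, Real.exp_log (by positivity)]
        rw [Real.exp_sub, Real.exp_add, Real.exp_add, Real.exp_sub, e1, e2,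
          Real.exp_log (refDensity_pos _), Real.exp_log hfv]
        -- This absorbs the constants: a factor 2 from `half_sqrt_le_one_add_tsum` and 21 from
        -- comparing `N`, `m` with `c`, `q`, where `2 m N ≤ 90 q c ≤ 21 ^ 2 q c`.
        have e4 : (42 : ℝ) ≤ Real.exp 4 := by
          have h1 := Real.exp_one_gt_d9
          have h2 : Real.exp 4 = (Real.exp 1) ^ 4 := by rw [← Real.exp_nat_mul]; norm_num
          rw [h2]
          have h3 : (2.7 : ℝ) ^ 4 ≤ Real.exp 1 ^ 4 := by gcongr; linarith
          norm_num at h3 ⊢; linarith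
        have e5 : N * √(2 * m * σ / (N * θ)) ≤ 21 * (c * √(r / θ)) := by
          have g1 : (N : ℝ) * √(2 * m * σ / (N * θ)) = √(2 * m * N * (σ / θ)) := by
            rw [← Real.sqrt_sq (by positivity : (0 : ℝ) ≤ N), ← Real.sqrt_mul (by positivity),
              Real.sqrt_sq (by positivity)]
            congr 1; field_simp
          have g2 : 21 * ((c : ℝ) * √(r / θ)) = √(441 * (q * c) * (σ / θ)) := by
            rw [← mul_assoc, ← Real.sqrt_sq (by positivity : (0 : ℝ) ≤ 21 * c),
              ← Real.sqrt_mul (by positivity)]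
            congr 1; rw [hr]; field_simp; ring
          rw [g1, g2]
          refine Real.sqrt_le_sqrt (mul_le_mul_of_nonneg_right ?_ (by positivity))
          have g3 := two_mul_spacingParam_le hNc
          have g4 : (N : ℝ) ≤ 3 * c := by exact_mod_cast hNc
          have g5 : (m : ℝ) = spacingParam N := rfl
          rw [← g5, ← hq] at g3
          have g6 : (2 * m : ℝ) * N ≤ 30 * q * (3 * c) := by gcongr
          nlinarith [mul_nonneg (by positivity : (0:ℝ) ≤ q) (by positivity : (0:ℝ) ≤ c)]
        calc refDensity (x v) / f (x v) * (N / (n * cellVol x ℓ v)) *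
              √(2 * m * σ / (N * θ)) / Real.exp 4
            = refDensity (x v) / f (x v) * (n : ℝ)⁻¹ * (cellVol x ℓ v)⁻¹ *
              (N * √(2 * m * σ / (N * θ))) / Real.exp 4 := by field_simp
          _ ≤ refDensity (x v) / f (x v) * (n : ℝ)⁻¹ * (cellVol x ℓ v)⁻¹ *
              (21 * (c * √(r / θ))) / 42 := by
              have := refDensity_pos (x v)
              gcongr
          _ = _ := by ring
    _ = ENNReal.ofReal (refDensity (x v) / f (x v)) * ((n : ℝ≥0∞)⁻¹ *
          (V⁻¹ * ENNReal.ofReal (c * √(r / θ) / 2))) := by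
        have := refDensity_pos (x v)
        rw [ENNReal.ofReal_mul (by positivity), ENNReal.ofReal_mul (by positivity),
          ENNReal.ofReal_mul (by positivity), ENNReal.ofReal_inv_of_pos hnR,
          ENNReal.ofReal_inv_of_pos hV0, ENNReal.ofReal_natCast]
    _ ≤ _ := by gcongr

lemma one_le_refMeasure_univ : 1 ≤ refMeasure.real Set.univ := by
  have h1 := le_refMeasure_Icc (show (-1 : ℝ) ≤ 1 by norm_num)
  rw [Real.arctan_neg, Real.arctan_one] at h1
  have h2 : refMeasure.real (Set.Icc (-1) 1) ≤ refMeasure.real Set.univ :=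
    measureReal_mono (Set.subset_univ _)
  have := Real.pi_gt_three
  linarith

lemma cellOn_one (E : Finset (Fin n)) (y : Fin n → Fin d → ℝ) (t : Fin d → ℝ) :
    cellOn E y 1 t = 0 := by
  funext j; simp [cellOn, segIndex]

/-- The potential of a single point. -/
lemma le_potential_singleton (f : (Fin d → ℝ) → ℝ) (j : Fin d) (x : Fin n → Fin d → ℝ)
    (u v : Fin n) :
    ENNReal.ofReal (refDensity (x v) / f (x v)) * ((ENNReal.ofReal (Real.pi ^ d))⁻¹ *
      (1 + ∑' p : ℕ, if |Real.arctan (x u j) - Real.arctan (x v j)| ≤ 1 / 4 ^ p then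
        ENNReal.ofReal (2 ^ p) else 0)) ≤ n * potential f 1 j {u} (x v) x := by
  have hnpos : 0 < n := Fin.pos v
  -- With `ℓ = 1` there is a single cell, the whole space, and it contains one point of the index
  -- set.
  have h1 : nbrCount 1 = 1 := by
    unfold nbrCount
    have : ⌊√((1 : ℕ) : ℝ) / 4⌋₊ = 0 := by
      rw [Nat.floor_eq_zero]; norm_num
    rw [this]; rfl
  have hcc : cellCnt {u} x 1 (x u) = 1 := by simp [cellCnt, Finset.filter_singleton]
  have hrad : 1 ≤ nbrRadius {u} x 1 j (x u) := by
    unfold nbrRadius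
    rw [hcc, h1]
    have : segSet {u} x 1 (x u) j = Set.univ := by
      ext s; simp [mem_segSet, segIndex, cellOn]
    rw [this]; simpa using one_le_refMeasure_univ
  unfold potential
  rw [Finset.sum_singleton, mul_left_comm (n : ℝ≥0∞), ← mul_assoc (n : ℝ≥0∞),
    ENNReal.mul_inv_cancel (by simpa using hnpos.ne') (ENNReal.natCast_ne_top n), one_mul]
  gcongr
  unfold nbrWeight
  rw [if_pos (by simp only [cellOn_one]), hcc, h1]
  gcongr ?_⁻¹ * (1 + ?_)
  · exact (measure_mono (Set.subset_univ _)).trans refPi_univ_le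
  · refine ENNReal.tsum_le_tsum fun p => ?_
    split_ifs with h2 h3
    · simp
    · exact absurd (h2.trans (by gcongr)) h3
    · exact zero_le
    · exact zero_le

/-- At distance zero every term of the series is present, so the potential is infinite. Finite
expectation will therefore exclude coinciding coordinates. -/
lemma ne_of_potential_singleton {f : (Fin d → ℝ) → ℝ} {j : Fin d} {x : Fin n → Fin d → ℝ}
    {u v : Fin n} (hfv : 0 < f (x v)) (h : n * potential f 1 j {u} (x v) x ≠ ⊤) :
    x u j ≠ x v j := by
  intro huv
  apply h
  rw [eq_top_iff]
  refine le_trans ?_ (le_potential_singleton f j x u v)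
  have h1 : (∑' p : ℕ, if |Real.arctan (x u j) - Real.arctan (x v j)| ≤ 1 / 4 ^ p then
        ENNReal.ofReal (2 ^ p) else 0) = ⊤ := by
    rw [eq_top_iff, ← ENNReal.tsum_const_eq_top_of_ne_zero (α := ℕ) (c := 1) one_ne_zero]
    refine ENNReal.tsum_le_tsum fun p => ?_
    rw [huv, sub_self, abs_zero, if_pos (by positivity), ← ENNReal.ofReal_one]
    exact ENNReal.ofReal_le_ofReal (one_le_pow₀ (by norm_num))
  rw [h1, add_top, ENNReal.mul_top (by simp), ENNReal.mul_top]
  have := refDensity_pos (x v)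
  rw [Ne, ENNReal.ofReal_eq_zero, not_le]
  positivity

/-- The potential of one point dominates a multiple of the inverse root of the distance; taking
logarithms doubles the bound. -/
lemma neg_log_le_of_potential_singleton {f : (Fin d → ℝ) → ℝ} {j : Fin d}
    {x : Fin n → Fin d → ℝ} {u v : Fin n} (hfv : 0 < f (x v)) {L : ℝ}
    (h : n * potential f 1 j {u} (x v) x ≤ ENNReal.ofReal (Real.exp L)) :
    -Real.log |Real.arctan (x u j) - Real.arctan (x v j)| ≤
      2 * (L + domFun f (x v) + d * Real.log Real.pi + Real.log 2) := by
  have hne : x u j ≠ x v j := ne_of_potential_singleton hfv (ne_top_of_le_ne_top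
    ENNReal.ofReal_ne_top h)
  set θ := |Real.arctan (x u j) - Real.arctan (x v j)| with hθ
  have hθ0 : 0 < θ := abs_pos.2 (sub_ne_zero.2 fun h => hne (Real.arctan_injective h))
  have h1 := (le_potential_singleton f j x u v).trans h
  have h2 := half_sqrt_le_one_add_tsum (r := 1) hθ0 zero_le_one
  simp only [mul_one, one_mul, ENNReal.ofReal_one] at h2
  have hρ := refDensity_pos (x v)
  have h3 : ENNReal.ofReal (refDensity (x v) / f (x v) * ((Real.pi ^ d)⁻¹ * (√(1 / θ) / 2))) ≤
      ENNReal.ofReal (Real.exp L) := by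
    refine le_trans ?_ h1
    rw [ENNReal.ofReal_mul (by positivity), ENNReal.ofReal_mul (by positivity),
      ENNReal.ofReal_inv_of_pos (by positivity)]
    gcongr
  have h4 := (ENNReal.ofReal_le_ofReal_iff (Real.exp_pos L).le).1 h3
  have h5 := Real.log_le_log (by positivity) h4
  rw [Real.log_exp, Real.log_mul (by positivity) (by positivity),
    Real.log_mul (by positivity) (by positivity), Real.log_div hρ.ne' hfv.ne', Real.log_inv,
    Real.log_pow, Real.log_div (by positivity) two_ne_zero, Real.log_sqrt (by positivity),
    one_div, Real.log_inv] at h5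
  have h6 := neg_domFun_le f (x v)
  linarith

/-- A crude bound for a single contribution to the estimator. -/
lemma log_densityEst_le_single {f : (Fin d → ℝ) → ℝ} {v : Fin n}
    (hv : densityEst x ℓ (x v) ≠ 0) (hfv : 0 < f (x v)) {L : ℝ}
    (hpair : ∀ u, u ≠ v → ∀ j, n * potential f 1 j {u} (x v) x ≤ ENNReal.ofReal (Real.exp L)) :
    Real.log (densityEst x ℓ (x v)) ≤
      d * (2 * (L + domFun f (x v) + d * Real.log Real.pi + Real.log 2) + Real.log 2) := by
  obtain ⟨a, ha⟩ := exists_isWindow x ℓ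
  have hnR : (0 : ℝ) < n := by exact_mod_cast Fin.pos v
  have hN1 : (1 : ℝ) ≤ cnt x ℓ v := by exact_mod_cast one_le_cnt x ℓ v
  have hm1 : (1 : ℝ) ≤ par x ℓ v := by exact_mod_cast one_le_par x ℓ v
  have hmN : (par x ℓ v : ℝ) ≤ cnt x ℓ v := by
    exact_mod_cast spacingParam_le_self (one_le_cnt x ℓ v)
  have hNn : (cnt x ℓ v : ℝ) ≤ n := by
    have := Finset.card_le_univ (pts x ℓ v)
    rw [Fintype.card_fin] at this; exact_mod_cast this
  rw [log_densityEst ha hv]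
  have h1 : Real.log ((cnt x ℓ v : ℝ) / n) ≤ 0 :=
    Real.log_nonpos (by positivity) ((div_le_one hnR).2 hNn)
  have h2 : ∀ j ∈ (Finset.univ : Finset (Fin d)),
      Real.log (2 * (par x ℓ v : ℝ) / (cnt x ℓ v * gap x ℓ a v j)) ≤
      2 * (L + domFun f (x v) + d * Real.log Real.pi + Real.log 2) + Real.log 2 := by
    intro j _
    have hθ0 := agap_pos ha hv j
    have hg0 := gap_pos ha hv j
    -- another point of the window
    obtain ⟨u, huv, hu⟩ : ∃ u, u ≠ v ∧
        |Real.arctan (x u j) - Real.arctan (x v j)| ≤ agap x ℓ a v j := by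
      have hpos : 0 < (crd x ℓ v j).card := by rw [card_crd]; exact one_le_cnt x ℓ v
      obtain ⟨u1, _, hu1⟩ := Multiset.mem_map.1
        (orderStat_mem ((a v j : ℤ) - par x ℓ v) hpos)
      obtain ⟨u2, _, hu2⟩ := Multiset.mem_map.1
        (orderStat_mem ((a v j : ℤ) + par x ℓ v) hpos)
      have g1 := ha.lo_le v j
      have g2 := ha.le_hi v j
      have g3 := Real.arctan_mono g1
      have g4 := Real.arctan_mono g2
      change x u1 j = os x ℓ v j _ at hu1
      change x u2 j = os x ℓ v j _ at hu2
      unfold agap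
      by_cases hc : u1 = v
      · refine ⟨u2, fun h => ?_, ?_⟩
        · have : gap x ℓ a v j = 0 := by
            unfold gap; rw [← hu1, ← hu2, h, hc, sub_self]
          linarith
        · rw [hu2, abs_le]; constructor <;> linarith
      · refine ⟨u1, hc, ?_⟩
        rw [hu1, abs_le]; constructor <;> linarith
    have h3 := neg_log_le_of_potential_singleton hfv (hpair u huv j)
    have hne : x u j ≠ x v j := ne_of_potential_singleton hfv (ne_top_of_le_ne_top
      ENNReal.ofReal_ne_top (hpair u huv j))
    have hd0 : 0 < |Real.arctan (x u j) - Real.arctan (x v j)| :=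
      abs_pos.2 (sub_ne_zero.2 fun h => hne (Real.arctan_injective h))
    have h4 := Real.log_le_log hd0 hu
    have h5 := log_arctan_sub_div_nonpos (sub_pos.1 hg0)
    change Real.log (agap x ℓ a v j / gap x ℓ a v j) ≤ 0 at h5
    rw [Real.log_div hθ0.ne' hg0.ne'] at h5
    have h6 : 2 * (par x ℓ v : ℝ) / (cnt x ℓ v * gap x ℓ a v j) ≤ 2 / gap x ℓ a v j := by
      rw [div_le_div_iff₀ (by positivity) hg0]
      nlinarith [mul_le_mul_of_nonneg_right hmN hg0.le]
    have h7 := Real.log_le_log (by positivity) h6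
    rw [Real.log_div two_ne_zero hg0.ne'] at h7
    linarith
  have h3 := Finset.sum_le_sum h2
  rw [Finset.sum_const, Finset.card_univ, Fintype.card_fin, nsmul_eq_mul] at h3
  linarith

/-- An upper bound for the contribution of a set of sample points to the estimator. -/
lemma sum_log_densityEst_le (hd : 0 < d) {f : (Fin d → ℝ) → ℝ}
    (hinj : ∀ j, Function.Injective fun v => x v j) (B : Finset (Fin n))
    (hB : ∀ v ∈ B, densityEst x ℓ (x v) ≠ 0) (hf : ∀ v, 0 < f (x v)) {L : ℝ} (hL : 0 ≤ L)
    (hpot : ∀ B' ⊆ B, ∀ j, ∏ v ∈ B', potential f ℓ j B'ᶜ (x v) x ≤ ENNReal.ofReal (Real.exp L))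
    (hpair : ∀ u v, u ≠ v → ∀ j, n * potential f 1 j {u} (x v) x ≤ ENNReal.ofReal (Real.exp L))
    {c : ℝ} (hc : 1 ≤ c) :
    ∑ v ∈ B, Real.log (densityEst x ℓ (x v)) ≤ (4 * d + 4 * d ^ 2) * L +
      ∑ v ∈ B, (4 * d * domFun f (x v) + 12 * d + 4 * d ^ 2) +
      2 * d * (B.card * Real.log c + n * Real.pi ^ d / c) := by
  classical
  obtain ⟨a, ha⟩ := exists_isWindow x ℓ
  obtain ⟨E₀, hE₀, hext⟩ := exists_extremes x
  have hlogc : 0 ≤ Real.log c := Real.log_nonneg hc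
  have hlog2 : Real.log 2 ≤ 1 := by linarith [Real.log_two_lt_d9]
  have hlogpi : Real.log Real.pi ≤ 2 := by
    have h1 : Real.log Real.pi ≤ Real.log (2 ^ 2) :=
      Real.log_le_log Real.pi_pos (by linarith [Real.pi_le_four])
    rw [Real.log_pow] at h1; push_cast at h1; linarith
  have hd1 : (1 : ℝ) ≤ d := by exact_mod_cast hd
  set ξ : Fin n → ℝ := fun v => domFun f (x v) with hξ
  have hξ0 : ∀ v, 0 ≤ ξ v := fun v => domFun_nonneg f _
  -- the extreme points
  have hB0 : ∑ v ∈ B.filter (· ∈ E₀), Real.log (densityEst x ℓ (x v)) ≤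
      4 * d ^ 2 * L + ∑ v ∈ B.filter (· ∈ E₀), (2 * d * ξ v + (3 * d + 4 * d ^ 2)) := by
    have h1 : ∀ v ∈ B.filter (· ∈ E₀), Real.log (densityEst x ℓ (x v)) ≤
        2 * d * L + (2 * d * ξ v + (3 * d + 4 * d ^ 2)) := by
      intro v hv
      refine (log_densityEst_le_single (hB v (Finset.mem_filter.1 hv).1) (hf v)
        fun u huv j => hpair u v huv j).trans ?_
      have h2 : (d : ℝ) * (d * Real.log Real.pi) ≤ d * (d * 2) := by gcongr
      have h3 : (d : ℝ) * Real.log 2 ≤ d * 1 := by gcongr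
      change (d : ℝ) * (2 * (L + ξ v + d * Real.log Real.pi + Real.log 2) + Real.log 2) ≤ _
      nlinarith
    refine (Finset.sum_le_sum h1).trans ?_
    rw [Finset.sum_add_distrib, Finset.sum_const, nsmul_eq_mul]
    refine add_le_add ?_ le_rfl
    have h4 : ((B.filter (· ∈ E₀)).card : ℝ) ≤ 2 * d := by
      exact_mod_cast (Finset.card_le_card fun v hv => (Finset.mem_filter.1 hv).2).trans hE₀
    nlinarith [mul_le_mul_of_nonneg_right h4 (by positivity : (0 : ℝ) ≤ 2 * d * L)]
  -- the other points
  set B1 := B.filter (· ∉ E₀) with hB1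
  have hB1B : B1 ⊆ B := Finset.filter_subset _ _
  have hB1' : ∑ v ∈ B1, Real.log (densityEst x ℓ (x v)) ≤
      4 * d * L + ∑ v ∈ B1, 2 * d * (ξ v + 4) +
      2 * d * (B.card * Real.log c + n * Real.pi ^ d / c) := by
    have h1 : ∀ j, ∑ v ∈ B1, (logHist x ℓ v + logSpac x ℓ a v j / 2) ≤
        2 * L + ∑ v ∈ B1, (ξ v + 4) := by
      intro j
      have hpar : ∀ e < 2, ∑ v ∈ B1.filter (fun v => rk x ℓ j v % 2 = e),
          (logHist x ℓ v + logSpac x ℓ a v j / 2) ≤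
          L + ∑ v ∈ B1.filter (fun v => rk x ℓ j v % 2 = e), (ξ v + 4) := by
        intro e he
        set B2 := B1.filter (fun v => rk x ℓ j v % 2 = e) with hB2
        have hB2B : B2 ⊆ B := (Finset.filter_subset _ _).trans hB1B
        -- The extremes stay outside `B2`, so the grid computed from `B2ᶜ` is the true one although
        -- the potential does not read `B2`.
        have hE₀B2 : E₀ ⊆ B2ᶜ := by
          intro u hu
          rw [Finset.mem_compl]
          intro hu2
          exact (Finset.mem_filter.1 (Finset.mem_filter.1 hu2).1).2 hu
        have h2 : ∀ v ∈ B2, ENNReal.ofReal (Real.exp (Real.log (refDensity (x v)) -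
            Real.log (f (x v)) + logHist x ℓ v + logSpac x ℓ a v j / 2 - 4)) ≤
            potential f ℓ j B2ᶜ (x v) x := by
          intro v hv
          -- All points of `B2` have rank parity `e`, so every point of parity `1 - e` is available
          -- as a neighbour.
          refine exp_le_potential ha j (hinj j) (hB v (hB2B hv)) (hf v) (hext _ hE₀B2).1
            (hext _ hE₀B2).2 (e := 1 - e) (by omega) fun u _ hu => ?_
          rw [Finset.mem_compl]
          intro hu2
          have := (Finset.mem_filter.1 hu2).2
          omega
        have h3 := (Finset.prod_le_prod' h2).trans (hpot B2 hB2B j)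
        rw [← ENNReal.ofReal_prod_of_nonneg (fun v _ => (Real.exp_pos _).le), ← Real.exp_sum,
          ENNReal.ofReal_le_ofReal_iff (Real.exp_pos L).le, Real.exp_le_exp] at h3
        have h4 : ∑ v ∈ B2, (logHist x ℓ v + logSpac x ℓ a v j / 2 - (ξ v + 4)) ≤ L := by
          refine le_trans (Finset.sum_le_sum fun v _ => ?_) h3
          have := neg_domFun_le f (x v)
          simp only [hξ]; linarith
        rw [Finset.sum_sub_distrib] at h4
        linarith
      have h5 := Finset.sum_filter_add_sum_filter_not B1 (fun v => rk x ℓ j v % 2 = 0)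
        (fun v => logHist x ℓ v + logSpac x ℓ a v j / 2)
      have h6 := Finset.sum_filter_add_sum_filter_not B1 (fun v => rk x ℓ j v % 2 = 0)
        (fun v => ξ v + 4)
      have h7 : B1.filter (fun v => ¬ rk x ℓ j v % 2 = 0) =
          B1.filter (fun v => rk x ℓ j v % 2 = 1) := by
        refine Finset.filter_congr fun v _ => ?_
        omega
      rw [h7] at h5 h6
      have := hpar 0 (by omega)
      have := hpar 1 (by omega)
      linarith
    -- The potential carries half a spacing logarithm and a full histogram logarithm for each
    -- direction. Doubling and summing over `j` counts the histogram term `2 d` times instead of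
    -- once; its lower bound pays for the surplus, and the reference part is nonpositive.
    have h2 : ∑ v ∈ B1, Real.log (densityEst x ℓ (x v)) ≤
        2 * ∑ j, ∑ v ∈ B1, (logHist x ℓ v + logSpac x ℓ a v j / 2) -
          (2 * d - 1) * ∑ v ∈ B1, logHist x ℓ v := by
      rw [Finset.sum_comm, Finset.mul_sum, Finset.mul_sum, ← Finset.sum_sub_distrib]
      refine Finset.sum_le_sum fun v hv => ?_
      rw [log_densityEst_eq ha (hB v (hB1B hv)), Finset.sum_add_distrib, Finset.sum_const,
        Finset.card_univ, Fintype.card_fin, nsmul_eq_mul, ← Finset.sum_div]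
      have : ∑ j, logRef x ℓ a v j ≤ 0 :=
        Finset.sum_nonpos fun j _ => logRef_nonpos ha (hB v (hB1B hv)) j
      linarith
    have h3 := Finset.sum_le_sum fun j (_ : j ∈ (Finset.univ : Finset (Fin d))) => h1 j
    rw [Finset.sum_const, Finset.card_univ, Fintype.card_fin, nsmul_eq_mul] at h3
    have h4 := neg_le_sum_logHist ha B1 (fun v hv => hB v (hB1B hv)) hc
    have h5 : (B1.card : ℝ) ≤ B.card := by exact_mod_cast Finset.card_le_card hB1B
    have h6 : (0 : ℝ) ≤ n * Real.pi ^ d / c := by positivity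
    have h7 := mul_le_mul_of_nonneg_right h5 hlogc
    have h8 : (0 : ℝ) ≤ B.card * Real.log c := by positivity
    have h9 : -((2 * d - 1) * ∑ v ∈ B1, logHist x ℓ v) ≤
        (2 * d - 1) * (B.card * Real.log c + n * Real.pi ^ d / c) := by
      rw [← mul_neg]
      refine mul_le_mul_of_nonneg_left ?_ (by linarith)
      linarith
    rw [← Finset.mul_sum]
    nlinarith
  rw [← Finset.sum_filter_add_sum_filter_not B (· ∈ E₀),
    ← Finset.sum_filter_add_sum_filter_not B (· ∈ E₀) (fun v => 4 * d * domFun f (x v) + _ + _)]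
  have h1 : ∑ v ∈ B.filter (· ∈ E₀), (2 * d * ξ v + (3 * d + 4 * d ^ 2)) ≤
      ∑ v ∈ B.filter (· ∈ E₀), (4 * d * domFun f (x v) + 12 * d + 4 * d ^ 2) :=
    Finset.sum_le_sum fun v _ => by
      have := hξ0 v
      change _ ≤ 4 * d * ξ v + _ + _
      nlinarith
  have h2 : ∑ v ∈ B1, 2 * d * (ξ v + 4) ≤
      ∑ v ∈ B1, (4 * d * domFun f (x v) + 12 * d + 4 * d ^ 2) :=
    Finset.sum_le_sum fun v _ => by
      have := hξ0 v
      change _ ≤ 4 * d * ξ v + _ + _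
      nlinarith
  linarith

end

end PSS

/-! ### Exponential moments and the Borel–Cantelli lemma -/

namespace PSS

noncomputable section

/-- The number of small subsets, weighted by `a ^ card`, grows at a small exponential rate. -/
lemma exists_sum_pow_card_le {a η : ℝ} (ha : 1 ≤ a) (hη : 0 < η) :
    ∃ ε > 0, ∀ n : ℕ, ∑ S : Finset (Fin n) with (S.card : ℝ) ≤ ε * n, a ^ S.card ≤
      Real.exp (η * n) := by
  -- A Chernoff bound: inserting `z ^ |S|` costs at most `exp (η n / 2)` on sets of size at most `ε
  -- n`, and the binomial sum `(1 + a z) ^ n` is then at most `exp (η n / 2)` too.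
  set z : ℝ := min (η / (2 * a)) 1 with hz
  have ha0 : 0 < a := by linarith
  have hz0 : 0 < z := lt_min (by positivity) one_pos
  have hz1 : z ≤ 1 := min_le_right _ _
  have hlz : 0 ≤ -Real.log z := by have := Real.log_nonpos hz0.le hz1; linarith
  refine ⟨η / (2 * (-Real.log z + 1)), by positivity, fun n => ?_⟩
  set ε := η / (2 * (-Real.log z + 1)) with hε
  have hε0 : 0 < ε := by positivity
  have h1 : ∀ S : Finset (Fin n), (S.card : ℝ) ≤ ε * n →
      a ^ S.card ≤ Real.exp (η / 2 * n) * ((a * z) ^ S.card * 1 ^ (n - S.card)) := by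
    intro S hS
    rw [one_pow, mul_one, mul_pow, mul_left_comm]
    refine le_mul_of_one_le_right (by positivity) ?_
    rw [← Real.log_nonneg_iff (by positivity), Real.log_mul (by positivity) (by positivity),
      Real.log_exp, Real.log_pow]
    have h2 : (S.card : ℝ) * -Real.log z ≤ ε * n * (-Real.log z + 1) := by
      have := mul_le_mul_of_nonneg_right hS hlz
      nlinarith [mul_nonneg hε0.le (Nat.cast_nonneg (α := ℝ) n)]
    have h3 : ε * n * (-Real.log z + 1) = η / 2 * n := by
      rw [hε]; field_simp
    linarith
  have h2 : ∑ S : Finset (Fin n), (a * z) ^ S.card * 1 ^ (n - S.card) = (a * z + 1) ^ n := by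
    have := Finset.sum_pow_mul_eq_add_pow (a * z) 1 (Finset.univ : Finset (Fin n))
    simpa using this
  calc ∑ S : Finset (Fin n) with (S.card : ℝ) ≤ ε * n, a ^ S.card
      ≤ ∑ S : Finset (Fin n) with (S.card : ℝ) ≤ ε * n,
          Real.exp (η / 2 * n) * ((a * z) ^ S.card * 1 ^ (n - S.card)) :=
        Finset.sum_le_sum fun S hS => h1 S (Finset.mem_filter.1 hS).2
    _ ≤ ∑ S : Finset (Fin n), Real.exp (η / 2 * n) * ((a * z) ^ S.card * 1 ^ (n - S.card)) :=
        Finset.sum_le_sum_of_subset_of_nonneg (Finset.filter_subset _ _)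
          fun _ _ _ => by positivity
    _ = Real.exp (η / 2 * n) * (a * z + 1) ^ n := by rw [← Finset.mul_sum, h2]
    _ ≤ Real.exp (η / 2 * n) * Real.exp (η / 2) ^ n := by
        gcongr
        have h3 : a * z ≤ η / 2 := by
          have h4 : z ≤ η / (2 * a) := min_le_left _ _
          calc a * z ≤ a * (η / (2 * a)) := by gcongr
            _ = η / 2 := by field_simp
        linarith [Real.add_one_le_exp (η / 2)]
    _ = Real.exp (η * n) := by
        rw [← Real.exp_nat_mul, ← Real.exp_add]; congr 1; ring

variable {Ω : Type*} [MeasurableSpace Ω] {P : Measure Ω}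
  {α : Type*} [MeasurableSpace α] {μ : Measure α} {X : ℕ → Ω → α}

/-- `X 0, X 1, …` are independent random variables with law `μ`. -/
structure IsSample (P : Measure Ω) (μ : Measure α) (X : ℕ → Ω → α) : Prop where
  meas : ∀ i, Measurable (X i)
  indep : iIndepFun X P
  law : ∀ i, P.map (X i) = μ

lemma IsSample.measurable_fin (hX : IsSample P μ X) (n : ℕ) :
    Measurable fun ω (v : Fin n) => X v ω :=
  measurable_pi_lambda _ fun v => hX.meas v

lemma IsSample.map_fin [IsProbabilityMeasure P] (hX : IsSample P μ X) (n : ℕ) :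
    P.map (fun ω (v : Fin n) => X v ω) = Measure.pi fun _ => μ := by
  have h1 : iIndepFun (fun v : Fin n => X v) P := hX.indep.precomp Fin.val_injective
  rw [(iIndepFun_iff_map_fun_eq_pi_map fun v : Fin n => (hX.meas v).aemeasurable).1 h1]
  simp only [hX.law]

lemma IsSample.lintegral_fin [IsProbabilityMeasure P] (hX : IsSample P μ X) {n : ℕ} {Φ : (Fin n → α) → ℝ≥0∞}
    (hΦ : Measurable Φ) :
    ∫⁻ ω, Φ (fun v => X v ω) ∂P = ∫⁻ y, Φ y ∂(Measure.pi fun _ => μ) := by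
  rw [← hX.map_fin n, lintegral_map hΦ (hX.measurable_fin n)]

/-- Markov's inequality at the level `exp (η n)` leaves probabilities of order `exp (-η n / 2)`,
which are summable. -/
lemma IsSample.ae_eventually_le_exp [IsProbabilityMeasure P] (hX : IsSample P μ X) (Φ : ∀ n, (Fin n → α) → ℝ≥0∞)
    (hΦ : ∀ n, Measurable (Φ n)) {K η : ℝ} (hη : 0 < η)
    (h : ∀ n, ∫⁻ y, Φ n y ∂(Measure.pi fun _ => μ) ≤ ENNReal.ofReal (K * Real.exp (η / 2 * n))) :
    ∀ᵐ ω ∂P, ∀ᶠ n in atTop, Φ n (fun v => X v ω) ≤ ENNReal.ofReal (Real.exp (η * n)) := by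
  set s : ℕ → Set Ω := fun n => {ω | ENNReal.ofReal (Real.exp (η * n)) ≤ Φ n (fun v => X v ω)}
    with hs
  have h1 : ∀ n, P (s n) ≤ ENNReal.ofReal (K * Real.exp (-(η / 2)) ^ n) := by
    intro n
    refine (meas_ge_le_lintegral_div ((hΦ n).comp (hX.measurable_fin n)).aemeasurable
      (by simp [Real.exp_pos]) ENNReal.ofReal_ne_top).trans ?_
    change (∫⁻ ω, Φ n (fun v => X v ω) ∂P) / _ ≤ _
    rw [hX.lintegral_fin (hΦ n)]
    refine (ENNReal.div_le_div_right (h n) _).trans ?_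
    rw [← ENNReal.ofReal_div_of_pos (Real.exp_pos _)]
    refine ENNReal.ofReal_le_ofReal (le_of_eq ?_)
    rw [mul_div_assoc, ← Real.exp_sub, ← Real.exp_nat_mul]
    congr 2; ring
  have h2 : ∑' n, P (s n) ≠ ⊤ := by
    refine ne_top_of_le_ne_top ?_ (ENNReal.tsum_le_tsum h1)
    refine Summable.tsum_ofReal_ne_top ?_
    exact (summable_geometric_of_lt_one (Real.exp_pos _).le
      (Real.exp_lt_one_iff.2 (by linarith))).mul_left K
  filter_upwards [ae_eventually_notMem h2] with ω hω
  filter_upwards [hω] with n hn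
  exact (not_le.1 hn).le

/-- On `[-1, 1]` one has `exp u ≤ 1 + u + u ^ 2`; the centred linear term integrates to zero. -/
lemma lintegral_exp_indicator_le [IsProbabilityMeasure μ] {G : Set α} (hG : MeasurableSet G) {s : ℝ} (hs : |s| ≤ 1) :
    ∫⁻ t, ENNReal.ofReal (Real.exp (s * (G.indicator 1 t - μ.real G))) ∂μ ≤
      ENNReal.ofReal (Real.exp (s ^ 2)) := by
  have hint : Integrable (G.indicator (1 : α → ℝ)) μ :=
    (integrable_const (1 : ℝ)).indicator hG
  have hp0 : 0 ≤ μ.real G := measureReal_nonneg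
  have hp1 : μ.real G ≤ 1 := measureReal_le_one
  have hbd : ∀ t, |G.indicator (1 : α → ℝ) t - μ.real G| ≤ 1 := by
    intro t
    by_cases ht : t ∈ G <;> simp only [ht, Set.indicator_of_mem, Set.indicator_of_notMem,
      not_false_eq_true, Pi.one_apply, abs_le] <;> constructor <;> linarith
  have hle : ∀ t, Real.exp (s * (G.indicator 1 t - μ.real G)) ≤
      1 + s * (G.indicator 1 t - μ.real G) + s ^ 2 := by
    intro t
    have h1 : |s * (G.indicator 1 t - μ.real G)| ≤ |s| := by
      rw [abs_mul]; exact mul_le_of_le_one_right (abs_nonneg _) (hbd t)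
    have h2 := Real.abs_exp_sub_one_sub_id_le (h1.trans hs)
    have h3 := (abs_le.1 h2).2
    have h4 : (s * (G.indicator 1 t - μ.real G)) ^ 2 ≤ s ^ 2 := sq_le_sq.2 h1
    linarith
  have hint2 : Integrable (fun t => s * (G.indicator (1 : α → ℝ) t - μ.real G)) μ :=
    (hint.sub (integrable_const _)).const_mul s
  refine (lintegral_mono fun t => ENNReal.ofReal_le_ofReal (hle t)).trans ?_
  have hint3 : Integrable (fun t => 1 + s * (G.indicator 1 t - μ.real G) + s ^ 2) μ :=
    ((integrable_const 1).add hint2).add (integrable_const _)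
  rw [← ofReal_integral_eq_lintegral_ofReal hint3
    (Eventually.of_forall fun t => (Real.exp_pos _).le.trans (hle t))]
  refine ENNReal.ofReal_le_ofReal ?_
  have h5 : ∫ t, (1 + s * (G.indicator 1 t - μ.real G) + s ^ 2) ∂μ = 1 + s ^ 2 := by
    have hint4 : Integrable (fun t => 1 + s * (G.indicator 1 t - μ.real G)) μ :=
      (integrable_const 1).add hint2
    rw [integral_add hint4 (integrable_const _),
      integral_add (integrable_const 1) hint2, integral_const_mul,
      integral_sub hint (integrable_const _), integral_indicator_one hG]
    simp
  rw [h5]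
  linarith [Real.add_one_le_exp (s ^ 2)]

/-- A uniform law of large numbers for families of random sets, each of which depends on few
sample points. -/
lemma IsSample.ae_eventually_deviation [IsProbabilityMeasure P] [IsProbabilityMeasure μ]
    (hX : IsSample P μ X) {ι : ℕ → Type*}
    [∀ n, Fintype (ι n)] (E : ∀ n, ι n → Finset (Fin n)) (G : ∀ n, ι n → (Fin n → α) → Set α)
    (hG : ∀ n i, MeasurableSet {p : α × (Fin n → α) | p.1 ∈ G n i p.2})
    (hdep : ∀ n i y y', (∀ u ∈ E n i, y u = y' u) → G n i y = G n i y') {s K : ℝ} (hs : 0 < s)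
    (hs1 : s ≤ 1)
    (hcard : ∀ n, (Fintype.card (ι n) : ℝ) ≤ K * Real.exp (s ^ 2 / 2 * n)) :
    ∀ᵐ ω ∂P, ∀ᶠ n in atTop, ∀ i : ι n,
      |∑ v ∈ (E n i)ᶜ, ((G n i fun v => X v ω).indicator 1 (X v ω) -
        μ.real (G n i fun v => X v ω))| ≤ 3 * s * n := by
  have hGy : ∀ n i y, MeasurableSet (G n i y) := fun n i y =>
    (measurable_id.prodMk measurable_const : Measurable fun t : α => (t, y)) (hG n i)
  set ψ : ∀ n, ι n → ℝ → α → (Fin n → α) → ℝ≥0∞ := fun n i σ t y =>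
    ENNReal.ofReal (Real.exp (σ * ((G n i y).indicator 1 t - μ.real (G n i y)))) with hψ
  have hψm : ∀ n i σ, Measurable (Function.uncurry (ψ n i σ)) := by
    intro n i σ
    have h1 : Measurable fun p : α × (Fin n → α) => (G n i p.2).indicator (1 : α → ℝ) p.1 := by
      have : (fun p : α × (Fin n → α) => (G n i p.2).indicator (1 : α → ℝ) p.1) =
          {p : α × (Fin n → α) | p.1 ∈ G n i p.2}.indicator 1 := by
        funext p
        by_cases hp : p.1 ∈ G n i p.2
        · rw [Set.indicator_of_mem hp, Set.indicator_of_mem (show p ∈ {p : α × (Fin n → α) | p.1 ∈ G n i p.2} from hp)]; rfl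
        · rw [Set.indicator_of_notMem hp, Set.indicator_of_notMem (show p ∉ {p : α × (Fin n → α) | p.1 ∈ G n i p.2} from hp)]
      rw [this]
      exact measurable_one.indicator (hG n i)
    have h2 : Measurable fun y : Fin n → α => μ.real (G n i y) :=
      (measurable_measure_prodMk_right (μ := μ) (hG n i)).ennreal_toReal
    exact ((h1.sub (h2.comp measurable_snd)).const_mul σ).exp.ennreal_ofReal
  -- The random set reads only the points in `E n i`, so decoupling treats it as fixed for all the
  -- others.
  have hexp : ∀ n i σ, |σ| = s → ∫⁻ y, ∏ v ∈ (E n i)ᶜ, ψ n i σ (y v) y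
      ∂(Measure.pi fun _ : Fin n => μ) ≤ ENNReal.ofReal (Real.exp (s ^ 2 * n)) := by
    intro n i σ hσ
    refine (lintegral_prod_decouple μ (E n i)ᶜ (fun _ => ψ n i σ) (fun _ => hψm n i σ) ?_
      (ENNReal.ofReal (Real.exp (s ^ 2))) ?_).trans ?_
    · intro _ t y y' h
      have := hdep n i y y' fun u hu => h u (by simpa using hu)
      simp only [hψ, this]
    · intro _ y
      have := lintegral_exp_indicator_le (μ := μ) (hGy n i y) (s := σ) (by rw [hσ]; exact hs1)
      rwa [← sq_abs, hσ] at this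
    · rw [← ENNReal.ofReal_pow (Real.exp_pos _).le, ← Real.exp_nat_mul]
      refine ENNReal.ofReal_le_ofReal (Real.exp_le_exp.2 ?_)
      rw [mul_comm]
      gcongr
      simpa using Finset.card_le_univ (E n i)ᶜ
  set Φ : ∀ n, (Fin n → α) → ℝ≥0∞ := fun n y =>
    ∑ i, (∏ v ∈ (E n i)ᶜ, ψ n i s (y v) y + ∏ v ∈ (E n i)ᶜ, ψ n i (-s) (y v) y) with hΦ
  have hpm : ∀ n i σ, Measurable fun y : Fin n → α => ∏ v ∈ (E n i)ᶜ, ψ n i σ (y v) y :=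
    fun n i σ => Finset.measurable_prod _ fun v _ =>
      Measurable.comp (g := Function.uncurry (ψ n i σ)) (f := fun y : Fin n → α => (y v, y))
        (hψm n i σ) ((measurable_pi_apply v).prodMk measurable_id)
  have hΦm : ∀ n, Measurable (Φ n) := fun n =>
    Finset.measurable_sum _ fun i _ => (hpm n i s).add (hpm n i (-s))
  -- The rate `s ^ 2` per set plus `s ^ 2 / 2` for the number of sets. Borel–Cantelli doubles it to
  -- `3 s ^ 2`, and division by `s` gives the deviation `3 s n`.
  have hK : ∀ n, ∫⁻ y, Φ n y ∂(Measure.pi fun _ => μ) ≤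
      ENNReal.ofReal (2 * K * Real.exp (3 * s ^ 2 / 2 * n)) := by
    intro n
    simp only [hΦ]
    have hadd : ∀ i, Measurable fun y : Fin n → α => ∏ v ∈ (E n i)ᶜ, ψ n i s (y v) y +
        ∏ v ∈ (E n i)ᶜ, ψ n i (-s) (y v) y := fun i => (hpm n i s).add (hpm n i (-s))
    rw [lintegral_finsetSum _ fun i _ => hadd i]
    calc _ ≤ ∑ _i : ι n, ENNReal.ofReal (2 * Real.exp (s ^ 2 * n)) := by
          refine Finset.sum_le_sum fun i _ => ?_
          rw [lintegral_add_left (hpm n i s), two_mul, ENNReal.ofReal_add (Real.exp_pos _).le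
            (Real.exp_pos _).le]
          exact add_le_add (hexp n i s (abs_of_pos hs)) (hexp n i (-s) (by rw [abs_neg, abs_of_pos hs]))
      _ = ENNReal.ofReal (Fintype.card (ι n) * (2 * Real.exp (s ^ 2 * n))) := by
          rw [Finset.sum_const, Finset.card_univ, nsmul_eq_mul, ← ENNReal.ofReal_natCast,
            ← ENNReal.ofReal_mul (by positivity)]
      _ ≤ _ := by
          refine ENNReal.ofReal_le_ofReal ?_
          calc _ ≤ K * Real.exp (s ^ 2 / 2 * n) * (2 * Real.exp (s ^ 2 * n)) := by
                gcongr; exact hcard n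
            _ = 2 * K * (Real.exp (s ^ 2 / 2 * n) * Real.exp (s ^ 2 * n)) := by ring
            _ = _ := by rw [← Real.exp_add]; congr 2; ring
  filter_upwards [hX.ae_eventually_le_exp Φ hΦm (K := 2 * K) (η := 3 * s ^ 2) (by positivity) hK]
    with ω hω
  filter_upwards [hω] with n hn
  intro i
  have key : ∀ σ, (σ = s ∨ σ = -s) → σ * ∑ v ∈ (E n i)ᶜ,
      ((G n i fun v => X v ω).indicator 1 (X v ω) - μ.real (G n i fun v => X v ω)) ≤
      3 * s ^ 2 * n := by
    intro σ hσ
    have h1 : ∏ v ∈ (E n i)ᶜ, ψ n i σ (X v ω) (fun v => X v ω) ≤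
        ENNReal.ofReal (Real.exp (3 * s ^ 2 * n)) := by
      refine le_trans ?_ hn
      refine le_trans ?_ (Finset.single_le_sum (f := fun i =>
        (∏ v ∈ (E n i)ᶜ, ψ n i s (X v ω) (fun v => X v ω) +
          ∏ v ∈ (E n i)ᶜ, ψ n i (-s) (X v ω) (fun v => X v ω))) (fun _ _ => zero_le)
        (Finset.mem_univ i))
      rcases hσ with rfl | rfl
      · exact le_self_add
      · exact le_add_self
    simp only [hψ] at h1
    rwa [← ENNReal.ofReal_prod_of_nonneg (fun v _ => (Real.exp_pos _).le), ← Real.exp_sum,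
      ENNReal.ofReal_le_ofReal_iff (Real.exp_pos _).le, Real.exp_le_exp, ← Finset.mul_sum] at h1
  have h1 := key s (Or.inl rfl)
  have h2 := key (-s) (Or.inr rfl)
  rw [abs_le]
  constructor
  · refine le_of_mul_le_mul_left (a := s) ?_ hs; linarith
  · refine le_of_mul_le_mul_left (a := s) ?_ hs; linarith

/-! ### Expectations of products of potentials -/

variable {d : ℕ}

/-- The sum of the products of potentials over a family of index sets, and over pairs. -/
def potSum (f : (Fin d → ℝ) → ℝ) (ℓ n : ℕ) (S : Finset (Finset (Fin n)))
    (y : Fin n → Fin d → ℝ) : ℝ≥0∞ :=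
  (∑ B ∈ S, ∑ j, ∏ v ∈ B, potential f ℓ j Bᶜ (y v) y) +
    ∑ p : Fin n × Fin n with p.1 ≠ p.2, ∑ j, n * potential f 1 j {p.1} (y p.2) y

lemma measurable_potential_self {f : (Fin d → ℝ) → ℝ} (hf : Measurable f) {n : ℕ} (ℓ : ℕ)
    (j : Fin d) (E : Finset (Fin n)) (v : Fin n) :
    Measurable fun y : Fin n → Fin d → ℝ => potential f ℓ j E (y v) y :=
  Measurable.potential E ℓ hf measurable_id (measurable_pi_apply v) j

lemma measurable_potSum {f : (Fin d → ℝ) → ℝ} (hf : Measurable f) (ℓ n : ℕ)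
    (S : Finset (Finset (Fin n))) : Measurable (potSum f ℓ n S) :=
  (Finset.measurable_sum _ fun B _ => Finset.measurable_sum _ fun j _ =>
    Finset.measurable_prod _ fun v _ => measurable_potential_self hf ℓ j Bᶜ v).add
  (Finset.measurable_sum _ fun p _ => Finset.measurable_sum _ fun j _ =>
    (measurable_potential_self hf 1 j {p.1} p.2).const_mul _)

/-- The decoupling theorem applies because the potential depends on the sample only through `E`,
which avoids `B`. -/
lemma lintegral_prod_potential_le {f : (Fin d → ℝ) → ℝ} (hf : Measurable f) (hf0 : ∀ x, 0 ≤ f x)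
    [IsProbabilityMeasure (densityMeasure f)] {n : ℕ} (ℓ : ℕ) (j : Fin d)
    {E B : Finset (Fin n)} (hEB : Disjoint E B) :
    ∫⁻ y, ∏ v ∈ B, potential f ℓ j E (y v) y ∂(Measure.pi fun _ => densityMeasure f) ≤
      5 ^ B.card := by
  refine lintegral_prod_decouple (densityMeasure f) B (fun _ t y => potential f ℓ j E t y)
    (fun _ => Measurable.potential E ℓ hf measurable_snd measurable_fst j) ?_ 5
    (fun _ y => lintegral_potential_le hf hf0 ℓ j E y)
  intro _ t y y' h
  exact potential_congr f (fun v hv => h v (Finset.disjoint_left.1 hEB hv)) ℓ j t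

lemma lintegral_potSum_le {f : (Fin d → ℝ) → ℝ} (hf : Measurable f) (hf0 : ∀ x, 0 ≤ f x)
    [IsProbabilityMeasure (densityMeasure f)] (ℓ n : ℕ) (S : Finset (Finset (Fin n))) :
    ∫⁻ y, potSum f ℓ n S y ∂(Measure.pi fun _ => densityMeasure f) ≤
      ENNReal.ofReal (d * ∑ B ∈ S, (5 : ℝ) ^ B.card + 5 * d * n ^ 3) := by
  unfold potSum
  rw [lintegral_add_left (Finset.measurable_sum _ fun B _ => Finset.measurable_sum _ fun j _ =>
    Finset.measurable_prod _ fun v _ => measurable_potential_self hf ℓ j Bᶜ v),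
    ENNReal.ofReal_add (by positivity) (by positivity)]
  refine add_le_add ?_ ?_
  · rw [lintegral_finsetSum _ fun B _ => Finset.measurable_sum _ fun j _ =>
      Finset.measurable_prod _ fun v _ => measurable_potential_self hf ℓ j Bᶜ v]
    rw [Finset.mul_sum, ENNReal.ofReal_sum_of_nonneg fun B _ => by positivity]
    refine Finset.sum_le_sum fun B _ => ?_
    rw [lintegral_finsetSum _ fun j _ =>
      Finset.measurable_prod _ fun v _ => measurable_potential_self hf ℓ j Bᶜ v]
    refine (Finset.sum_le_sum fun j _ => lintegral_prod_potential_le hf hf0 ℓ j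
      disjoint_compl_left).trans (le_of_eq ?_)
    rw [Finset.sum_const, Finset.card_univ, Fintype.card_fin, nsmul_eq_mul,
      ENNReal.ofReal_mul (by positivity), ENNReal.ofReal_natCast,
      ENNReal.ofReal_pow (by norm_num)]
    norm_num
  · rw [lintegral_finsetSum _ fun p _ => Finset.measurable_sum _ fun j _ =>
      (measurable_potential_self hf 1 j {p.1} p.2).const_mul _]
    have h1 : ∀ p ∈ (Finset.univ.filter fun p : Fin n × Fin n => p.1 ≠ p.2),
        ∫⁻ y, ∑ j, n * potential f 1 j {p.1} (y p.2) y ∂(Measure.pi fun _ => densityMeasure f) ≤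
        ENNReal.ofReal (5 * d * n) := by
      intro p hp
      rw [lintegral_finsetSum _ fun j _ =>
        (measurable_potential_self hf 1 j {p.1} p.2).const_mul _]
      have h2 : ∀ j ∈ (Finset.univ : Finset (Fin d)), ∫⁻ y, n * potential f 1 j {p.1} (y p.2) y
          ∂(Measure.pi fun _ => densityMeasure f) ≤ n * 5 := by
        intro j _
        rw [lintegral_const_mul _ (measurable_potential_self hf 1 j {p.1} p.2)]
        have := lintegral_prod_potential_le hf hf0 1 j (E := {p.1}) (B := {p.2})
          (by simpa using (Finset.mem_filter.1 hp).2)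
        simp only [Finset.prod_singleton, Finset.card_singleton, pow_one] at this
        gcongr
      refine (Finset.sum_le_sum h2).trans (le_of_eq ?_)
      rw [Finset.sum_const, Finset.card_univ, Fintype.card_fin, nsmul_eq_mul,
        ENNReal.ofReal_mul (by positivity), ENNReal.ofReal_mul (by norm_num),
        ENNReal.ofReal_natCast, ENNReal.ofReal_natCast]
      norm_num; ring
    refine (Finset.sum_le_sum h1).trans ?_
    rw [Finset.sum_const, nsmul_eq_mul, ← ENNReal.ofReal_natCast,
      ← ENNReal.ofReal_mul (by positivity)]
    refine ENNReal.ofReal_le_ofReal ?_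
    have h3 : ((Finset.univ.filter fun p : Fin n × Fin n => p.1 ≠ p.2).card : ℝ) ≤ n ^ 2 := by
      have := Finset.card_le_univ (Finset.univ.filter fun p : Fin n × Fin n => p.1 ≠ p.2)
      rw [Fintype.card_prod, Fintype.card_fin, ← sq] at this
      exact_mod_cast this
    calc _ ≤ (n : ℝ) ^ 2 * (5 * d * n) := by gcongr
      _ = _ := by ring

lemma prod_potential_le_potSum (f : (Fin d → ℝ) → ℝ) (ℓ : ℕ) {n : ℕ}
    {S : Finset (Finset (Fin n))} (y : Fin n → Fin d → ℝ) {B : Finset (Fin n)} (hB : B ∈ S)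
    (j : Fin d) : ∏ v ∈ B, potential f ℓ j Bᶜ (y v) y ≤ potSum f ℓ n S y :=
  (Finset.single_le_sum (f := fun j => ∏ v ∈ B, potential f ℓ j Bᶜ (y v) y)
    (fun _ _ => zero_le) (Finset.mem_univ j)).trans
  ((Finset.single_le_sum (f := fun B => ∑ j, ∏ v ∈ B, potential f ℓ j Bᶜ (y v) y)
    (fun _ _ => zero_le) hB).trans le_self_add)

lemma pair_potential_le_potSum (f : (Fin d → ℝ) → ℝ) (ℓ : ℕ) {n : ℕ}
    (S : Finset (Finset (Fin n))) (y : Fin n → Fin d → ℝ) {u v : Fin n} (huv : u ≠ v)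
    (j : Fin d) : n * potential f 1 j {u} (y v) y ≤ potSum f ℓ n S y :=
  (Finset.single_le_sum (f := fun j => n * potential f 1 j {u} (y v) y)
    (fun _ _ => zero_le) (Finset.mem_univ j)).trans
  ((Finset.single_le_sum (f := fun p : Fin n × Fin n =>
    ∑ j, n * potential f 1 j {p.1} (y p.2) y) (fun _ _ => zero_le)
    (Finset.mem_filter.2 ⟨Finset.mem_univ (u, v), huv⟩)).trans le_add_self)

end

end PSS

namespace PSS

noncomputable section

variable {d n : ℕ}

/-! ### Empirical measure of unions of cells and of slabs -/

/-- The number of sample points in a set. -/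
def empCount {α : Type*} (x : Fin n → α) (S : Set α) : ℝ := ∑ v, S.indicator 1 (x v)

lemma empCount_eq_card {α : Type*} (x : Fin n → α) (S : Set α) [DecidablePred fun v => x v ∈ S] :
    empCount x S = (Finset.univ.filter fun v => x v ∈ S).card := by
  classical
  simp [empCount, Set.indicator_apply]

lemma empCount_nonneg {α : Type*} (x : Fin n → α) (S : Set α) : 0 ≤ empCount x S :=
  Finset.sum_nonneg fun _ _ => Set.indicator_nonneg (fun _ _ => zero_le_one) _

lemma empCount_le {α : Type*} (x : Fin n → α) (S : Set α) : empCount x S ≤ n := by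
  classical
  rw [empCount_eq_card]
  simpa using Finset.card_le_univ (Finset.univ.filter fun v => x v ∈ S)

lemma empCount_biUnion {α ι : Type*} (x : Fin n → α) (T : Finset ι) (S : ι → Set α)
    (hS : (T : Set ι).PairwiseDisjoint S) :
    empCount x (⋃ t ∈ T, S t) = ∑ t ∈ T, empCount x (S t) := by
  unfold empCount
  rw [Finset.sum_comm]
  refine Finset.sum_congr rfl fun v _ => ?_
  rw [Finset.indicator_biUnion_apply T S hS]

/-- A maximal subset without related pairs. -/
lemma exists_separated {ι : Type*} (R : ι → ι → Prop) (hrefl : ∀ v, R v v)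
    (hsymm : ∀ u v, R u v → R v u) (B : Finset ι) :
    ∃ T ⊆ B, (∀ u ∈ T, ∀ v ∈ T, u ≠ v → ¬ R u v) ∧ ∀ v ∈ B, ∃ t ∈ T, R v t := by
  classical
  induction B using Finset.induction_on with
  | empty => exact ⟨∅, le_rfl, by simp, by simp⟩
  | insert b B hb ih =>
    obtain ⟨T, hTB, hT, hcov⟩ := ih
    by_cases h : ∃ t ∈ T, R b t
    · refine ⟨T, hTB.trans (Finset.subset_insert _ _), hT, fun v hv => ?_⟩
      rcases Finset.mem_insert.1 hv with rfl | hv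
      · exact h
      · exact hcov v hv
    · refine ⟨insert b T, Finset.insert_subset_insert _ hTB, ?_, fun v hv => ?_⟩
      · intro u hu v hv huv hR
        rcases Finset.mem_insert.1 hu with hu' | hu' <;>
          rcases Finset.mem_insert.1 hv with hv' | hv'
        · exact huv (hu'.trans hv'.symm)
        · exact h ⟨v, hv', hu' ▸ hR⟩
        · exact h ⟨u, hu', hv' ▸ hsymm _ _ hR⟩
        · exact hT u hu' v hv' huv hR
      · rcases Finset.mem_insert.1 hv with rfl | hv
        · exact ⟨v, Finset.mem_insert_self _ _, hrefl v⟩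
        · obtain ⟨t, ht, hR⟩ := hcov v hv
          exact ⟨t, Finset.mem_insert_of_mem ht, hR⟩

/-- If the union of disjoint sets has about the right number of sample points, then there are
few points in those sets that have too many, or too few, points. -/
lemma card_le_of_deviation {α : Type*} [MeasurableSpace α] (μ : Measure α) [IsFiniteMeasure μ]
    (x : Fin n → α) (B : Finset (Fin n)) (R : Fin n → Fin n → Prop) (hrefl : ∀ v, R v v)
    (hsymm : ∀ u v, R u v → R v u) (S : Fin n → Set α) (hSm : ∀ v, MeasurableSet (S v))
    (hdisj : ∀ u ∈ B, ∀ v ∈ B, ¬ R u v → Disjoint (S u) (S v))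
    {ε κ η K : ℝ} (hK : 1 ≤ K * ε) (hKS : ∀ v ∈ B, K ≤ empCount x (S v))
    (hε : 0 < ε) (hη : 0 < η) (hη1 : η ≤ 1)
    (hcov : ∀ t ∈ B, ∀ C ⊆ B, (∀ v ∈ C, R v t) → (C.card : ℝ) ≤ 4 * empCount x (S t))
    (hdev : ∀ T ⊆ B, (∀ u ∈ T, ∀ v ∈ T, u ≠ v → ¬ R u v) → (T.card : ℝ) ≤ ε * n →
      |empCount x (⋃ t ∈ T, S t) - n * μ.real (⋃ t ∈ T, S t)| ≤ κ)
    (hbad : (∀ v ∈ B, (1 + η) * (n * μ.real (S v)) ≤ empCount x (S v)) ∨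
      (∀ v ∈ B, empCount x (S v) ≤ (1 - η) * (n * μ.real (S v)))) :
    (B.card : ℝ) ≤ 8 / η * κ := by
  classical
  obtain ⟨T, hTB, hsep, hTcov⟩ := exists_separated R hrefl hsymm B
  have hTd : (T : Set (Fin n)).PairwiseDisjoint S := fun u hu v hv huv =>
    hdisj u (hTB hu) v (hTB hv) (hsep u hu v hv huv)
  have hsum := empCount_biUnion x T S hTd
  have hμ : μ.real (⋃ t ∈ T, S t) = ∑ t ∈ T, μ.real (S t) :=
    measureReal_biUnion_finset hTd fun t _ => hSm t
  set G := ⋃ t ∈ T, S t with hG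
  have hK0 : 0 < K := by by_contra h; nlinarith
  -- Disjoint sets with at least `K ≥ 1 / ε` sample points each cannot be more than `ε n` in number.
  have hTcard : (T.card : ℝ) ≤ ε * n := by
    have h1 : T.card * K ≤ n := by
      refine le_trans ?_ (empCount_le x G)
      rw [hsum, ← nsmul_eq_mul]
      exact Finset.card_nsmul_le_sum _ _ _ fun t ht => hKS t (hTB ht)
    have h2 : (T.card : ℝ) * 1 ≤ T.card * (K * ε) := by gcongr
    nlinarith
  have hd := abs_le.1 (hdev T hTB hsep hTcard)
  have hB : (B.card : ℝ) ≤ 4 * empCount x G := by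
    have h1 : B ⊆ T.biUnion fun t => B.filter fun v => R v t := by
      intro v hv
      obtain ⟨t, ht, hR⟩ := hTcov v hv
      exact Finset.mem_biUnion.2 ⟨t, ht, Finset.mem_filter.2 ⟨hv, hR⟩⟩
    have h2 : (B.card : ℝ) ≤ ∑ t ∈ T, ((B.filter fun v => R v t).card : ℝ) := by
      exact_mod_cast (Finset.card_le_card h1).trans Finset.card_biUnion_le
    refine h2.trans ?_
    rw [hsum, Finset.mul_sum]
    exact Finset.sum_le_sum fun t ht => hcov t (hTB ht) _ (Finset.filter_subset _ _)
      fun v hv => (Finset.mem_filter.1 hv).2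
  have h0 := empCount_nonneg x G
  -- The relative error has the same sign on all the disjoint sets, so it does not cancel in the
  -- union.
  have hkey : η * empCount x G ≤ 2 * κ := by
    rcases hbad with h | h
    · have h3 : (1 + η) * (n * μ.real G) ≤ empCount x G := by
        rw [hμ, hsum, Finset.mul_sum, Finset.mul_sum]
        exact Finset.sum_le_sum fun t ht => h t (hTB ht)
      nlinarith [hd.1, hd.2]
    · have h3 : empCount x G ≤ (1 - η) * (n * μ.real G) := by
        rw [hμ, hsum, Finset.mul_sum, Finset.mul_sum]
        exact Finset.sum_le_sum fun t ht => h t (hTB ht)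
      nlinarith [hd.1, hd.2]
  rw [div_mul_eq_mul_div, le_div_iff₀ hη]
  nlinarith

/-- The range of the points with index in `E`. -/
def boxSet (E : Finset (Fin n)) (y : Fin n → Fin d → ℝ) : Set (Fin d → ℝ) :=
  {t | ∀ j, lowOn E y j ≤ t j ∧ t j ≤ highOn E y j}

/-- The union of the cells of the points with index in `E₁`. -/
def cellUnion (E : Finset (Fin n)) (y : Fin n → Fin d → ℝ) (ℓ : ℕ) (E₁ : Finset (Fin n)) :
    Set (Fin d → ℝ) :=
  {t | t ∈ boxSet E y ∧ ∃ e ∈ E₁, cellOn E y ℓ (y e) = cellOn E y ℓ t}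

/-- The union of the slabs in the direction `j` that start at the points with index in `E₁` and
end at points with index in `E₂`. -/
def slabUnion (E : Finset (Fin n)) (y : Fin n → Fin d → ℝ) (ℓ : ℕ) (j : Fin d)
    (E₁ E₂ : Finset (Fin n)) : Set (Fin d → ℝ) :=
  {t | t ∈ boxSet E y ∧ ∃ e ∈ E₁, cellOn E y ℓ (y e) = cellOn E y ℓ t ∧ y e j < t j ∧
    ∀ e' ∈ E₂, cellOn E y ℓ (y e') = cellOn E y ℓ t → y e j < y e' j → t j ≤ y e' j}

lemma measurableSet_mem_boxSet {α : Type*} [MeasurableSpace α] (E : Finset (Fin n))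
    {y : α → Fin n → Fin d → ℝ} {t : α → Fin d → ℝ} (hy : Measurable y) (ht : Measurable t) :
    MeasurableSet {a | t a ∈ boxSet E (y a)} := by
  have : {a | t a ∈ boxSet E (y a)} =
      ⋂ j, {a | lowOn E (y a) j ≤ t a j} ∩ {a | t a j ≤ highOn E (y a) j} := by
    ext a; simp [boxSet]
  rw [this]
  exact MeasurableSet.iInter fun j =>
    (measurableSet_le ((measurable_lowOn E j).comp hy) ((measurable_pi_apply j).comp ht)).inter
    (measurableSet_le ((measurable_pi_apply j).comp ht) ((measurable_highOn E j).comp hy))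

lemma measurableSet_cellOn_eq {α : Type*} [MeasurableSpace α] (E : Finset (Fin n)) (ℓ : ℕ)
    {y : α → Fin n → Fin d → ℝ} {s t : α → Fin d → ℝ} (hy : Measurable y) (hs : Measurable s)
    (ht : Measurable t) : MeasurableSet {a | cellOn E (y a) ℓ (s a) = cellOn E (y a) ℓ (t a)} :=
  measurableSet_eq_fun (hy.cellOn E ℓ hs) (hy.cellOn E ℓ ht)

lemma measurableSet_mem_cellUnion {α : Type*} [MeasurableSpace α] (E : Finset (Fin n)) (ℓ : ℕ)
    (E₁ : Finset (Fin n)) {y : α → Fin n → Fin d → ℝ} {t : α → Fin d → ℝ} (hy : Measurable y)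
    (ht : Measurable t) : MeasurableSet {a | t a ∈ cellUnion E (y a) ℓ E₁} := by
  have : {a | t a ∈ cellUnion E (y a) ℓ E₁} = {a | t a ∈ boxSet E (y a)} ∩
      ⋃ e ∈ E₁, {a | cellOn E (y a) ℓ (y a e) = cellOn E (y a) ℓ (t a)} := by
    ext a; simp [cellUnion]
  rw [this]
  exact (measurableSet_mem_boxSet E hy ht).inter (Finset.measurableSet_biUnion _ fun e _ =>
    measurableSet_cellOn_eq E ℓ hy ((measurable_pi_apply e).comp hy) ht)

lemma measurableSet_mem_slabUnion {α : Type*} [MeasurableSpace α] (E : Finset (Fin n)) (ℓ : ℕ)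
    (j : Fin d) (E₁ E₂ : Finset (Fin n)) {y : α → Fin n → Fin d → ℝ} {t : α → Fin d → ℝ}
    (hy : Measurable y) (ht : Measurable t) :
    MeasurableSet {a | t a ∈ slabUnion E (y a) ℓ j E₁ E₂} := by
  have : {a | t a ∈ slabUnion E (y a) ℓ j E₁ E₂} = {a | t a ∈ boxSet E (y a)} ∩
      ⋃ e ∈ E₁, ({a | cellOn E (y a) ℓ (y a e) = cellOn E (y a) ℓ (t a)} ∩
        ({a | y a e j < t a j} ∩ ⋂ e' ∈ E₂,
          ({a | cellOn E (y a) ℓ (y a e') = cellOn E (y a) ℓ (t a)}ᶜ ∪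
            ({a | y a e j < y a e' j}ᶜ ∪ {a | t a j ≤ y a e' j})))) := by
    ext a
    simp only [slabUnion, Set.mem_ofPred_eq, Set.mem_inter_iff, Set.mem_iUnion, Set.mem_iInter,
      Set.mem_union, Set.mem_compl_iff, exists_prop, imp_iff_not_or]
  have hc : ∀ e, Measurable fun a => y a e j := fun e =>
    (measurable_pi_apply j).comp ((measurable_pi_apply e).comp hy)
  have htj : Measurable fun a => t a j := (measurable_pi_apply j).comp ht
  rw [this]
  refine (measurableSet_mem_boxSet E hy ht).inter (Finset.measurableSet_biUnion _ fun e _ => ?_)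
  refine (measurableSet_cellOn_eq E ℓ hy ((measurable_pi_apply e).comp hy) ht).inter
    ((measurableSet_lt (hc e) htj).inter (Finset.measurableSet_biInter _ fun e' _ => ?_))
  exact (measurableSet_cellOn_eq E ℓ hy ((measurable_pi_apply e').comp hy) ht).compl.union
    ((measurableSet_lt (hc e) (hc e')).compl.union (measurableSet_le htj (hc e')))

lemma boxSet_congr {E : Finset (Fin n)} {y y' : Fin n → Fin d → ℝ} (h : ∀ v ∈ E, y v = y' v) :
    boxSet E y = boxSet E y' := by
  ext t; simp only [boxSet, Set.mem_ofPred_eq, lowOn_congr h, highOn_congr h]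

lemma cellUnion_congr {E E₁ : Finset (Fin n)} {y y' : Fin n → Fin d → ℝ}
    (h : ∀ v ∈ E, y v = y' v) (ℓ : ℕ) (h₁ : E₁ ⊆ E) :
    cellUnion E y ℓ E₁ = cellUnion E y' ℓ E₁ := by
  ext t
  simp only [cellUnion, Set.mem_ofPred_eq, boxSet_congr h, cellOn_congr h]
  refine and_congr_right fun _ => exists_congr fun e => and_congr_right fun he => ?_
  rw [h e (h₁ he)]

lemma slabUnion_congr {E E₁ E₂ : Finset (Fin n)} {y y' : Fin n → Fin d → ℝ}
    (h : ∀ v ∈ E, y v = y' v) (ℓ : ℕ) (j : Fin d) (h₁ : E₁ ⊆ E) (h₂ : E₂ ⊆ E) :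
    slabUnion E y ℓ j E₁ E₂ = slabUnion E y' ℓ j E₁ E₂ := by
  ext t
  simp only [slabUnion, Set.mem_ofPred_eq, boxSet_congr h, cellOn_congr h]
  refine and_congr_right fun _ => exists_congr fun e => and_congr_right fun he => ?_
  rw [h e (h₁ he)]
  refine and_congr_right fun _ => and_congr_right fun _ => forall_congr' fun e' =>
    forall_congr' fun he' => ?_
  rw [h e' (h₂ he')]

lemma cellUnion_eq_univ {E : Finset (Fin n)} {y : Fin n → Fin d → ℝ}
    (hE : (∀ j, lowOn E y j = lowOn Finset.univ y j) ∧ ∀ j, highOn E y j = highOn Finset.univ y j)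
    (ℓ : ℕ) (E₁ : Finset (Fin n)) : cellUnion E y ℓ E₁ = cellUnion Finset.univ y ℓ E₁ := by
  unfold cellUnion boxSet cellOn; simp only [hE.1, hE.2]

lemma slabUnion_eq_univ {E : Finset (Fin n)} {y : Fin n → Fin d → ℝ}
    (hE : (∀ j, lowOn E y j = lowOn Finset.univ y j) ∧ ∀ j, highOn E y j = highOn Finset.univ y j)
    (ℓ : ℕ) (j : Fin d) (E₁ E₂ : Finset (Fin n)) :
    slabUnion E y ℓ j E₁ E₂ = slabUnion Finset.univ y ℓ j E₁ E₂ := by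
  unfold slabUnion boxSet cellOn; simp only [hE.1, hE.2]

variable {Ω : Type*} [MeasurableSpace Ω] {P : Measure Ω} [IsProbabilityMeasure P]
  {μ : Measure (Fin d → ℝ)} [IsProbabilityMeasure μ] {X : ℕ → Ω → Fin d → ℝ}

/-- All unions of few cells, and of few slabs, have about the right number of sample points. -/
lemma IsSample.ae_eventually_union_deviation (hX : IsSample P μ X) (ℓ : ℕ → ℕ) {s : ℝ}
    (hs : 0 < s) (hs1 : s ≤ 1) :
    ∃ ε > 0, ∀ᵐ ω ∂P, ∀ᶠ n : ℕ in atTop, ∀ E₁ E₂ : Finset (Fin n),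
      (E₁.card : ℝ) ≤ ε * n → (E₂.card : ℝ) ≤ ε * n →
      (|empCount (fun v : Fin n => X v ω) (cellUnion Finset.univ (fun v => X v ω) (ℓ n) E₁) -
        n * μ.real (cellUnion Finset.univ (fun v : Fin n => X v ω) (ℓ n) E₁)| ≤ 4 * s * n) ∧
      ∀ j, |empCount (fun v : Fin n => X v ω)
        (slabUnion Finset.univ (fun v => X v ω) (ℓ n) j E₁ E₂) -
        n * μ.real (slabUnion Finset.univ (fun v : Fin n => X v ω) (ℓ n) j E₁ E₂)| ≤
        4 * s * n := by
  classical
  obtain ⟨ε₀, hε₀, hcount⟩ := exists_sum_pow_card_le le_rfl (show 0 < s ^ 2 / 6 by positivity)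
  simp only [one_pow, Finset.sum_const, nsmul_eq_mul, mul_one] at hcount
  set ε := min ε₀ (s / 3) with hε
  have hεpos : 0 < ε := lt_min hε₀ (by positivity)
  set I : ∀ n, Finset (Finset (Fin n)) :=
    fun n => Finset.univ.filter fun S : Finset (Fin n) => (S.card : ℝ) ≤ ε * n with hI
  have hIcard : ∀ n, ((I n).card : ℝ) ≤ Real.exp (s ^ 2 / 6 * n) := by
    intro n
    refine le_trans ?_ (hcount n)
    refine Nat.cast_le.2 (Finset.card_le_card fun S hS => ?_)
    simp only [hI, Finset.mem_filter, Finset.mem_univ, true_and] at hS ⊢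
    exact hS.trans (by gcongr; exact min_le_left _ _)
  -- The first of the three index sets is reserved for the extreme points, so that the sets of `U`
  -- determine the grid. The `Option` codes cells (`none`) or slabs in a direction; three factors
  -- `exp (s ^ 2 n / 6)` give the admissible count.
  set U : ∀ n, ((I n ×ˢ I n ×ˢ I n : Finset _) × Option (Fin d)) → Finset (Fin n) :=
    fun n i => i.1.1.1 ∪ (i.1.1.2.1 ∪ i.1.1.2.2) with hU
  set G : ∀ n, ((I n ×ˢ I n ×ˢ I n : Finset _) × Option (Fin d)) → (Fin n → Fin d → ℝ) →
      Set (Fin d → ℝ) := fun n i y => match i.2 with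
    | none => cellUnion (U n i) y (ℓ n) i.1.1.2.1
    | some j => slabUnion (U n i) y (ℓ n) j i.1.1.2.1 i.1.1.2.2 with hG
  have hdev := hX.ae_eventually_deviation U G ?_ ?_ hs hs1 (K := d + 1) ?_
  · refine ⟨ε, hεpos, ?_⟩
    filter_upwards [hdev] with ω hω
    have hd : ∀ᶠ n : ℕ in atTop, (2 * d : ℝ) ≤ ε * n :=
      (tendsto_natCast_atTop_atTop.const_mul_atTop hεpos).eventually_ge_atTop _
    filter_upwards [hω, hd] with n hn hdn
    intro E₁ E₂ h₁ h₂
    set x : Fin n → Fin d → ℝ := fun v => X v ω with hx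
    obtain ⟨E₀, hE₀, hext⟩ := exists_extremes x
    have h₀ : (E₀.card : ℝ) ≤ ε * n := by
      refine le_trans ?_ hdn; exact_mod_cast hE₀
    have hmem : (E₀, E₁, E₂) ∈ (I n ×ˢ I n ×ˢ I n : Finset _) := by
      simp only [Finset.mem_product, hI, Finset.mem_filter, Finset.mem_univ, true_and]
      exact ⟨h₀, h₁, h₂⟩
    have hunion := hext (E₀ ∪ (E₁ ∪ E₂)) Finset.subset_union_left
    have hUcard : ((E₀ ∪ (E₁ ∪ E₂)).card : ℝ) ≤ s * n := by
      have h3 : ((E₀ ∪ (E₁ ∪ E₂)).card : ℝ) ≤ E₀.card + (E₁.card + E₂.card) := by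
        exact_mod_cast (Finset.card_union_le _ _).trans
          (Nat.add_le_add_left (Finset.card_union_le _ _) _)
      have h4 : ε * n ≤ s / 3 * n := by gcongr; exact min_le_right _ _
      linarith
    -- The few points that define the set are not covered by the deviation bound; each contributes
    -- at most 1, which raises `3 s n` to `4 s n`.
    have key : ∀ S : Set (Fin d → ℝ),
        |∑ v ∈ (E₀ ∪ (E₁ ∪ E₂))ᶜ, (S.indicator 1 (x v) - μ.real S)| ≤ 3 * s * n →
        |empCount x S - n * μ.real S| ≤ 4 * s * n := by
      intro S hS
      have h5 : empCount x S - n * μ.real S = ∑ v, (S.indicator 1 (x v) - μ.real S) := by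
        rw [Finset.sum_sub_distrib]; simp [empCount]
      rw [h5, ← Finset.sum_add_sum_compl (E₀ ∪ (E₁ ∪ E₂))]
      have h6 : |∑ v ∈ E₀ ∪ (E₁ ∪ E₂), (S.indicator (1 : (Fin d → ℝ) → ℝ) (x v) - μ.real S)| ≤ s * n := by
        refine (Finset.abs_sum_le_sum_abs _ _).trans (le_trans ?_ hUcard)
        rw [Finset.card_eq_sum_ones, Nat.cast_sum]
        refine Finset.sum_le_sum fun v _ => ?_
        have hp0 : 0 ≤ μ.real S := measureReal_nonneg
        have hp1 : μ.real S ≤ 1 := measureReal_le_one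
        by_cases hv : x v ∈ S <;> simp only [hv, Set.indicator_of_mem, Set.indicator_of_notMem,
          not_false_eq_true, Pi.one_apply, abs_le, Nat.cast_one] <;> constructor <;> linarith
      refine (abs_add_le _ _).trans ?_
      linarith
    constructor
    · have := hn (⟨(E₀, E₁, E₂), hmem⟩, none)
      rw [← cellUnion_eq_univ hunion]
      exact key _ this
    · intro j
      have := hn (⟨(E₀, E₁, E₂), hmem⟩, some j)
      rw [← slabUnion_eq_univ hunion]
      exact key _ this
  · rintro n ⟨i, o⟩
    cases o with
    | none => exact measurableSet_mem_cellUnion _ _ _ measurable_snd measurable_fst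
    | some j => exact measurableSet_mem_slabUnion _ _ j _ _ measurable_snd measurable_fst
  · rintro n ⟨i, o⟩ y y' h
    cases o with
    | none =>
      exact cellUnion_congr h _
        (Finset.subset_union_left.trans Finset.subset_union_right)
    | some j =>
      exact slabUnion_congr h _ j
        (Finset.subset_union_left.trans Finset.subset_union_right)
        (Finset.subset_union_right.trans Finset.subset_union_right)
  · intro n
    rw [Fintype.card_prod, Fintype.card_coe, Fintype.card_option, Fintype.card_fin,
      Finset.card_product, Finset.card_product]
    push_cast
    have h1 := hIcard n
    calc ((I n).card : ℝ) * ((I n).card * (I n).card) * (d + 1)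
        ≤ Real.exp (s ^ 2 / 6 * n) * (Real.exp (s ^ 2 / 6 * n) * Real.exp (s ^ 2 / 6 * n)) *
          (d + 1) := by gcongr
      _ = (d + 1) * Real.exp (s ^ 2 / 2 * n) := by
          rw [← Real.exp_add, ← Real.exp_add, mul_comm]; congr 2; ring

end

end PSS

namespace PSS

noncomputable section

variable {d n : ℕ}

/-! ### Cells and slabs with about the right number of points -/

/-- The part of the cell of the `v`-th point in the range of the sample. -/
def boxCell (x : Fin n → Fin d → ℝ) (ℓ : ℕ) (v : Fin n) : Set (Fin d → ℝ) :=
  {t | t ∈ boxSet Finset.univ x ∧ cellOn Finset.univ x ℓ (x v) = cellOn Finset.univ x ℓ t}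

/-- The slab of the cell of the `v`-th point that belongs to its spacing in the direction `j`. -/
def slab (x : Fin n → Fin d → ℝ) (ℓ : ℕ) (a : Fin n → Fin d → ℕ) (j : Fin d) (v : Fin n) :
    Set (Fin d → ℝ) :=
  {t | t ∈ boxCell x ℓ v ∧ os x ℓ v j ((a v j : ℤ) - par x ℓ v) < t j ∧
    t j ≤ os x ℓ v j ((a v j : ℤ) + par x ℓ v)}

/-- The spacing used at the `v`-th point is not affected by the boundary of its cell. -/
def IsInner (x : Fin n → Fin d → ℝ) (ℓ : ℕ) (a : Fin n → Fin d → ℕ) (j : Fin d) (v : Fin n) :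
    Prop :=
  par x ℓ v + 1 ≤ a v j ∧ a v j + par x ℓ v ≤ cnt x ℓ v

lemma self_mem_boxSet (x : Fin n → Fin d → ℝ) (v : Fin n) : x v ∈ boxSet Finset.univ x :=
  fun j => ⟨lowOn_le x (Finset.mem_univ v) j, le_highOn x (Finset.mem_univ v) j⟩

lemma mem_boxCell_iff {x : Fin n → Fin d → ℝ} {ℓ : ℕ} {u v : Fin n} :
    x u ∈ boxCell x ℓ v ↔ u ∈ pts x ℓ v := by
  rw [mem_pts, cellIndex_eq_cellOn, cellIndex_eq_cellOn]
  exact ⟨fun h => h.2.symm, fun h => ⟨self_mem_boxSet x u, h.symm⟩⟩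

lemma measurableSet_boxCell (x : Fin n → Fin d → ℝ) (ℓ : ℕ) (v : Fin n) :
    MeasurableSet (boxCell x ℓ v) :=
  (measurableSet_mem_boxSet Finset.univ measurable_const measurable_id).inter
    (measurableSet_cellOn_eq Finset.univ ℓ measurable_const measurable_const measurable_id)

lemma measurableSet_slab (x : Fin n → Fin d → ℝ) (ℓ : ℕ) (a : Fin n → Fin d → ℕ) (j : Fin d)
    (v : Fin n) : MeasurableSet (slab x ℓ a j v) :=
  (measurableSet_boxCell x ℓ v).inter
    ((measurableSet_lt measurable_const (measurable_pi_apply j)).inter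
      (measurableSet_le (measurable_pi_apply j) measurable_const))

lemma empCount_boxCell (x : Fin n → Fin d → ℝ) (ℓ : ℕ) (v : Fin n) :
    empCount x (boxCell x ℓ v) = cnt x ℓ v := by
  classical
  rw [empCount_eq_card, cnt]
  congr 2
  ext u
  simp only [Finset.mem_filter, Finset.mem_univ, true_and, mem_boxCell_iff]

lemma iUnion_boxCell (x : Fin n → Fin d → ℝ) (ℓ : ℕ) (T : Finset (Fin n)) :
    ⋃ t ∈ T, boxCell x ℓ t = cellUnion Finset.univ x ℓ T := by
  ext s
  simp only [Set.mem_iUnion, exists_prop, boxCell, cellUnion, Set.mem_ofPred_eq]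
  exact ⟨fun ⟨t, ht, h1, h2⟩ => ⟨h1, t, ht, h2⟩, fun ⟨h1, t, ht, h2⟩ => ⟨t, ht, h1, h2⟩⟩

variable {x : Fin n → Fin d → ℝ} {ℓ : ℕ} {a : Fin n → Fin d → ℕ}

lemma disjoint_boxCell {u v : Fin n} (h : u ∉ pts x ℓ v) :
    Disjoint (boxCell x ℓ u) (boxCell x ℓ v) := by
  rw [Set.disjoint_left]
  intro t hu hv
  apply h
  rw [mem_pts, cellIndex_eq_cellOn, cellIndex_eq_cellOn, hu.2, hv.2]

lemma mem_pts_symm {u v : Fin n} (h : u ∈ pts x ℓ v) : v ∈ pts x ℓ u :=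
  mem_pts.2 (mem_pts.1 h).symm

/-- Few points lie in cells with too many, or too few, points. -/
lemma card_badCell_le (μ : Measure (Fin d → ℝ)) [IsFiniteMeasure μ] (B : Finset (Fin n))
    {ε κ η K : ℝ} (hK : 1 ≤ K * ε) (hKB : ∀ v ∈ B, K ≤ cnt x ℓ v) (hε : 0 < ε) (hη : 0 < η)
    (hη1 : η ≤ 1)
    (hdev : ∀ E₁ : Finset (Fin n), (E₁.card : ℝ) ≤ ε * n →
      |empCount x (cellUnion Finset.univ x ℓ E₁) -
        n * μ.real (cellUnion Finset.univ x ℓ E₁)| ≤ κ)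
    (hbad : (∀ v ∈ B, (1 + η) * (n * μ.real (boxCell x ℓ v)) ≤ cnt x ℓ v) ∨
      (∀ v ∈ B, cnt x ℓ v ≤ (1 - η) * (n * μ.real (boxCell x ℓ v)))) :
    (B.card : ℝ) ≤ 8 / η * κ := by
  refine card_le_of_deviation μ x B (fun u v => u ∈ pts x ℓ v) (self_mem_pts x ℓ)
    (fun _ _ => mem_pts_symm) (boxCell x ℓ) (measurableSet_boxCell x ℓ)
    (fun u _ v _ h => disjoint_boxCell h) hK ?_ hε hη hη1 ?_ ?_ ?_
  · simpa only [empCount_boxCell] using hKB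
  · intro t _ C _ hC
    rw [empCount_boxCell]
    have h1 : (C.card : ℝ) ≤ cnt x ℓ t := by exact_mod_cast Finset.card_le_card hC
    have h2 : (0 : ℝ) ≤ cnt x ℓ t := by positivity
    linarith
  · intro T _ _ hT
    rw [iUnion_boxCell]
    exact hdev T hT
  · simpa only [empCount_boxCell] using hbad

lemma exists_rk_eq (j : Fin d) (hinj : Function.Injective fun v => x v j) (v : Fin n) {r : ℕ}
    (h1 : 1 ≤ r) (h2 : r ≤ cnt x ℓ v) : ∃ u ∈ pts x ℓ v, rk x ℓ j u = r ∧ os x ℓ v j r = x u j := by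
  obtain ⟨u, hu, hur⟩ := exists_rank_eq (C := pts x ℓ v) (y := fun u => x u j) hinj.injOn h1 h2
  have h3 : rk x ℓ j u = r := by unfold rk; rw [pts_congr hu]; exact hur
  refine ⟨u, hu, h3, ?_⟩
  rw [← h3, ← os_congr hu, os_rk]

lemma rk_le_rk_iff {j : Fin d} {u v : Fin n} (h : u ∈ pts x ℓ v) :
    rk x ℓ j u ≤ rk x ℓ j v ↔ x u j ≤ x v j := by
  have h1 : rk x ℓ j u = rank (pts x ℓ v) (fun u => x u j) u := by unfold rk; rw [pts_congr h]
  rw [h1]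
  exact rank_le_rank_iff h

/-- The end points of the slab of an inner point. -/
lemma IsInner.exists_ends {j : Fin d} {v : Fin n} (h : IsInner x ℓ a j v)
    (hinj : Function.Injective fun v => x v j) :
    ∃ e ∈ pts x ℓ v, ∃ e' ∈ pts x ℓ v, rk x ℓ j e + par x ℓ v = a v j ∧
      rk x ℓ j e' = a v j + par x ℓ v ∧
      os x ℓ v j ((a v j : ℤ) - par x ℓ v) = x e j ∧
      os x ℓ v j ((a v j : ℤ) + par x ℓ v) = x e' j := by
  obtain ⟨h1, h2⟩ := h
  obtain ⟨e, he, her, hee⟩ := exists_rk_eq (ℓ := ℓ) j hinj v (r := a v j - par x ℓ v) (by omega)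
    (by omega)
  obtain ⟨e', he', her', hee'⟩ := exists_rk_eq (ℓ := ℓ) j hinj v (r := a v j + par x ℓ v)
    (by omega) (by omega)
  refine ⟨e, he, e', he', by omega, her', ?_, ?_⟩
  · rw [← hee]; congr 1; push_cast [show par x ℓ v ≤ a v j by omega]; rfl
  · rw [← hee']; congr 1

/-- The slab is open on the left, so of the two end points only the upper one belongs to it. This
makes the count exactly `2 m` in `empCount_slab`. -/
lemma mem_slab_iff {j : Fin d} {u v : Fin n} (h : IsInner x ℓ a j v)
    (hinj : Function.Injective fun v => x v j) :
    x u ∈ slab x ℓ a j v ↔ u ∈ pts x ℓ v ∧ a v j - par x ℓ v + 1 ≤ rk x ℓ j u ∧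
      rk x ℓ j u ≤ a v j + par x ℓ v := by
  obtain ⟨e, he, e', he', h1, h2, h3, h4⟩ := h.exists_ends hinj
  unfold slab
  rw [Set.mem_ofPred_eq, mem_boxCell_iff, h3, h4]
  refine and_congr_right fun hu => ?_
  have hue : u ∈ pts x ℓ e := by rw [pts_congr he]; exact hu
  have hue' : u ∈ pts x ℓ e' := by rw [pts_congr he']; exact hu
  rw [← rk_le_rk_iff hue', ← not_le, ← rk_le_rk_iff hue]
  omega

lemma empCount_slab {j : Fin d} {v : Fin n} (h : IsInner x ℓ a j v)
    (hinj : Function.Injective fun v => x v j) : empCount x (slab x ℓ a j v) = 2 * par x ℓ v := by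
  classical
  have h1 := card_rank_mem_Icc_eq (C := pts x ℓ v) (y := fun u => x u j) hinj.injOn
    (p := a v j - par x ℓ v + 1) (q := a v j + par x ℓ v) (by omega) h.2
  rw [empCount_eq_card]
  have h2 : (Finset.univ.filter fun u => x u ∈ slab x ℓ a j v) =
      (pts x ℓ v).filter fun u => a v j - par x ℓ v + 1 ≤ rank (pts x ℓ v) (fun u => x u j) u ∧
        rank (pts x ℓ v) (fun u => x u j) u ≤ a v j + par x ℓ v := by
    ext u
    simp only [Finset.mem_filter, Finset.mem_univ, true_and, mem_slab_iff h hinj]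
    refine and_congr_right fun hu => ?_
    unfold rk; rw [pts_congr hu]
  rw [h2, h1]
  have := h.1
  have h3 : a v j + par x ℓ v + 1 - (a v j - par x ℓ v + 1) = 2 * par x ℓ v := by omega
  rw [h3]; push_cast; ring

/-- Few points lie in slabs with too many, or too few, points. -/
lemma card_badSlab_le (μ : Measure (Fin d → ℝ)) [IsFiniteMeasure μ] (ha : IsWindow x ℓ a)
    (j : Fin d) (hinj : Function.Injective fun v => x v j) (B : Finset (Fin n))
    {ε κ η K : ℝ} (hK : 1 ≤ K * ε) (hKB : ∀ v ∈ B, K ≤ 2 * par x ℓ v) (hε : 0 < ε) (hη : 0 < η)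
    (hη1 : η ≤ 1) (hB : ∀ v ∈ B, IsInner x ℓ a j v)
    (hdev : ∀ E₁ E₂ : Finset (Fin n), (E₁.card : ℝ) ≤ ε * n → (E₂.card : ℝ) ≤ ε * n →
      |empCount x (slabUnion Finset.univ x ℓ j E₁ E₂) -
        n * μ.real (slabUnion Finset.univ x ℓ j E₁ E₂)| ≤ κ)
    (hbad : (∀ v ∈ B, (1 + η) * (n * μ.real (slab x ℓ a j v)) ≤ 2 * par x ℓ v) ∨
      (∀ v ∈ B, 2 * par x ℓ v ≤ (1 - η) * (n * μ.real (slab x ℓ a j v)))) :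
    (B.card : ℝ) ≤ 8 / η * κ := by
  classical
  have hcount : ∀ v ∈ B, empCount x (slab x ℓ a j v) = 2 * par x ℓ v := fun v hv =>
    empCount_slab (hB v hv) hinj
  -- Unrelated points have disjoint slabs: they lie in different cells, or their windows `(a - m, a
  -- + m]` do not overlap.
  set R : Fin n → Fin n → Prop := fun u v => u ∈ pts x ℓ v ∧ a u j < a v j + 2 * par x ℓ v ∧
    a v j < a u j + 2 * par x ℓ u with hR
  have hends : ∀ v, ∃ e e', v ∈ B → e ∈ pts x ℓ v ∧ e' ∈ pts x ℓ v ∧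
      rk x ℓ j e + par x ℓ v = a v j ∧ rk x ℓ j e' = a v j + par x ℓ v ∧
      os x ℓ v j ((a v j : ℤ) - par x ℓ v) = x e j ∧
      os x ℓ v j ((a v j : ℤ) + par x ℓ v) = x e' j := by
    intro v
    by_cases hv : v ∈ B
    · obtain ⟨e, he, e', he', h⟩ := (hB v hv).exists_ends hinj
      exact ⟨e, e', fun _ => ⟨he, he', h⟩⟩
    · exact ⟨v, v, fun h => absurd h hv⟩
  choose e e' hee using hends
  have hcell : ∀ {u v t}, t ∈ slab x ℓ a j u → t ∈ slab x ℓ a j v → u ∈ pts x ℓ v := by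
    intro u v t hu hv
    by_contra h
    exact Set.disjoint_left.1 (disjoint_boxCell h) hu.1 hv.1
  refine card_le_of_deviation μ x B R ?_ ?_ (slab x ℓ a j) (measurableSet_slab x ℓ a j)
    ?_ hK (fun v hv => by rw [hcount v hv]; exact hKB v hv) hε hη hη1 ?_ ?_ ?_
  · intro v
    have := one_le_par x ℓ v
    exact ⟨self_mem_pts x ℓ v, by omega, by omega⟩
  · intro u v ⟨h1, h2, h3⟩
    exact ⟨mem_pts_symm h1, h3, h2⟩
  · intro u hu v hv h
    rw [Set.disjoint_left]
    intro t htu htv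
    have hp := hcell htu htv
    have hpar := par_congr hp
    apply h
    refine ⟨hp, ?_, ?_⟩
    · by_contra hc
      have h1 := htu.2.1
      have h2 := htv.2.2
      rw [os_congr hp] at h1
      have h3 := os_mono x ℓ v j (show (a v j : ℤ) + par x ℓ v ≤ a u j - par x ℓ u by omega)
      linarith
    · by_contra hc
      have h1 := htu.2.2
      have h2 := htv.2.1
      rw [os_congr hp] at h1
      have h3 := os_mono x ℓ v j (show (a u j : ℤ) + par x ℓ u ≤ a v j - par x ℓ v by omega)
      linarith
  · intro t ht C _ hC
    rw [hcount t ht]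
    -- The windows of related points have centres less than `2 m` apart, and a rank is within `m` of
    -- its centre. So the ranks lie within `3 m` of `a t j`, and `6 m + 1 ≤ 4 * (2 m)`.
    have h1 := card_rank_mem_Icc_le (C := pts x ℓ t) (y := fun u => x u j) hinj.injOn
      ((a t j : ℤ) - 3 * par x ℓ t) ((a t j : ℤ) + 3 * par x ℓ t) (by omega)
    have h2 : C ⊆ (pts x ℓ t).filter fun u => (a t j : ℤ) - 3 * par x ℓ t ≤
        (rank (pts x ℓ t) (fun u => x u j) u : ℤ) ∧
        (rank (pts x ℓ t) (fun u => x u j) u : ℤ) ≤ (a t j : ℤ) + 3 * par x ℓ t := by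
      intro u hu
      obtain ⟨h3, h4, h5⟩ := hC u hu
      have h6 := rk_mem_window ha u j hinj
      have hpar := par_congr h3
      have h7 : rk x ℓ j u = rank (pts x ℓ t) (fun u => x u j) u := by
        unfold rk; rw [pts_congr h3]
      rw [h7] at h6
      refine Finset.mem_filter.2 ⟨h3, ?_, ?_⟩ <;> omega
    have h3 := Finset.card_le_card h2
    have h4 := one_le_par x ℓ t
    have h5 : C.card ≤ 8 * par x ℓ t := by omega
    have h6 : (C.card : ℝ) ≤ 8 * par x ℓ t := by exact_mod_cast h5
    linarith
  · intro T hTB hsep hT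
    -- The pairing of lower with upper end points need not be recorded: by separation, the first
    -- upper end point of the same cell after `e t` is `e' t`.
    have hunion : ⋃ t ∈ T, slab x ℓ a j t =
        slabUnion Finset.univ x ℓ j (T.image e) (T.image e') := by
      ext s
      simp only [Set.mem_iUnion, exists_prop]
      constructor
      · rintro ⟨t, ht, hs⟩
        obtain ⟨he, he', hre, hre', hoe, hoe'⟩ := hee t (hTB ht)
        have hst : cellOn Finset.univ x ℓ (x t) = cellOn Finset.univ x ℓ s := hs.1.2
        refine ⟨hs.1.1, e t, Finset.mem_image_of_mem _ ht, ?_, ?_, ?_⟩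
        · rw [← hst]; simpa only [mem_pts, cellIndex_eq_cellOn] using he
        · rw [← hoe]; exact hs.2.1
        · intro w hw hws hlt
          obtain ⟨t', ht', rfl⟩ := Finset.mem_image.1 hw
          obtain ⟨_, ge', _, gre', _, _⟩ := hee t' (hTB ht')
          have htt' : t' ∈ pts x ℓ t := by
            rw [mem_pts, cellIndex_eq_cellOn, cellIndex_eq_cellOn, hst, ← hws]
            have := mem_pts.1 ge'
            rw [cellIndex_eq_cellOn, cellIndex_eq_cellOn] at this
            exact this.symm
          have hpar := par_congr htt'
          have ge'' : e' t' ∈ pts x ℓ t := by rw [← pts_congr htt']; exact ge'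
          have g1 : rk x ℓ j (e t) < rk x ℓ j (e' t') := by
            rw [← not_le] at hlt ⊢
            rwa [rk_le_rk_iff (by rw [pts_congr he]; exact ge'')]
          have g2 : x (e' t) j ≤ x (e' t') j := by
            rw [← rk_le_rk_iff (ℓ := ℓ) (by rw [pts_congr ge'']; exact he')]
            by_cases htt : t' = t
            · rw [htt]
            · have := hsep t' ht' t ht htt
              simp only [hR, not_and, not_lt] at this
              have := this htt'
              by_contra hcon
              have : a t' j < a t j + 2 * par x ℓ t := by omega
              omega
          have := hs.2.2
          rw [hoe'] at this
          exact this.trans g2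
      · rintro ⟨hbox, w, hw, hws, hlt, hall⟩
        obtain ⟨t, ht, rfl⟩ := Finset.mem_image.1 hw
        obtain ⟨he, he', hre, hre', hoe, hoe'⟩ := hee t (hTB ht)
        have hst : cellOn Finset.univ x ℓ (x t) = cellOn Finset.univ x ℓ s := by
          rw [← hws]
          have := mem_pts.1 he
          rw [cellIndex_eq_cellOn, cellIndex_eq_cellOn] at this
          exact this.symm
        refine ⟨t, ht, ⟨hbox, hst⟩, ?_, ?_⟩
        · rw [hoe]; exact hlt
        · rw [hoe']
          refine hall (e' t) (Finset.mem_image_of_mem _ ht) ?_ ?_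
          · rw [← hst]; simpa only [mem_pts, cellIndex_eq_cellOn] using he'
          · rw [← not_le, ← rk_le_rk_iff (ℓ := ℓ) (by rw [pts_congr he]; exact he')]
            have := one_le_par x ℓ t
            omega
    rw [hunion]
    have hc : ∀ g : Fin n → Fin n, ((T.image g).card : ℝ) ≤ ε * n := fun g =>
      le_trans (by exact_mod_cast Finset.card_image_le) hT
    exact hdev _ _ (hc e) (hc e')
  · rcases hbad with h | h
    · exact Or.inl fun v hv => by rw [hcount v hv]; exact h v hv
    · exact Or.inr fun v hv => by rw [hcount v hv]; exact h v hv

lemma par_le_two_sqrt (x : Fin n → Fin d → ℝ) (ℓ : ℕ) (v : Fin n) :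
    (par x ℓ v : ℝ) ≤ 2 * √(cnt x ℓ v) := by
  have h1 := spacingParam_le (cnt x ℓ v)
  have h2 : (1 : ℝ) ≤ √(cnt x ℓ v) := Real.one_le_sqrt.2 (by exact_mod_cast one_le_cnt x ℓ v)
  change (par x ℓ v : ℝ) ≤ _ at h1
  linarith

/-- Few points of large cells have a spacing that is affected by the boundary. -/
lemma card_not_isInner_le (ha : IsWindow x ℓ a) (j : Fin d)
    (hinj : Function.Injective fun v => x v j) {K : ℝ} (hK : 0 < K) (B : Finset (Fin n))
    (hB : ∀ v ∈ B, K ^ 2 ≤ cnt x ℓ v ∧ ¬ IsInner x ℓ a j v) : (B.card : ℝ) ≤ 8 / K * n := by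
  classical
  have h := sum_le_sum_of_pts x ℓ (fun v => if v ∈ B then (1 : ℝ) else 0) (fun _ => 8 / K) ?_
  · simpa [mul_comm] using h
  intro v
  rw [← Finset.sum_filter, Finset.sum_const, Finset.sum_const, nsmul_eq_mul, nsmul_eq_mul, mul_one]
  change _ ≤ (cnt x ℓ v : ℝ) * _
  rcases ((pts x ℓ v).filter (· ∈ B)).eq_empty_or_nonempty with h0 | ⟨w, hw⟩
  · rw [h0]; simp; positivity
  obtain ⟨hwv, hwB⟩ := Finset.mem_filter.1 hw
  have hKN : K ≤ √(cnt x ℓ v) := by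
    rw [← cnt_congr hwv]
    exact Real.le_sqrt_of_sq_le (hB w hwB).1
  have h1 := card_rank_mem_Icc_le (C := pts x ℓ v) (y := fun u => x u j) hinj.injOn
    1 (2 * par x ℓ v) (by omega)
  have h2 := card_rank_mem_Icc_le (C := pts x ℓ v) (y := fun u => x u j) hinj.injOn
    (cnt x ℓ v + 1 - 2 * par x ℓ v) (cnt x ℓ v) (by omega)
  have hsub : (pts x ℓ v).filter (· ∈ B) ⊆
      ((pts x ℓ v).filter fun u => 1 ≤ (rank (pts x ℓ v) (fun u => x u j) u : ℤ) ∧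
        (rank (pts x ℓ v) (fun u => x u j) u : ℤ) ≤ 2 * par x ℓ v) ∪
      ((pts x ℓ v).filter fun u => (cnt x ℓ v + 1 - 2 * par x ℓ v : ℤ) ≤
        (rank (pts x ℓ v) (fun u => x u j) u : ℤ) ∧
        (rank (pts x ℓ v) (fun u => x u j) u : ℤ) ≤ cnt x ℓ v) := by
    intro u hu
    obtain ⟨huv, huB⟩ := Finset.mem_filter.1 hu
    have h3 := (hB u huB).2
    have h4 := rk_mem_window ha u j hinj
    have h5 : rk x ℓ j u = rank (pts x ℓ v) (fun u => x u j) u := by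
      unfold rk; rw [pts_congr huv]
    have h6 : 1 ≤ rank (pts x ℓ v) (fun u => x u j) u := one_le_rank (y := fun u => x u j) huv
    have h7 : rank (pts x ℓ v) (fun u => x u j) u ≤ cnt x ℓ v :=
      rank_le_card (pts x ℓ v) (fun u => x u j) u
    have hpar := par_congr huv
    have hcnt := cnt_congr huv
    rw [h5, hpar] at h4
    unfold IsInner at h3
    rw [hpar, hcnt] at h3
    rw [Finset.mem_union, Finset.mem_filter, Finset.mem_filter]
    -- A window that meets the border belongs to a point with one of the `2 m` lowest or `2 m`
    -- highest ranks, and `m` is of order `√N`.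
    by_cases h8 : par x ℓ v + 1 ≤ a u j
    · right; refine ⟨huv, ?_, ?_⟩ <;> omega
    · left; refine ⟨huv, ?_, ?_⟩ <;> omega
  have h3 := (Finset.card_le_card hsub).trans (Finset.card_union_le _ _)
  have h4 : ((pts x ℓ v).filter (· ∈ B)).card ≤ 4 * par x ℓ v := by omega
  have h5 : (((pts x ℓ v).filter (· ∈ B)).card : ℝ) ≤ 4 * par x ℓ v := by exact_mod_cast h4
  refine h5.trans ?_
  have h6 := par_le_two_sqrt x ℓ v
  have h7 : (cnt x ℓ v : ℝ) = √(cnt x ℓ v) * √(cnt x ℓ v) := by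
    rw [Real.mul_self_sqrt (by positivity)]
  rw [h7, mul_div_assoc', le_div_iff₀ hK]
  have h8 : (par x ℓ v : ℝ) * K ≤ 2 * √(cnt x ℓ v) * √(cnt x ℓ v) := by gcongr
  linarith

/-- Few points lie in small cells. -/
lemma card_small_le (hℓ : 1 ≤ ℓ) (B : Finset (Fin n)) {M : ℕ} (hB : ∀ v ∈ B, cnt x ℓ v ≤ M) :
    B.card ≤ M * ℓ ^ d := by
  classical
  have h1 : B.card ≤ M * (B.image fun v => cellIndex x ℓ (x v)).card := by
    refine Finset.card_le_mul_card_image B M fun k hk => ?_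
    obtain ⟨v, hv, rfl⟩ := Finset.mem_image.1 hk
    refine le_trans (Finset.card_le_card fun u hu => ?_) (hB v hv)
    exact mem_pts.2 (Finset.mem_filter.1 hu).2
  refine h1.trans (Nat.mul_le_mul_left _ ?_)
  have h2 : (B.image fun v => cellIndex x ℓ (x v)) ⊆
      Fintype.piFinset fun _ : Fin d => Finset.range ℓ := by
    intro k hk
    obtain ⟨v, _, rfl⟩ := Finset.mem_image.1 hk
    refine Fintype.mem_piFinset.2 fun j => Finset.mem_range.2 ?_
    have : cellIndex x ℓ (x v) j ≤ ℓ - 1 := min_le_right _ _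
    omega
  refine (Finset.card_le_card h2).trans (le_of_eq ?_)
  simp

end

end PSS

namespace PSS

noncomputable section

variable {d n : ℕ}

/-! ### The estimator at points where the density is almost constant on the cell -/

/-- The points around which `f` has small relative oscillation at scale `r`. -/
def flatSet (f : (Fin d → ℝ) → ℝ) (η r : ℝ) : Set (Fin d → ℝ) :=
  {t | 0 < f t ∧ ∀ s, dist s t < r → |f s - f t| ≤ η * f t}

/-- The condition on all nearby `s` is uncountable. A violation is witnessed by a rational level
`q`, and the points within `r` of a given set form an open set, however irregular that set is. -/
lemma measurableSet_flatSet {f : (Fin d → ℝ) → ℝ} (hf : Measurable f) (η r : ℝ) :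
    MeasurableSet (flatSet f η r) := by
  have hopen : ∀ A : Set (Fin d → ℝ), MeasurableSet {t | ∃ s ∈ A, dist s t < r} := by
    intro A
    have : {t | ∃ s ∈ A, dist s t < r} = ⋃ s ∈ A, Metric.ball s r := by
      ext t; simp [dist_comm]
    rw [this]
    exact (isOpen_biUnion fun s _ => Metric.isOpen_ball).measurableSet
  have h1 : flatSet f η r = {t | 0 < f t} ∩
      (⋃ q : ℚ, ({t | (1 + η) * f t < q} ∩ {t | ∃ s ∈ {s | (q : ℝ) < f s}, dist s t < r}) ∪
        ({t | (q : ℝ) < (1 - η) * f t} ∩ {t | ∃ s ∈ {s | f s < (q : ℝ)}, dist s t < r}))ᶜ := by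
    ext t
    simp only [flatSet, Set.mem_ofPred_eq, Set.mem_inter_iff, Set.mem_compl_iff, Set.mem_iUnion,
      Set.mem_union, not_exists, not_or]
    refine and_congr_right fun _ => ⟨fun h q => ⟨?_, ?_⟩, fun h s hs => ?_⟩
    · rintro ⟨h1, s, h2, h3⟩
      have := (abs_le.1 (h s h3)).2
      linarith
    · rintro ⟨h1, s, h2, h3⟩
      have := (abs_le.1 (h s h3)).1
      linarith
    · rw [abs_le]
      constructor
      · by_contra hc
        obtain ⟨q, h1, h2⟩ := exists_rat_btwn (show f s < (1 - η) * f t by linarith)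
        exact (h q).2 ⟨h2, s, h1, hs⟩
      · by_contra hc
        obtain ⟨q, h1, h2⟩ := exists_rat_btwn (show (1 + η) * f t < f s by linarith)
        exact (h q).1 ⟨h1, s, h2, hs⟩
  rw [h1]
  refine (measurableSet_lt measurable_const hf).inter (MeasurableSet.iUnion fun q => ?_).compl
  exact ((measurableSet_lt (hf.const_mul _) measurable_const).inter (hopen _)).union
    ((measurableSet_lt measurable_const (hf.const_mul _)).inter (hopen _))

lemma flatSet_anti (f : (Fin d → ℝ) → ℝ) (η : ℝ) {r r' : ℝ} (h : r ≤ r') :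
    flatSet f η r' ⊆ flatSet f η r :=
  fun _ ht => ⟨ht.1, fun s hs => ht.2 s (hs.trans_le h)⟩

lemma exists_mem_flatSet {f : (Fin d → ℝ) → ℝ} {η : ℝ} (hη : 0 < η) {t : Fin d → ℝ}
    (ht : 0 < f t) (hc : ContinuousAt f t) : ∃ k : ℕ, t ∈ flatSet f η (1 / (k + 1)) := by
  obtain ⟨r, hr, h⟩ := Metric.continuousAt_iff.1 hc (η * f t) (by positivity)
  obtain ⟨k, hk⟩ := exists_nat_one_div_lt hr
  exact ⟨k, ht, fun s hs => (h (hs.trans hk)).le⟩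

lemma ae_pos_densityMeasure {f : (Fin d → ℝ) → ℝ} (hf : Measurable f) :
    ∀ᵐ t ∂(densityMeasure f), 0 < f t := by
  unfold densityMeasure
  rw [ae_withDensity_iff hf.ennreal_ofReal]
  refine Eventually.of_forall fun t ht => ?_
  by_contra h
  exact ht (ENNReal.ofReal_eq_zero.2 (not_lt.1 h))

/-- Most of the mass is in the flat sets. -/
lemma exists_flatSet_compl_lt {f : (Fin d → ℝ) → ℝ} (hf : Measurable f)
    [IsProbabilityMeasure (densityMeasure f)] (hc : ∀ᵐ t, ContinuousAt f t) {η ε : ℝ}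
    (hη : 0 < η) (hε : 0 < ε) :
    ∃ r > 0, (densityMeasure f).real (flatSet f η r)ᶜ < ε := by
  set μ := densityMeasure f with hμ
  have h1 : Tendsto (fun k : ℕ => μ (flatSet f η (1 / (k + 1)))ᶜ) atTop
      (𝓝 (μ (⋂ k : ℕ, (flatSet f η (1 / (k + 1)))ᶜ))) := by
    refine tendsto_measure_iInter_atTop
      (fun k => (measurableSet_flatSet hf η _).compl.nullMeasurableSet) ?_
      ⟨0, measure_ne_top _ _⟩
    intro k l hkl
    refine Set.compl_subset_compl.2 (flatSet_anti f η ?_)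
    exact one_div_le_one_div_of_le (by positivity) (by gcongr)
  have h2 : μ (⋂ k : ℕ, (flatSet f η (1 / (k + 1)))ᶜ) = 0 := by
    have h3 : ∀ᵐ t ∂μ, ContinuousAt f t := (withDensity_absolutelyContinuous _ _).ae_le hc
    have h4 : ∀ᵐ t ∂μ, t ∉ ⋂ k : ℕ, (flatSet f η (1 / (k + 1)))ᶜ := by
      filter_upwards [h3, ae_pos_densityMeasure hf] with t ht ht'
      obtain ⟨k, hk⟩ := exists_mem_flatSet hη ht' ht
      intro h
      exact Set.mem_iInter.1 h k hk
    exact measure_eq_zero_iff_ae_notMem.2 h4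
  rw [h2] at h1
  have h5 := h1.eventually_lt_const (ENNReal.ofReal_pos.2 hε)
  obtain ⟨k, hk⟩ := h5.exists
  refine ⟨1 / (k + 1), by positivity, ?_⟩
  rw [Measure.real, ← ENNReal.ofReal_lt_ofReal_iff hε, ENNReal.ofReal_toReal (measure_ne_top _ _)]
  exact hk

/-- The mass of a set on which the density is almost constant. -/
lemma densityMeasure_real_bounds {f : (Fin d → ℝ) → ℝ} {F η : ℝ} (hF : 0 < F) (hη : 0 ≤ η)
    (hη1 : η ≤ 1) {T : Set (Fin d → ℝ)} (hT : MeasurableSet T) (hvol : volume T ≠ ⊤)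
    (h : ∀ s ∈ T, |f s - F| ≤ η * F) :
    (1 - η) * F * volume.real T ≤ (densityMeasure f).real T ∧
      (densityMeasure f).real T ≤ (1 + η) * F * volume.real T := by
  have h1 : densityMeasure f T = ∫⁻ s in T, ENNReal.ofReal (f s) := by
    unfold densityMeasure; rw [withDensity_apply _ hT]
  have h2 : densityMeasure f T ≤ ENNReal.ofReal ((1 + η) * F) * volume T := by
    rw [h1, ← setLIntegral_const]
    refine setLIntegral_mono' hT fun s hs => ENNReal.ofReal_le_ofReal ?_
    linarith [(abs_le.1 (h s hs)).2]
  have h3 : ENNReal.ofReal ((1 - η) * F) * volume T ≤ densityMeasure f T := by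
    rw [h1, ← setLIntegral_const]
    refine setLIntegral_mono' hT fun s hs => ENNReal.ofReal_le_ofReal ?_
    linarith [(abs_le.1 (h s hs)).1]
  have h4 : densityMeasure f T ≠ ⊤ :=
    ne_top_of_le_ne_top (ENNReal.mul_ne_top ENNReal.ofReal_ne_top hvol) h2
  constructor
  · have := ENNReal.toReal_mono h4 h3
    rwa [ENNReal.toReal_mul, ENNReal.toReal_ofReal (mul_nonneg (by linarith) hF.le)] at this
  · have := ENNReal.toReal_mono (ENNReal.mul_ne_top ENNReal.ofReal_ne_top hvol) h2
    rwa [ENNReal.toReal_mul, ENNReal.toReal_ofReal (by positivity)] at this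

lemma abs_log_div_le {p q η : ℝ} (hq : 0 < q) (hη : 0 ≤ η) (hη2 : η ≤ 1 / 2)
    (h1 : (1 - η) * q ≤ p) (h2 : p ≤ (1 + η) * q) : 0 < p ∧ |Real.log p - Real.log q| ≤ 2 * η := by
  have hp : 0 < p := lt_of_lt_of_le (by nlinarith) h1
  refine ⟨hp, ?_⟩
  rw [← Real.log_div hp.ne' hq.ne']
  have h3 : p / q ≤ 1 + η := (div_le_iff₀ hq).2 h2
  have h4 : 1 - η ≤ p / q := (le_div_iff₀ hq).2 h1
  have h5 := Real.log_le_sub_one_of_pos (div_pos hp hq)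
  have h6 := Real.one_sub_inv_le_log_of_pos (div_pos hp hq)
  have h7 : (p / q)⁻¹ ≤ 1 + 2 * η := by
    rw [inv_le_comm₀ (div_pos hp hq) (by positivity)]
    refine le_trans ?_ h4
    rw [inv_le_comm₀ (by positivity) (by linarith), ← one_div, div_le_iff₀ (by linarith)]
    nlinarith
  rw [abs_le]
  constructor <;> linarith

variable {x : Fin n → Fin d → ℝ} {ℓ : ℕ} {a : Fin n → Fin d → ℕ}

/-- The `j`-th side of `boxCell x ℓ v`. -/
def boxSide (x : Fin n → Fin d → ℝ) (ℓ : ℕ) (v : Fin n) (j : Fin d) : Set ℝ :=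
  Set.Icc (lowOn Finset.univ x j) (highOn Finset.univ x j) ∩ segSet Finset.univ x ℓ (x v) j

lemma boxCell_eq_pi (x : Fin n → Fin d → ℝ) (ℓ : ℕ) (v : Fin n) :
    boxCell x ℓ v = Set.univ.pi (boxSide x ℓ v) := by
  ext t
  simp only [boxCell, boxSet, boxSide, Set.mem_ofPred_eq, Set.mem_pi, Set.mem_univ, true_imp_iff,
    Set.mem_inter_iff, Set.mem_Icc, mem_segSet]
  constructor
  · rintro ⟨h1, h2⟩ j
    exact ⟨h1 j, (congrFun h2 j).symm⟩
  · intro h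
    exact ⟨fun j => (h j).1, funext fun j => (h j).2.symm⟩

lemma os_mem_boxSide (x : Fin n → Fin d → ℝ) (ℓ : ℕ) (v : Fin n) (j : Fin d) (r : ℤ) :
    os x ℓ v j r ∈ boxSide x ℓ v j := by
  refine ⟨?_, os_mem_segSet x ℓ v j r⟩
  have hpos : 0 < (crd x ℓ v j).card := by rw [card_crd]; exact one_le_cnt x ℓ v
  obtain ⟨u, _, hu⟩ := Multiset.mem_map.1 (orderStat_mem r hpos)
  change x u j = os x ℓ v j r at hu
  rw [← hu]
  exact self_mem_boxSet x u j

lemma ordConnected_boxSide (x : Fin n → Fin d → ℝ) (ℓ : ℕ) (v : Fin n) (j : Fin d) :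
    (boxSide x ℓ v j).OrdConnected :=
  Set.ordConnected_Icc.inter (ordConnected_segSet Finset.univ x ℓ (x v) j)

lemma slab_eq_pi (x : Fin n → Fin d → ℝ) (ℓ : ℕ) (a : Fin n → Fin d → ℕ) (j : Fin d) (v : Fin n) :
    slab x ℓ a j v = Set.univ.pi (Function.update (boxSide x ℓ v) j
      (Set.Ioc (os x ℓ v j ((a v j : ℤ) - par x ℓ v)) (os x ℓ v j ((a v j : ℤ) + par x ℓ v)))) := by
  ext t
  simp only [slab, Set.mem_ofPred_eq, boxCell_eq_pi, Set.mem_pi, Set.mem_univ, true_imp_iff]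
  constructor
  · rintro ⟨h1, h2⟩ i
    by_cases hij : i = j
    · subst hij; simpa using h2
    · rw [Function.update_of_ne hij]; exact h1 i
  · intro h
    have hj : t j ∈ Set.Ioc (os x ℓ v j ((a v j : ℤ) - par x ℓ v))
        (os x ℓ v j ((a v j : ℤ) + par x ℓ v)) := by simpa using h j
    refine ⟨fun i => ?_, hj⟩
    by_cases hij : i = j
    · subst hij
      exact (ordConnected_boxSide x ℓ v i).out (os_mem_boxSide x ℓ v i _)
        (os_mem_boxSide x ℓ v i _) ⟨hj.1.le, hj.2⟩
    · have := h i
      rwa [Function.update_of_ne hij] at this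

lemma volume_boxSide_ne_top (x : Fin n → Fin d → ℝ) (ℓ : ℕ) (v : Fin n) (j : Fin d) :
    volume (boxSide x ℓ v j) ≠ ⊤ :=
  ne_top_of_le_ne_top (by simp [Real.volume_Icc]) (measure_mono Set.inter_subset_left)

/-- The clamped segment index extends the outermost segments indefinitely; the intersection with the
range of the sample restores finite Lebesgue volume. -/
lemma volume_boxCell_ne_top (x : Fin n → Fin d → ℝ) (ℓ : ℕ) (v : Fin n) :
    volume (boxCell x ℓ v) ≠ ⊤ := by
  rw [boxCell_eq_pi, volume_pi_pi]
  exact ENNReal.prod_ne_top fun j _ => volume_boxSide_ne_top x ℓ v j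

lemma gap_le_volume_boxSide (ha : IsWindow x ℓ a) (v : Fin n) (j : Fin d) :
    gap x ℓ a v j ≤ volume.real (boxSide x ℓ v j) := by
  have h1 : Set.Ioc (os x ℓ v j ((a v j : ℤ) - par x ℓ v))
      (os x ℓ v j ((a v j : ℤ) + par x ℓ v)) ⊆ boxSide x ℓ v j := fun s hs =>
    (ordConnected_boxSide x ℓ v j).out (os_mem_boxSide x ℓ v j _)
        (os_mem_boxSide x ℓ v j _) ⟨hs.1.le, hs.2⟩
  have h2 := measureReal_mono (μ := volume) h1 (volume_boxSide_ne_top x ℓ v j)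
  rw [Real.volume_real_Ioc_of_le ((ha.lo_le v j).trans (ha.le_hi v j))] at h2
  exact h2

lemma volume_slab (ha : IsWindow x ℓ a) (j : Fin d) (v : Fin n)
    (hpos : 0 < volume.real (boxSide x ℓ v j)) :
    volume.real (slab x ℓ a j v) =
      volume.real (boxCell x ℓ v) * (gap x ℓ a v j / volume.real (boxSide x ℓ v j)) := by
  have h1 : volume.real (Set.Ioc (os x ℓ v j ((a v j : ℤ) - par x ℓ v))
      (os x ℓ v j ((a v j : ℤ) + par x ℓ v))) = gap x ℓ a v j :=
    Real.volume_real_Ioc_of_le ((ha.lo_le v j).trans (ha.le_hi v j))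
  unfold Measure.real at *
  rw [slab_eq_pi, boxCell_eq_pi, volume_pi_pi, volume_pi_pi, ENNReal.toReal_prod,
    ENNReal.toReal_prod, ← Finset.mul_prod_erase _ _ (Finset.mem_univ j),
    ← Finset.mul_prod_erase Finset.univ (fun i => (volume (boxSide x ℓ v i)).toReal)
      (Finset.mem_univ j), Function.update_self, h1]
  have h2 : ∏ i ∈ Finset.univ.erase j, (volume (Function.update (boxSide x ℓ v) j
      (Set.Ioc (os x ℓ v j ((a v j : ℤ) - par x ℓ v))
        (os x ℓ v j ((a v j : ℤ) + par x ℓ v))) i)).toReal =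
      ∏ i ∈ Finset.univ.erase j, (volume (boxSide x ℓ v i)).toReal :=
    Finset.prod_congr rfl fun i hi => by rw [Function.update_of_ne (Finset.ne_of_mem_erase hi)]
  rw [h2]
  field_simp

lemma dist_le_of_mem_boxCell (hℓ : 1 ≤ ℓ) {v : Fin n} {t : Fin d → ℝ} (ht : t ∈ boxCell x ℓ v)
    {r : ℝ} (hr : 0 < r) (hw : ∀ j, segWidth x ℓ j < r) : dist t (x v) < r := by
  rw [dist_pi_lt_iff hr]
  intro j
  have h1 := ht.1 j
  have h2 := self_mem_boxSet x v j
  have h3 := abs_sub_le_of_segIndex_eq hℓ h1.1 h1.2 h2.1 h2.2 (congrFun ht.2 j).symm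
  rw [Real.dist_eq]
  rw [← segWidth_eq] at h3
  exact h3.trans_lt (hw j)

lemma IsInner.gap_pos {j : Fin d} {v : Fin n} (h : IsInner x ℓ a j v)
    (hinj : Function.Injective fun v => x v j) : 0 < gap x ℓ a v j := by
  obtain ⟨e, he, e', he', h1, h2, h3, h4⟩ := h.exists_ends hinj
  unfold gap
  rw [h3, h4, sub_pos, ← not_le, ← rk_le_rk_iff (ℓ := ℓ) (by rw [pts_congr he]; exact he')]
  have := one_le_par x ℓ v
  omega

/-- The estimator is accurate at points of flat cells for which the cell and the slabs have about
the right number of points. -/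
lemma abs_log_densityEst_sub_le {f : (Fin d → ℝ) → ℝ} (hd : 0 < d) (hℓ : 1 ≤ ℓ)
    (ha : IsWindow x ℓ a) (hinj : ∀ j, Function.Injective fun v => x v j) {v : Fin n} {η r : ℝ}
    (hη : 0 < η) (hη2 : η ≤ 1 / 2) (hr : 0 < r) (hw : ∀ j, segWidth x ℓ j < r)
    (hflat : x v ∈ flatSet f η r) (h2 : 2 ≤ cnt x ℓ v) (hin : ∀ j, IsInner x ℓ a j v)
    (hcell : (1 - η) * (n * (densityMeasure f).real (boxCell x ℓ v)) ≤ cnt x ℓ v ∧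
      cnt x ℓ v ≤ (1 + η) * (n * (densityMeasure f).real (boxCell x ℓ v)))
    (hslab : ∀ j, (1 - η) * (n * (densityMeasure f).real (slab x ℓ a j v)) ≤ 2 * par x ℓ v ∧
      2 * par x ℓ v ≤ (1 + η) * (n * (densityMeasure f).real (slab x ℓ a j v))) :
    densityEst x ℓ (x v) ≠ 0 ∧
      |Real.log (densityEst x ℓ (x v)) - Real.log (f (x v))| ≤ 8 * d * η := by
  have hgap : ∀ j, 0 < gap x ℓ a v j := fun j => (hin j).gap_pos (hinj j)
  have hne : densityEst x ℓ (x v) ≠ 0 := densityEst_ne_zero_iff ha h2 hgap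
  refine ⟨hne, ?_⟩
  set F := f (x v) with hF
  have hF0 : 0 < F := hflat.1
  have hnR : (0 : ℝ) < n := by exact_mod_cast Fin.pos v
  have hNR : (0 : ℝ) < cnt x ℓ v := by positivity
  have hmR : (0 : ℝ) < par x ℓ v := by exact_mod_cast one_le_par x ℓ v
  have hσ : ∀ j, 0 < volume.real (boxSide x ℓ v j) := fun j =>
    (hgap j).trans_le (gap_le_volume_boxSide ha v j)
  have hosc : ∀ s ∈ boxCell x ℓ v, |f s - F| ≤ η * F := fun s hs =>
    hflat.2 s (dist_le_of_mem_boxCell hℓ hs hr hw)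
  have hvolA : volume.real (boxCell x ℓ v) = ∏ j, volume.real (boxSide x ℓ v j) := by
    unfold Measure.real; rw [boxCell_eq_pi, volume_pi_pi, ENNReal.toReal_prod]
  have hA0 : 0 < volume.real (boxCell x ℓ v) := by
    rw [hvolA]; exact Finset.prod_pos fun j _ => hσ j
  obtain ⟨hA1, hA2⟩ := densityMeasure_real_bounds hF0 hη.le (by linarith)
    (measurableSet_boxCell x ℓ v) (volume_boxCell_ne_top x ℓ v) hosc
  rw [mul_assoc] at hA1 hA2
  obtain ⟨hμA, hu⟩ := abs_log_div_le (mul_pos hF0 hA0) hη.le hη2 hA1 hA2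
  obtain ⟨_, hla⟩ := abs_log_div_le (mul_pos hnR hμA) hη.le hη2 hcell.1 hcell.2
  rw [Real.log_mul hF0.ne' hA0.ne'] at hu
  rw [Real.log_mul hnR.ne' hμA.ne'] at hla
  -- The volumes of slab and cell differ by the factor `gap / side`. Two errors of `2 η` enter: slab
  -- count against mass, and mass against `F` times volume.
  have hj : ∀ j, |Real.log (2 * (par x ℓ v : ℝ) / (cnt x ℓ v * gap x ℓ a v j)) +
      Real.log (volume.real (boxSide x ℓ v j)) +
      (Real.log (cnt x ℓ v) - Real.log n - Real.log F -
        Real.log (volume.real (boxCell x ℓ v)))| ≤ 4 * η := by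
    intro j
    have hvolS := volume_slab ha j v (hσ j)
    have hS0 : 0 < volume.real (slab x ℓ a j v) := by
      rw [hvolS]; exact mul_pos hA0 (div_pos (hgap j) (hσ j))
    obtain ⟨hS1, hS2⟩ := densityMeasure_real_bounds hF0 hη.le (by linarith)
      (measurableSet_slab x ℓ a j v)
      (ne_top_of_le_ne_top (volume_boxCell_ne_top x ℓ v) (measure_mono fun t ht => ht.1))
      fun s hs => hosc s hs.1
    rw [mul_assoc] at hS1 hS2
    obtain ⟨hμS, huS⟩ := abs_log_div_le (mul_pos hF0 hS0) hη.le hη2 hS1 hS2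
    obtain ⟨_, hlb⟩ := abs_log_div_le (mul_pos hnR hμS) hη.le hη2 (hslab j).1 (hslab j).2
    rw [Real.log_mul hF0.ne' hS0.ne', hvolS, Real.log_mul hA0.ne' (div_pos (hgap j) (hσ j)).ne',
      Real.log_div (hgap j).ne' (hσ j).ne'] at huS
    rw [Real.log_mul hnR.ne' hμS.ne'] at hlb
    rw [Real.log_div (by positivity) (mul_pos hNR (hgap j)).ne',
      Real.log_mul hNR.ne' (hgap j).ne']
    rw [abs_le] at *
    constructor <;> linarith
  rw [log_densityEst ha hne, Real.log_div hNR.ne' hnR.ne']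
  have hsum : ∑ j, (Real.log (2 * (par x ℓ v : ℝ) / (cnt x ℓ v * gap x ℓ a v j)) +
      Real.log (volume.real (boxSide x ℓ v j)) +
      (Real.log (cnt x ℓ v) - Real.log n - Real.log F -
        Real.log (volume.real (boxCell x ℓ v)))) =
      ∑ j, Real.log (2 * (par x ℓ v : ℝ) / (cnt x ℓ v * gap x ℓ a v j)) +
        Real.log (volume.real (boxCell x ℓ v)) +
      d * (Real.log (cnt x ℓ v) - Real.log n - Real.log F -
        Real.log (volume.real (boxCell x ℓ v))) := by
    rw [Finset.sum_add_distrib, Finset.sum_add_distrib, Finset.sum_const, Finset.card_univ,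
      Fintype.card_fin, nsmul_eq_mul, hvolA, Real.log_prod fun j _ => (hσ j).ne']
  have hbound := (Finset.abs_sum_le_sum_abs (fun j =>
    (Real.log (2 * (par x ℓ v : ℝ) / (cnt x ℓ v * gap x ℓ a v j)) +
      Real.log (volume.real (boxSide x ℓ v j)) +
      (Real.log (cnt x ℓ v) - Real.log n - Real.log F -
        Real.log (volume.real (boxCell x ℓ v))))) Finset.univ).trans
    (Finset.sum_le_sum fun j _ => hj j)
  rw [hsum, Finset.sum_const, Finset.card_univ, Fintype.card_fin, nsmul_eq_mul] at hbound
  set S := ∑ j, Real.log (2 * (par x ℓ v : ℝ) / (cnt x ℓ v * gap x ℓ a v j))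
  set z := Real.log (cnt x ℓ v) - Real.log n - Real.log F -
        Real.log (volume.real (boxCell x ℓ v)) with hz
  -- The error of the cell as a histogram. The total error is the sum of the `d` slab errors minus
  -- `(d - 1) z`, hence at most `8 d η`.
  have hz4 : |z| ≤ 4 * η := by
    rw [abs_le] at *; constructor <;> linarith
  have hd1 : (1 : ℝ) ≤ d := by exact_mod_cast hd
  have hdz : |((d : ℝ) - 1) * z| ≤ (d - 1) * (4 * η) := by
    rw [abs_mul, abs_of_nonneg (by linarith)]
    exact mul_le_mul_of_nonneg_left hz4 (by linarith)
  rw [abs_le] at *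
  constructor <;> nlinarith

end

end PSS

namespace PSS

noncomputable section

/-! ### Most contributions to the estimator are accurate -/

section StrongLaw

variable {Ω : Type*} [MeasurableSpace Ω] {P : Measure Ω} {α : Type*} [MeasurableSpace α]
  {μ : Measure α} {X : ℕ → Ω → α}

lemma IsSample.identDistrib_comp (hX : IsSample P μ X) {g : α → ℝ} (hg : Measurable g) (i : ℕ) :
    IdentDistrib (fun ω => g (X i ω)) (fun ω => g (X 0 ω)) P P :=
  (IdentDistrib.mk (hX.meas i).aemeasurable (hX.meas 0).aemeasurable
    ((hX.law i).trans (hX.law 0).symm)).comp hg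

lemma IsSample.indepFun_comp (hX : IsSample P μ X) {g : α → ℝ} (hg : Measurable g) :
    Pairwise fun i j => IndepFun (fun ω => g (X i ω)) (fun ω => g (X j ω)) P :=
  fun _ _ hij => (hX.indep.indepFun hij).comp hg hg

lemma IsSample.integrable_comp (hX : IsSample P μ X) {g : α → ℝ} (hg : Integrable g μ) (i : ℕ) :
    Integrable (fun ω => g (X i ω)) P := by
  rw [← hX.law i] at hg
  exact hg.comp_measurable (hX.meas i)

lemma IsSample.integral_comp (hX : IsSample P μ X) {g : α → ℝ} (hg : Measurable g) (i : ℕ) :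
    ∫ ω, g (X i ω) ∂P = ∫ t, g t ∂μ := by
  rw [← hX.law i, integral_map (hX.meas i).aemeasurable hg.aestronglyMeasurable]

lemma IsSample.ae_tendsto_average (hX : IsSample P μ X) {g : α → ℝ} (hg : Measurable g)
    (hgi : Integrable g μ) :
    ∀ᵐ ω ∂P, Tendsto (fun n : ℕ => (∑ v : Fin n, g (X v ω)) / n) atTop (𝓝 (∫ t, g t ∂μ)) := by
  have h := strong_law_ae_real (fun i ω => g (X i ω)) (hX.integrable_comp hgi 0)
    (hX.indepFun_comp hg) (hX.identDistrib_comp hg)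
  rw [hX.integral_comp hg 0] at h
  filter_upwards [h] with ω hω
  refine hω.congr fun n => ?_
  rw [Finset.sum_range]

lemma ae_pos {d : ℕ} {f : (Fin d → ℝ) → ℝ} {X : ℕ → Ω → Fin d → ℝ} (hf : Measurable f)
    (hX : IsSample P (densityMeasure f) X) :
    ∀ᵐ ω ∂P, ∀ i, 0 < f (X i ω) := by
  rw [ae_all_iff]
  intro i
  have h := ae_pos_densityMeasure hf
  rw [← hX.law i] at h
  exact ae_of_ae_map (hX.meas i).aemeasurable h

end StrongLaw

variable {Ω : Type*} [MeasurableSpace Ω] {P : Measure Ω} [IsProbabilityMeasure P] {d : ℕ}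
  {f : (Fin d → ℝ) → ℝ} {X : ℕ → Ω → Fin d → ℝ} {ℓ : ℕ → ℕ}

/-- Equal coordinates would make a pair potential infinite, whereas it has finite expectation. With
the empty family, `potSum` consists of the pair terms only. -/
lemma ae_injective (hf : Measurable f) (hf0 : ∀ x, 0 ≤ f x)
    [IsProbabilityMeasure (densityMeasure f)] (hX : IsSample P (densityMeasure f) X) :
    ∀ᵐ ω ∂P, ∀ (n : ℕ) (j : Fin d), Function.Injective fun v : Fin n => X v ω j := by
  have h1 : ∀ᵐ ω ∂P, ∀ n : ℕ, potSum f 1 n ∅ (fun v => X v ω) < ⊤ := by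
    rw [ae_all_iff]
    intro n
    refine ae_lt_top ((measurable_potSum hf 1 n ∅).comp (hX.measurable_fin n)) ?_
    change ∫⁻ ω, potSum f 1 n ∅ (fun v => X v ω) ∂P ≠ ⊤
    rw [hX.lintegral_fin (measurable_potSum hf 1 n ∅)]
    exact ne_top_of_le_ne_top ENNReal.ofReal_ne_top (lintegral_potSum_le hf hf0 1 n ∅)
  filter_upwards [h1, ae_pos hf hX] with ω hω hpos
  intro n j u v huv
  by_contra hne
  have h2 : n * potential f 1 j {u} (X v ω) (fun v : Fin n => X v ω) ≠ ⊤ :=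
    ne_top_of_le_ne_top (hω n).ne
      (pair_potential_le_potSum f 1 ∅ (fun v : Fin n => X v ω) hne j)
  exact ne_of_potential_singleton (x := fun v : Fin n => X v ω) (hpos v) h2 huv

/-- The bound holds for all small index sets at once, so it can be applied to a set that itself
depends on the sample. -/
lemma ae_eventually_potSum_le (hf : Measurable f) (hf0 : ∀ x, 0 ≤ f x)
    [IsProbabilityMeasure (densityMeasure f)] (hX : IsSample P (densityMeasure f) X) (ℓ : ℕ → ℕ)
    {η : ℝ} (hη : 0 < η) :
    ∃ ε > 0, ∀ᵐ ω ∂P, ∀ᶠ n : ℕ in atTop,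
      potSum f (ℓ n) n {B | (B.card : ℝ) ≤ ε * n} (fun v => X v ω) ≤
        ENNReal.ofReal (Real.exp (η * n)) := by
  obtain ⟨ε, hε, h⟩ := exists_sum_pow_card_le (a := 5) (by norm_num) (half_pos hη)
  refine ⟨ε, hε, hX.ae_eventually_le_exp (fun n => potSum f (ℓ n) n {B | (B.card : ℝ) ≤ ε * n})
    (fun n => measurable_potSum hf _ n _) (K := d + 5 * d * (6 * (2 / η) ^ 3)) hη fun n => ?_⟩
  refine (lintegral_potSum_le hf hf0 (ℓ n) n _).trans (ENNReal.ofReal_le_ofReal ?_)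
  have h1 : (n : ℝ) ^ 3 ≤ 6 * (2 / η) ^ 3 * Real.exp (η / 2 * n) := by
    have h2 := Real.pow_div_factorial_le_exp (η / 2 * n) (by positivity) 3
    have h3 : (n : ℝ) ^ 3 = 6 * (2 / η) ^ 3 * ((η / 2 * n) ^ 3 / (Nat.factorial 3 : ℕ)) := by
      have : (Nat.factorial 3 : ℕ) = 6 := rfl
      rw [this]; field_simp; norm_num
    rw [h3]
    gcongr
  have h4 := h n
  calc (d : ℝ) * ∑ B : Finset (Fin n) with (B.card : ℝ) ≤ ε * n, (5 : ℝ) ^ B.card + 5 * d * n ^ 3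
      ≤ d * Real.exp (η / 2 * n) + 5 * d * (6 * (2 / η) ^ 3 * Real.exp (η / 2 * n)) := by gcongr
    _ = _ := by ring

lemma eventually_mul_pow_le (hℓo : (fun n => (ℓ n : ℝ) ^ d) =o[atTop] (fun n => (n : ℝ))) (M : ℕ)
    {t : ℝ} (ht : 0 < t) : ∀ᶠ n : ℕ in atTop, ((M * ℓ n ^ d : ℕ) : ℝ) ≤ t * n := by
  filter_upwards [hℓo.def (show 0 < t / (M + 1) by positivity)] with n hn
  rw [Real.norm_of_nonneg (by positivity), Real.norm_of_nonneg (by positivity)] at hn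
  push_cast
  calc (M : ℝ) * (ℓ n : ℝ) ^ d ≤ (M + 1) * (t / (M + 1) * n) := by gcongr; linarith
    _ = t * n := by field_simp

lemma eventually_segWidth_lt {x : ∀ n : ℕ, Fin n → Fin d → ℝ}
    (h : ∀ j : Fin d, Tendsto (fun n => segWidth (x n) (ℓ n) j) atTop (𝓝 0)) {r : ℝ}
    (hr : 0 < r) : ∀ᶠ n in atTop, ∀ j, segWidth (x n) (ℓ n) j < r :=
  eventually_all.2 fun j => (h j).eventually_lt_const hr

/-- For most sample points, the logarithm of the estimator is close to that of the density. -/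
lemma ae_eventually_good (hd : 0 < d) (hf : Measurable f) (hf0 : ∀ x, 0 ≤ f x)
    [IsProbabilityMeasure (densityMeasure f)]
    (hcont : ∀ᵐ x ∂(volume : Measure (Fin d → ℝ)), ContinuousAt f x)
    (hX : IsSample P (densityMeasure f) X) (hℓ : ∀ n, 1 ≤ ℓ n)
    (hℓo : (fun n => (ℓ n : ℝ) ^ d) =o[atTop] (fun n => (n : ℝ)))
    (hmesh : ∀ᵐ ω ∂P, ∀ j : Fin d,
      Tendsto (fun n => segWidth (fun v : Fin n => X v ω) (ℓ n) j) atTop (𝓝 0))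
    {η τ : ℝ} (hη : 0 < η) (hη2 : η ≤ 1 / 2) (hτ : 0 < τ) :
    ∀ᵐ ω ∂P, ∀ᶠ n : ℕ in atTop, ∃ B : Finset (Fin n), (B.card : ℝ) ≤ τ * n ∧ ∀ v ∉ B,
      densityEst (fun v : Fin n => X v ω) (ℓ n) (X v ω) ≠ 0 ∧
      |Real.log (densityEst (fun v : Fin n => X v ω) (ℓ n) (X v ω)) - Real.log (f (X v ω))| ≤
        8 * d * η := by
  classical
  set μ := densityMeasure f with hμ
  -- Each of the four exceptional sets not attached to a direction, and each of the three attached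
  -- to every direction, may have at most `t n` points.
  set t : ℝ := τ / (4 + 3 * d) with ht
  have ht0 : 0 < t := by positivity
  -- Makes the bound `8 / η * (4 s n)` for points with wrong counts at most `t n`.
  set s : ℝ := min 1 (t * η / 32) with hs
  have hs0 : 0 < s := lt_min one_pos (by positivity)
  obtain ⟨ε, hε, hdev⟩ := hX.ae_eventually_union_deviation ℓ hs0 (min_le_left _ _)
  obtain ⟨r, hr, hflat⟩ := exists_flatSet_compl_lt hf hcont hη ht0
  -- `1 / ε` keeps disjoint families small; `8 / t` makes the windows affected by the border of a
  -- large cell rare.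
  set K : ℝ := max 1 (max (1 / ε) (8 / t)) with hK
  have hK1 : 1 ≤ K := le_max_left _ _
  have hKε : 1 ≤ K * ε := by
    have : 1 / ε ≤ K := (le_max_left _ _).trans (le_max_right _ _)
    rwa [div_le_iff₀ hε] at this
  have hKt : 8 / K ≤ t := by
    have : 8 / t ≤ K := (le_max_right _ _).trans (le_max_right _ _)
    rw [div_le_iff₀ ht0] at this
    rw [div_le_iff₀ (by positivity)]; linarith
  set M : ℕ := ⌈K ^ 2⌉₊ + 2 with hM
  have hflatm := measurableSet_flatSet hf η r
  have hSLLN := hX.ae_tendsto_average (g := (flatSet f η r)ᶜ.indicator 1)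
    (measurable_one.indicator hflatm.compl) ((integrable_const (1 : ℝ)).indicator hflatm.compl)
  filter_upwards [hdev, hSLLN, hmesh, ae_injective hf hf0 hX] with ω hω1 hω2 hω3 hinj
  rw [integral_indicator_one hflatm.compl] at hω2
  filter_upwards [hω1, hω2.eventually_lt_const hflat, eventually_segWidth_lt hω3 hr,
    eventually_mul_pow_le hℓo M ht0, eventually_gt_atTop 0] with n hn1 hn2 hn3 hn4 hn0
  have hnR : (0 : ℝ) < n := by exact_mod_cast hn0
  set x : Fin n → Fin d → ℝ := fun v => X v ω with hx
  obtain ⟨a, ha⟩ := exists_isWindow x (ℓ n)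
  have hκ : 8 / η * (4 * s * n) ≤ t * n := by
    have h1 : s ≤ t * η / 32 := min_le_right _ _
    calc 8 / η * (4 * s * n) ≤ 8 / η * (4 * (t * η / 32) * n) := by gcongr
      _ = t * n := by field_simp; norm_num
  have hbig : ∀ v, M < cnt x (ℓ n) v → K ^ 2 ≤ cnt x (ℓ n) v := by
    intro v hv
    refine (Nat.le_ceil _).trans ?_
    exact_mod_cast (show ⌈K ^ 2⌉₊ ≤ cnt x (ℓ n) v by omega)
  have hbig' : ∀ v, M < cnt x (ℓ n) v → K ≤ cnt x (ℓ n) v := fun v hv => by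
    have := hbig v hv; nlinarith
  have hbig2 : ∀ v, M < cnt x (ℓ n) v → K ≤ 2 * par x (ℓ n) v := fun v hv => by
    have h1 : K ≤ √(cnt x (ℓ n) v) := Real.le_sqrt_of_sq_le (hbig v hv)
    have h2 : √(cnt x (ℓ n) v : ℝ) < par x (ℓ n) v + 1 / 2 := sqrt_lt_spacingParam _
    linarith
  set B1 : Finset (Fin n) := Finset.univ.filter fun v => x v ∉ flatSet f η r with hB1
  set B2 : Finset (Fin n) := Finset.univ.filter fun v => cnt x (ℓ n) v ≤ M with hB2
  set B3 : Fin d → Finset (Fin n) := fun j => Finset.univ.filter fun v =>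
    M < cnt x (ℓ n) v ∧ ¬ IsInner x (ℓ n) a j v with hB3
  set B4 : Finset (Fin n) := Finset.univ.filter fun v => M < cnt x (ℓ n) v ∧
    (1 + η) * (n * μ.real (boxCell x (ℓ n) v)) ≤ cnt x (ℓ n) v with hB4
  set B5 : Finset (Fin n) := Finset.univ.filter fun v => M < cnt x (ℓ n) v ∧
    cnt x (ℓ n) v ≤ (1 - η) * (n * μ.real (boxCell x (ℓ n) v)) with hB5
  set B6 : Fin d → Finset (Fin n) := fun j => Finset.univ.filter fun v => M < cnt x (ℓ n) v ∧
    IsInner x (ℓ n) a j v ∧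
    (1 + η) * (n * μ.real (slab x (ℓ n) a j v)) ≤ 2 * par x (ℓ n) v with hB6
  set B7 : Fin d → Finset (Fin n) := fun j => Finset.univ.filter fun v => M < cnt x (ℓ n) v ∧
    IsInner x (ℓ n) a j v ∧
    2 * par x (ℓ n) v ≤ (1 - η) * (n * μ.real (slab x (ℓ n) a j v)) with hB7
  have c1 : (B1.card : ℝ) ≤ t * n := by
    rw [div_lt_iff₀ hnR] at hn2
    refine le_trans (le_of_eq ?_) hn2.le
    exact (empCount_eq_card x (flatSet f η r)ᶜ).symm
  have c2 : (B2.card : ℝ) ≤ t * n := by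
    refine le_trans ?_ hn4
    exact_mod_cast card_small_le (hℓ n) B2 fun v hv => (Finset.mem_filter.1 hv).2
  have c3 : ∀ j, ((B3 j).card : ℝ) ≤ t * n := by
    intro j
    refine (card_not_isInner_le ha j (hinj n j) (show 0 < K by linarith) (B3 j)
      fun v hv => ?_).trans (by gcongr)
    obtain ⟨_, h1, h2⟩ := Finset.mem_filter.1 hv
    exact ⟨hbig v h1, h2⟩
  have c4 : (B4.card : ℝ) ≤ t * n := by
    refine (card_badCell_le μ B4 hKε (fun v hv => hbig' v (Finset.mem_filter.1 hv).2.1) hε hη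
      (by linarith) (fun E₁ hE₁ => (hn1 E₁ E₁ hE₁ hE₁).1)
      (Or.inl fun v hv => (Finset.mem_filter.1 hv).2.2)).trans hκ
  have c5 : (B5.card : ℝ) ≤ t * n := by
    refine (card_badCell_le μ B5 hKε (fun v hv => hbig' v (Finset.mem_filter.1 hv).2.1) hε hη
      (by linarith) (fun E₁ hE₁ => (hn1 E₁ E₁ hE₁ hE₁).1)
      (Or.inr fun v hv => (Finset.mem_filter.1 hv).2.2)).trans hκ
  have c6 : ∀ j, ((B6 j).card : ℝ) ≤ t * n := by
    intro j
    refine (card_badSlab_le μ ha j (hinj n j) (B6 j) hKε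
      (fun v hv => hbig2 v (Finset.mem_filter.1 hv).2.1) hε hη (by linarith)
      (fun v hv => (Finset.mem_filter.1 hv).2.2.1)
      (fun E₁ E₂ hE₁ hE₂ => (hn1 E₁ E₂ hE₁ hE₂).2 j)
      (Or.inl fun v hv => (Finset.mem_filter.1 hv).2.2.2)).trans hκ
  have c7 : ∀ j, ((B7 j).card : ℝ) ≤ t * n := by
    intro j
    refine (card_badSlab_le μ ha j (hinj n j) (B7 j) hKε
      (fun v hv => hbig2 v (Finset.mem_filter.1 hv).2.1) hε hη (by linarith)
      (fun v hv => (Finset.mem_filter.1 hv).2.2.1)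
      (fun E₁ E₂ hE₁ hE₂ => (hn1 E₁ E₂ hE₁ hE₂).2 j)
      (Or.inr fun v hv => (Finset.mem_filter.1 hv).2.2.2)).trans hκ
  have hbi : ∀ B : Fin d → Finset (Fin n), (∀ j, ((B j).card : ℝ) ≤ t * n) →
      ((Finset.univ.biUnion B).card : ℝ) ≤ d * (t * n) := by
    intro B hB
    have h1 : ((Finset.univ.biUnion B).card : ℝ) ≤ ∑ j, ((B j).card : ℝ) := by
      exact_mod_cast Finset.card_biUnion_le
    refine h1.trans ((Finset.sum_le_sum fun j _ => hB j).trans (le_of_eq ?_))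
    simp
  refine ⟨B1 ∪ (B2 ∪ (B4 ∪ (B5 ∪ (Finset.univ.biUnion B3 ∪
    (Finset.univ.biUnion B6 ∪ Finset.univ.biUnion B7))))), ?_, fun v hv => ?_⟩
  · have hu : ∀ A B : Finset (Fin n), ((A ∪ B).card : ℝ) ≤ A.card + B.card := fun A B => by
      exact_mod_cast Finset.card_union_le A B
    have h3 := hbi B3 c3
    have h6 := hbi B6 c6
    have h7 := hbi B7 c7
    have e1 := hu B1 (B2 ∪ (B4 ∪ (B5 ∪ (Finset.univ.biUnion B3 ∪
      (Finset.univ.biUnion B6 ∪ Finset.univ.biUnion B7)))))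
    have e2 := hu B2 (B4 ∪ (B5 ∪ (Finset.univ.biUnion B3 ∪
      (Finset.univ.biUnion B6 ∪ Finset.univ.biUnion B7))))
    have e3 := hu B4 (B5 ∪ (Finset.univ.biUnion B3 ∪
      (Finset.univ.biUnion B6 ∪ Finset.univ.biUnion B7)))
    have e4 := hu B5 (Finset.univ.biUnion B3 ∪
      (Finset.univ.biUnion B6 ∪ Finset.univ.biUnion B7))
    have e5 := hu (Finset.univ.biUnion B3) (Finset.univ.biUnion B6 ∪ Finset.univ.biUnion B7)
    have e6 := hu (Finset.univ.biUnion B6) (Finset.univ.biUnion B7)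
    have e7 : τ * n = 4 * (t * n) + 3 * (d * (t * n)) := by rw [ht]; field_simp
    linarith
  · simp only [Finset.mem_union, Finset.mem_biUnion, Finset.mem_univ, true_and, not_or, not_exists,
      hB1, hB2, hB3, hB4, hB5, hB6, hB7, Finset.mem_filter, not_and, not_not, not_le] at hv
    obtain ⟨v1, v2, v4, v5, v3, v6, v7⟩ := hv
    have hin : ∀ j, IsInner x (ℓ n) a j v := fun j => v3 j v2
    refine abs_log_densityEst_sub_le hd (hℓ n) ha (hinj n) hη hη2 hr hn3 v1 (by omega) hin
      ⟨(v5 v2).le, (v4 v2).le⟩ fun j => ⟨(v7 j v2 (hin j)).le, (v6 j v2 (hin j)).le⟩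

end

end PSS

namespace PSS

noncomputable section

/-! ### Almost sure convergence -/

lemma exists_integral_indicator_lt {α : Type*} [MeasurableSpace α] {μ : Measure α} {g : α → ℝ}
    (hg : Measurable g) (hgi : Integrable g μ) {η : ℝ} (hη : 0 < η) :
    ∃ K : ℕ, ∫ t, {t | (K : ℝ) < g t}.indicator g t ∂μ < η := by
  have h : Tendsto (fun K : ℕ => ∫ t, {t | (K : ℝ) < g t}.indicator g t ∂μ) atTop
      (𝓝 (∫ _, (0 : ℝ) ∂μ)) := by
    refine tendsto_integral_of_dominated_convergence (fun t => |g t|)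
      (fun K => (hg.indicator (measurableSet_lt measurable_const hg)).aestronglyMeasurable)
      hgi.abs (fun K => Eventually.of_forall fun t => ?_) (Eventually.of_forall fun t => ?_)
    · exact norm_indicator_le_norm_self g t
    · refine tendsto_const_nhds.congr' ?_
      filter_upwards [eventually_ge_atTop ⌈g t⌉₊] with K hK
      rw [Set.indicator_of_notMem]
      exact not_lt.2 ((Nat.le_ceil (g t)).trans (by exact_mod_cast hK))
  rw [integral_zero] at h
  exact (h.eventually_lt_const hη).exists

/-- The sums of an integrable function over few sample points are small. -/
lemma IsSample.ae_eventually_sum_le {Ω : Type*} [MeasurableSpace Ω] {P : Measure Ω}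
    {α : Type*} [MeasurableSpace α] {μ : Measure α} {X : ℕ → Ω → α} (hX : IsSample P μ X)
    {g : α → ℝ} (hg : Measurable g) (hgi : Integrable g μ) {η : ℝ} (hη : 0 < η) :
    ∃ ε > 0, ∀ᵐ ω ∂P, ∀ᶠ n : ℕ in atTop, ∀ B : Finset (Fin n), (B.card : ℝ) ≤ ε * n →
      ∑ v ∈ B, g (X v ω) ≤ η * n := by
  obtain ⟨K, hK⟩ := exists_integral_indicator_lt hg hgi (half_pos hη)
  have hm : MeasurableSet {t | (K : ℝ) < g t} := measurableSet_lt measurable_const hg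
  -- Few points contribute little below the truncation level `K`; above it the whole sample average
  -- is already less than `η / 2`.
  refine ⟨η / (2 * (K + 1)), by positivity, ?_⟩
  filter_upwards [hX.ae_tendsto_average (hg.indicator hm) (hgi.indicator hm)] with ω hω
  filter_upwards [hω.eventually_lt_const hK, eventually_gt_atTop 0] with n hn hn0
  intro B hB
  rw [div_lt_iff₀ (by exact_mod_cast hn0)] at hn
  have h1 : ∀ t, g t ≤ K + {t | (K : ℝ) < g t}.indicator g t := by
    intro t
    by_cases ht : (K : ℝ) < g t
    · rw [Set.indicator_of_mem (show t ∈ {t | (K : ℝ) < g t} from ht)]; simp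
    · rw [Set.indicator_of_notMem (show t ∉ {t | (K : ℝ) < g t} from ht)]; linarith [not_lt.1 ht]
  have h2 : ∀ t, 0 ≤ {t | (K : ℝ) < g t}.indicator g t := fun t =>
    Set.indicator_apply_nonneg fun ht =>
      (Nat.cast_nonneg K).trans (le_of_lt (show (K : ℝ) < g t from ht))
  calc ∑ v ∈ B, g (X v ω) ≤ ∑ v ∈ B, ((K : ℝ) + {t | (K : ℝ) < g t}.indicator g (X v ω)) :=
        Finset.sum_le_sum fun v _ => h1 _
    _ = B.card * K + ∑ v ∈ B, {t | (K : ℝ) < g t}.indicator g (X v ω) := by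
        rw [Finset.sum_add_distrib, Finset.sum_const, nsmul_eq_mul]
    _ ≤ η / (2 * (K + 1)) * n * (K + 1) + ∑ v : Fin n, {t | (K : ℝ) < g t}.indicator g (X v ω) := by
        refine add_le_add (mul_le_mul hB (by linarith) (by positivity) (by positivity)) ?_
        exact Finset.sum_le_sum_of_subset_of_nonneg (Finset.subset_univ _) fun v _ _ => h2 _
    _ ≤ η / 2 * n + η / 2 * n := by
        refine add_le_add (le_of_eq ?_) hn.le
        field_simp
    _ = η * n := by ring

/-- If `g (X n) ≤ n + 1` eventually, almost surely, then `g` is integrable. -/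
lemma IsSample.lintegral_lt_top {Ω : Type*} [MeasurableSpace Ω] {P : Measure Ω}
    [IsProbabilityMeasure P] {α : Type*} [MeasurableSpace α] {μ : Measure α}
    [IsProbabilityMeasure μ] {X : ℕ → Ω → α} (hX : IsSample P μ X) {g : α → ℝ}
    (hg : Measurable g) (h : ∀ᵐ ω ∂P, ∀ᶠ n : ℕ in atTop, g (X n ω) ≤ n + 1) :
    ∫⁻ t, ENNReal.ofReal (g t) ∂μ < ⊤ := by
  set A : ℕ → Set α := fun n => {t | (n : ℝ) + 1 < g t} with hA
  have hAm : ∀ n, MeasurableSet (A n) := fun n => measurableSet_lt measurable_const hg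
  set s : ℕ → Set Ω := fun n => X n ⁻¹' A n with hs
  have hPs : ∀ n, P (s n) = μ (A n) := fun n => by
    rw [← hX.law n, Measure.map_apply (hX.meas n) (hAm n)]
  have hsum : ∑' n, P (s n) ≠ ⊤ := by
    intro htop
    have hind : iIndepSet s P := by
      rw [iIndepSet_iff_meas_biInter fun n => hX.meas n (hAm n)]
      intro S
      exact hX.indep.measure_inter_preimage_eq_mul S fun i _ => hAm i
    have h1 := measure_limsup_eq_one (fun n => hX.meas n (hAm n)) hind htop
    have h2 : P (limsup s atTop) = 0 := by
      rw [measure_eq_zero_iff_ae_notMem]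
      filter_upwards [h] with ω hω hmem
      rw [mem_limsup_iff_frequently_mem] at hmem
      obtain ⟨n, hn1, hn2⟩ := (hmem.and_eventually hω).exists
      exact absurd hn2 (not_le.2 hn1)
    rw [h2] at h1
    exact zero_ne_one h1
  -- Layer-cake comparison: up to an additive 2, `g` is at most the number of levels `n + 1` below
  -- it.
  have hle : ∀ t, ENNReal.ofReal (g t) ≤ 2 + ∑' n, (A n).indicator 1 t := by
    intro t
    have h1 : ((⌊g t⌋₊ - 1 : ℕ) : ℝ≥0∞) ≤ ∑' n, (A n).indicator (1 : α → ℝ≥0∞) t := by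
      refine le_trans (le_of_eq ?_) (ENNReal.sum_le_tsum (Finset.range (⌊g t⌋₊ - 1)))
      have h3 : ∀ n ∈ Finset.range (⌊g t⌋₊ - 1), (A n).indicator (1 : α → ℝ≥0∞) t = 1 := by
        intro n hn
        rw [Finset.mem_range] at hn
        have h2 : t ∈ A n := by
          change (n : ℝ) + 1 < g t
          exact_mod_cast Nat.lt_of_lt_floor (show n + 1 < ⌊g t⌋₊ by omega)
        rw [Set.indicator_of_mem h2]; rfl
      rw [Finset.sum_congr rfl h3]; simp
    have h2 : g t ≤ 2 + (⌊g t⌋₊ - 1 : ℕ) := by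
      have h3 := Nat.lt_floor_add_one (g t)
      have h4 : ⌊g t⌋₊ ≤ (⌊g t⌋₊ - 1 : ℕ) + 1 := by omega
      have h5 : (⌊g t⌋₊ : ℝ) ≤ (⌊g t⌋₊ - 1 : ℕ) + 1 := by exact_mod_cast h4
      linarith
    calc ENNReal.ofReal (g t) ≤ ENNReal.ofReal (2 + (⌊g t⌋₊ - 1 : ℕ)) := ENNReal.ofReal_le_ofReal h2
      _ = 2 + ((⌊g t⌋₊ - 1 : ℕ) : ℝ≥0∞) := by
          rw [ENNReal.ofReal_add zero_le_two (by positivity), ENNReal.ofReal_natCast]; norm_num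
      _ ≤ _ := by gcongr
  refine (lintegral_mono hle).trans_lt ?_
  rw [lintegral_add_left measurable_const, lintegral_tsum fun n =>
    (measurable_one.indicator (hAm n)).aemeasurable]
  simp only [lintegral_const, measure_univ, mul_one, lintegral_indicator_one (hAm _)]
  simp only [← hPs]
  exact ENNReal.add_lt_top.2 ⟨by norm_num, hsum.lt_top⟩

variable {d : ℕ} {f : (Fin d → ℝ) → ℝ} {ℓ : ℕ → ℕ}

lemma abs_sub_le_mul_segWidth {n : ℕ} (x : Fin n → Fin d → ℝ) {l : ℕ} (hl : 1 ≤ l) (u v : Fin n)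
    (j : Fin d) : |x u j - x v j| ≤ l * segWidth x l j := by
  have h1 := self_mem_boxSet x u j
  have h2 := self_mem_boxSet x v j
  have : (0 : ℝ) < l := by exact_mod_cast hl
  rw [segWidth_eq, mul_div_cancel₀ _ this.ne', abs_le]
  constructor <;> linarith

/-! ### A moment condition implied by the shrinking mesh -/

section Moment

variable {Ω : Type*} [MeasurableSpace Ω] {P : Measure Ω} [IsProbabilityMeasure P]
  {X : ℕ → Ω → Fin d → ℝ}

/-- Shrinking partitions force a moment condition. -/
lemma integrable_pow_abs [IsProbabilityMeasure (densityMeasure f)]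
    (hX : IsSample P (densityMeasure f) X) (hℓ : ∀ n, 1 ≤ ℓ n)
    (hℓo : (fun n => (ℓ n : ℝ) ^ d) =o[atTop] (fun n => (n : ℝ)))
    (hmesh : ∀ᵐ ω ∂P, ∀ j : Fin d,
      Tendsto (fun n => segWidth (fun v : Fin n => X v ω) (ℓ n) j) atTop (𝓝 0)) (j : Fin d) :
    Integrable (fun t : Fin d → ℝ => |t j| ^ d) (densityMeasure f) := by
  have hm : Measurable fun t : Fin d → ℝ => |t j| ^ d := (measurable_pi_apply j).abs.pow_const d
  have h : ∀ᵐ ω ∂P, ∀ᶠ n : ℕ in atTop, |X n ω j| ^ d / 2 ^ d ≤ (n : ℝ) + 1 := by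
    filter_upwards [hmesh] with ω hω
    have h1 := (eventually_segWidth_lt hω one_pos)
    have h2 := eventually_mul_pow_le hℓo 1 one_pos
    have h3 := (tendsto_add_atTop_nat 1).eventually h1
    have h4 := (tendsto_add_atTop_nat 1).eventually h2
    filter_upwards [h3, h4, tendsto_natCast_atTop_atTop.eventually_ge_atTop (|X 0 ω j| ^ d)]
      with n h5 h6 h7
    -- The newest point is within the range of the sample, `ℓ` times the mesh, of the first point.
    -- With mesh below 1 and `ℓ ^ d ≤ n + 1`, its `d`-th power is eventually at most a multiple of
    -- `n + 1`.
    have h8 := abs_sub_le_mul_segWidth (fun v : Fin (n + 1) => X v ω) (hℓ (n + 1)) (Fin.last n) 0 j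
    simp only [Fin.val_last, Fin.val_zero] at h8
    have hℓ0 : (0 : ℝ) ≤ ℓ (n + 1) := by positivity
    have h9 : |X n ω j| ≤ |X 0 ω j| + ℓ (n + 1) := by
      have h10 := abs_sub_abs_le_abs_sub (X n ω j) (X 0 ω j)
      nlinarith [h5 j]
    set q := max |X 0 ω j| (ℓ (n + 1)) with hq
    have hq0 : 0 ≤ q := hℓ0.trans (le_max_right _ _)
    have h10 : |X n ω j| ≤ 2 * q := by
      have := le_max_left |X 0 ω j| (ℓ (n + 1) : ℝ)
      have := le_max_right |X 0 ω j| (ℓ (n + 1) : ℝ)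
      linarith
    have h11 : q ^ d ≤ n + 1 := by
      push_cast at h6
      rcases max_choice |X 0 ω j| (ℓ (n + 1) : ℝ) with h | h <;> rw [hq, h] <;> linarith
    rw [div_le_iff₀ (by positivity)]
    calc |X n ω j| ^ d ≤ (2 * q) ^ d := by gcongr
      _ = q ^ d * 2 ^ d := by rw [mul_pow]; ring
      _ ≤ _ := by gcongr
  have h1 := hX.lintegral_lt_top (g := fun t => |t j| ^ d / 2 ^ d) (hm.div_const _) h
  have h2 : Integrable (fun t : Fin d → ℝ => |t j| ^ d / 2 ^ d) (densityMeasure f) := by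
    refine ⟨(hm.div_const _).aestronglyMeasurable, ?_⟩
    rw [hasFiniteIntegral_iff_ofReal (Eventually.of_forall fun t => by positivity)]
    exact h1
  refine (h2.mul_const (2 ^ d)).congr (Eventually.of_forall fun t => ?_)
  change |t j| ^ d / 2 ^ d * 2 ^ d = |t j| ^ d
  field_simp

end Moment

lemma log_one_add_le_one_add_pow (hd : 0 < d) {s : ℝ} (hs : 0 ≤ s) :
    Real.log (1 + s) ≤ 1 + s ^ d := by
  have h1 := Real.log_le_sub_one_of_pos (show 0 < 1 + s by linarith)
  rcases le_total s 1 with h | h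
  · have : 0 ≤ s ^ d := by positivity
    linarith
  · have := le_self_pow₀ h hd.ne'
    linarith

lemma measurable_domFun (hf : Measurable f) : Measurable (domFun f) := by
  unfold domFun
  have h1 : Measurable fun t => |Real.log (f t)| := hf.log.abs
  exact h1.add (Finset.measurable_sum _ fun j _ =>
    (((measurable_pi_apply j).abs.const_add 1).log).const_mul 2)

lemma integrable_domFun (hd : 0 < d) [IsProbabilityMeasure (densityMeasure f)]
    (hlog : Integrable (fun t => Real.log (f t)) (densityMeasure f))
    (hpow : ∀ j : Fin d, Integrable (fun t : Fin d → ℝ => |t j| ^ d) (densityMeasure f)) :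
    Integrable (domFun f) (densityMeasure f) := by
  refine hlog.abs.add (integrable_finsetSum _ fun j _ => Integrable.const_mul ?_ 2)
  refine ((integrable_const 1).add (hpow j)).mono'
    (((measurable_pi_apply j).abs.const_add 1).log).aestronglyMeasurable
    (Eventually.of_forall fun t => ?_)
  rw [Real.norm_of_nonneg (log_one_add_abs_nonneg _)]
  exact log_one_add_le_one_add_pow hd (abs_nonneg _)

/-- A sample point counted in the estimator contributes the logarithm of the estimated density,
and the other ones contribute nothing. -/
def logEst {n : ℕ} (x : Fin n → Fin d → ℝ) (l : ℕ) (v : Fin n) : ℝ :=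
  if densityEst x l (x v) = 0 then 0 else Real.log (densityEst x l (x v))

lemma sum_logEst_eq {n : ℕ} (x : Fin n → Fin d → ℝ) (l : ℕ) (B : Finset (Fin n)) :
    ∑ v ∈ B, logEst x l v =
      ∑ v ∈ B with densityEst x l (x v) ≠ 0, Real.log (densityEst x l (x v)) := by
  rw [Finset.sum_filter]
  refine Finset.sum_congr rfl fun v _ => ?_
  unfold logEst
  split_ifs <;> first | rfl | contradiction

/-- The deterministic core: outside `B` the terms are compared one by one, on `B` the sums of `log
f̂` and of `log f` are each small. The parameter `c` comes from the tangent inequality and is free.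
-/
lemma abs_sum_logEst_sub_le (hd : 0 < d) {n l : ℕ} {x : Fin n → Fin d → ℝ} (hl : 1 ≤ l)
    (hinj : ∀ j, Function.Injective fun v => x v j) (hpos : ∀ v, 0 < f (x v))
    {B : Finset (Fin n)} {δ η ε c : ℝ} (hη : 0 ≤ η) (hc : 1 ≤ c)
    (hδ : 0 ≤ δ)
    (hgood : ∀ v ∉ B, densityEst x l (x v) ≠ 0 ∧
      |Real.log (densityEst x l (x v)) - Real.log (f (x v))| ≤ δ)
    (hBε : (B.card : ℝ) ≤ ε * n) (hdom : ∑ v ∈ B, domFun f (x v) ≤ η * n)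
    (hpot : ∀ B' ⊆ B, ∀ j, ∏ v ∈ B', potential f l j B'ᶜ (x v) x ≤
      ENNReal.ofReal (Real.exp (η * n)))
    (hpair : ∀ u v, u ≠ v → ∀ j, n * potential f 1 j {u} (x v) x ≤
      ENNReal.ofReal (Real.exp (η * n)))
    (hw : ∀ j, segWidth x l j < 1) :
    |∑ v, logEst x l v - ∑ v, Real.log (f (x v))| ≤
      (δ + (4 * d ^ 2 + 8 * d + 2) * η + (4 * d ^ 2 + 14 * d) * ε + (3 * d + 1) * (ε * Real.log c) +
        ((2 * d + 1) * Real.pi ^ d + 2 * d) / c) * n := by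
  classical
  set B' := B.filter fun v => densityEst x l (x v) ≠ 0 with hB'
  have hB'B : B' ⊆ B := Finset.filter_subset _ _
  have hB'0 : ∀ v ∈ B', densityEst x l (x v) ≠ 0 := fun v hv => (Finset.mem_filter.1 hv).2
  have hlogc : 0 ≤ Real.log c := Real.log_nonneg hc
  have hB'ε : (B'.card : ℝ) ≤ ε * n := le_trans (by exact_mod_cast Finset.card_le_card hB'B) hBε
  have hcl : (B'.card : ℝ) * Real.log c ≤ ε * n * Real.log c := by gcongr
  have hdom' : ∑ v ∈ B', domFun f (x v) ≤ η * n :=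
    (Finset.sum_le_sum_of_subset_of_nonneg hB'B fun _ _ _ => domFun_nonneg f _).trans hdom
  have hup := sum_log_densityEst_le hd hinj B' hB'0 hpos (L := η * n) (by positivity)
    (fun C hC => hpot C (hC.trans hB'B)) hpair hc
  have hlo := neg_le_sum_log_densityEst hl hinj B' hB'0 hc
  have hup' : ∑ v ∈ B', (4 * d * domFun f (x v) + 12 * d + 4 * d ^ 2) ≤
      4 * d * (η * n) + (12 * d + 4 * d ^ 2) * (ε * n) := by
    simp only [add_assoc]
    rw [Finset.sum_add_distrib, ← Finset.mul_sum, Finset.sum_const, nsmul_eq_mul]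
    refine add_le_add (by gcongr) ?_
    rw [mul_comm]
    gcongr
  have hlo' : ∑ v ∈ B', ∑ j, (2 * Real.log (1 + |x v j|) + 2 * Real.log (1 + segWidth x l j)) ≤
      η * n + 2 * d * (ε * n) := by
    have h1 : ∀ v ∈ B', ∑ j, (2 * Real.log (1 + |x v j|) + 2 * Real.log (1 + segWidth x l j)) ≤
        domFun f (x v) + 2 * d := by
      intro v _
      rw [Finset.sum_add_distrib]
      refine add_le_add (le_add_of_nonneg_left (abs_nonneg _)) ?_
      have h2 : ∀ j ∈ (Finset.univ : Finset (Fin d)), 2 * Real.log (1 + segWidth x l j) ≤ 2 := by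
        intro j _
        have h3 := Real.log_le_sub_one_of_pos (show 0 < 1 + segWidth x l j by
          linarith [segWidth_nonneg x l j])
        linarith [hw j]
      refine (Finset.sum_le_sum h2).trans (le_of_eq ?_)
      simp [mul_comm]
    refine (Finset.sum_le_sum h1).trans ?_
    rw [Finset.sum_add_distrib, Finset.sum_const, nsmul_eq_mul]
    refine add_le_add hdom' ?_
    rw [mul_comm]
    gcongr
  have hf' : |∑ v ∈ B, Real.log (f (x v))| ≤ η * n := by
    refine (Finset.abs_sum_le_sum_abs _ _).trans (le_trans (Finset.sum_le_sum fun v _ => ?_) hdom)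
    exact le_add_of_nonneg_right (Finset.sum_nonneg fun j _ =>
      mul_nonneg zero_le_two (log_one_add_abs_nonneg _))
  have hgood' : |∑ v ∈ Bᶜ, (logEst x l v - Real.log (f (x v)))| ≤ δ * n := by
    refine (Finset.abs_sum_le_sum_abs _ _).trans ?_
    have h1 : ∀ v ∈ Bᶜ, |logEst x l v - Real.log (f (x v))| ≤ δ := by
      intro v hv
      obtain ⟨h1, h2⟩ := hgood v (Finset.mem_compl.1 hv)
      unfold logEst
      rw [if_neg h1]; exact h2
    refine (Finset.sum_le_sum h1).trans ?_
    rw [Finset.sum_const, nsmul_eq_mul, mul_comm]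
    gcongr
    simpa using Finset.card_le_univ Bᶜ
  have hsplit : ∑ v, logEst x l v - ∑ v, Real.log (f (x v)) =
      ∑ v ∈ Bᶜ, (logEst x l v - Real.log (f (x v))) +
        ∑ v ∈ B', Real.log (densityEst x l (x v)) - ∑ v ∈ B, Real.log (f (x v)) := by
    rw [← sum_logEst_eq, Finset.sum_sub_distrib, ← Finset.sum_add_sum_compl B (logEst x l),
      ← Finset.sum_add_sum_compl B fun v => Real.log (f (x v))]
    ring
  rw [hsplit]
  have hn0 : (0 : ℝ) ≤ n := by positivity
  have hε0 : 0 ≤ ε * n := (Nat.cast_nonneg _).trans hBε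
  have hεl : 0 ≤ ε * n * Real.log c := mul_nonneg hε0 hlogc
  have hηn : 0 ≤ η * n := by positivity
  have hd0 : (0 : ℝ) ≤ d := by positivity
  have hpc : 0 ≤ n * Real.pi ^ d / c := by positivity
  have hnc : 0 ≤ n / c := by positivity
  have hdcl := mul_le_mul_of_nonneg_left hcl hd0
  have e1 : (δ + (4 * d ^ 2 + 8 * d + 2) * η + (4 * d ^ 2 + 14 * d) * ε +
      (3 * d + 1) * (ε * Real.log c) + ((2 * d + 1) * Real.pi ^ d + 2 * d) / c) * n =
      δ * n + (4 * d ^ 2 + 8 * d + 2) * (η * n) + (4 * d ^ 2 + 14 * d) * (ε * n) +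
      (3 * d + 1) * (ε * n * Real.log c) + (2 * d + 1) * (n * Real.pi ^ d / c) +
      2 * d * (n / c) := by
    field_simp
    ring
  have e2 : n * (Real.pi ^ d + 2 * d) / c = n * Real.pi ^ d / c + 2 * d * (n / c) := by
    field_simp
  rw [e1]
  rw [e2] at hlo
  have k1 := mul_nonneg hd0 hηn
  have k2 := mul_nonneg hd0 hε0
  have k3 := mul_nonneg hd0 hεl
  have k4 := mul_nonneg hd0 hpc
  have k5 := mul_nonneg hd0 hnc
  have k6 := mul_nonneg (sq_nonneg (d : ℝ)) hηn
  have k7 := mul_nonneg (sq_nonneg (d : ℝ)) hε0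
  obtain ⟨f1, f2⟩ := abs_le.1 hf'
  obtain ⟨g1, g2⟩ := abs_le.1 hgood'
  clear hf' hgood' hsplit hdom hdom' hBε hB'ε
  rw [abs_le]
  constructor <;> linarith

section AlmostSure

variable {Ω : Type*} [MeasurableSpace Ω] {P : Measure Ω} [IsProbabilityMeasure P]
  {X : ℕ → Ω → Fin d → ℝ}

lemma ae_eventually_abs_sum_logEst_sub_le (hd : 0 < d) (hf : Measurable f) (hf0 : ∀ x, 0 ≤ f x)
    [IsProbabilityMeasure (densityMeasure f)]
    (hcont : ∀ᵐ x ∂(volume : Measure (Fin d → ℝ)), ContinuousAt f x)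
    (hX : IsSample P (densityMeasure f) X) (hdomi : Integrable (domFun f) (densityMeasure f))
    (hℓ : ∀ n, 1 ≤ ℓ n) (hℓo : (fun n => (ℓ n : ℝ) ^ d) =o[atTop] (fun n => (n : ℝ)))
    (hmesh : ∀ᵐ ω ∂P, ∀ j : Fin d,
      Tendsto (fun n => segWidth (fun v : Fin n => X v ω) (ℓ n) j) atTop (𝓝 0))
    {τ : ℝ} (hτ : 0 < τ) :
    ∀ᵐ ω ∂P, ∀ᶠ n : ℕ in atTop, |∑ v : Fin n, logEst (fun v : Fin n => X v ω) (ℓ n) v -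
      ∑ v : Fin n, Real.log (f (X v ω))| ≤ τ * n := by
  classical
  have hd0 : (0 : ℝ) < d := by exact_mod_cast hd
  set η₀ : ℝ := min (1 / 2) (τ / (40 * d)) with hη₀
  have hη₀0 : 0 < η₀ := lt_min (by norm_num) (by positivity)
  set η : ℝ := τ / (5 * (4 * d ^ 2 + 8 * d + 2)) with hη
  have hη0 : 0 < η := by positivity
  set q : ℝ := (2 * d + 1) * Real.pi ^ d + 2 * d with hq
  have hq0 : 0 < q := by positivity
  -- Each of the five error terms receives `τ / 5`. The term `q / c` fixes `c` first, since the size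
  -- `ε` of the exceptional set must also beat `log c`.
  set c : ℝ := max 1 (5 * q / τ) with hc
  have hc1 : 1 ≤ c := le_max_left _ _
  have hlogc : 0 ≤ Real.log c := Real.log_nonneg hc1
  obtain ⟨ε₁, hε₁, h1⟩ := ae_eventually_potSum_le hf hf0 hX ℓ hη0
  obtain ⟨ε₂, hε₂, h2⟩ := hX.ae_eventually_sum_le (measurable_domFun hf) hdomi hη0
  set ε : ℝ := min (min ε₁ ε₂) (min (τ / (5 * (4 * d ^ 2 + 14 * d)))
    (τ / (5 * ((3 * d + 1) * (Real.log c + 1))))) with hε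
  have hε0 : 0 < ε := by
    refine lt_min (lt_min hε₁ hε₂) (lt_min (by positivity) (by positivity))
  have h3 := ae_eventually_good hd hf hf0 hcont hX hℓ hℓo hmesh hη₀0 (min_le_left _ _) hε0
  filter_upwards [h1, h2, h3, ae_injective hf hf0 hX, ae_pos hf hX, hmesh]
    with ω w1 w2 w3 hinj hpos hmeshω
  filter_upwards [w1, w2, w3, eventually_segWidth_lt hmeshω one_pos] with n n1 n2 n3 n4
  obtain ⟨B, hB, hgood⟩ := n3
  have hle1 : ε * n ≤ ε₁ * n := by gcongr; exact (min_le_left _ _).trans (min_le_left _ _)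
  have hle2 : ε * n ≤ ε₂ * n := by gcongr; exact (min_le_left _ _).trans (min_le_right _ _)
  have key := abs_sum_logEst_sub_le (f := f) (l := ℓ n) (x := fun v : Fin n => X v ω) (c := c) hd
    (hℓ n) (hinj n) (fun v => hpos v) hη0.le hc1 (by positivity) hgood hB
    (n2 B (hB.trans hle2)) (fun B' hB' j => (prod_potential_le_potSum f (ℓ n)
      (fun v : Fin n => X v ω) (by
        rw [Finset.mem_filter]
        refine ⟨Finset.mem_univ _, le_trans ?_ (hB.trans hle1)⟩
        exact_mod_cast Finset.card_le_card hB') j).trans n1)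
    (fun u v huv j => (pair_potential_le_potSum f (ℓ n) _ (fun v : Fin n => X v ω)
      huv j).trans n1) n4
  refine key.trans (mul_le_mul_of_nonneg_right ?_ (by positivity))
  have e1 : 8 * d * η₀ ≤ τ / 5 := by
    calc 8 * d * η₀ ≤ 8 * d * (τ / (40 * d)) := by gcongr; exact min_le_right _ _
      _ = τ / 5 := by field_simp; norm_num
  have e2 : (4 * d ^ 2 + 8 * d + 2) * η = τ / 5 := by rw [hη]; field_simp
  have e3 : (4 * d ^ 2 + 14 * d) * ε ≤ τ / 5 := by
    calc (4 * d ^ 2 + 14 * d) * ε ≤ (4 * d ^ 2 + 14 * d) * (τ / (5 * (4 * d ^ 2 + 14 * d))) := by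
          gcongr; exact (min_le_right _ _).trans (min_le_left _ _)
      _ = τ / 5 := by field_simp
  have e4 : (3 * d + 1) * (ε * Real.log c) ≤ τ / 5 := by
    calc (3 * d + 1) * (ε * Real.log c) ≤
          (3 * d + 1) * (τ / (5 * ((3 * d + 1) * (Real.log c + 1))) * (Real.log c + 1)) := by
          gcongr
          · exact (min_le_right _ _).trans (min_le_right _ _)
          · linarith
      _ = τ / 5 := by field_simp
  have e5 : q / c ≤ τ / 5 := by
    have : 5 * q / τ ≤ c := le_max_right _ _
    rw [div_le_iff₀ hτ] at this
    rw [div_le_iff₀ (by positivity)]; linarith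
  linarith

lemma entropyEst_eq {n : ℕ} (x : Fin n → Fin d → ℝ) (l : ℕ) :
    entropyEst x l = -((∑ v, logEst x l v) / n) := by
  unfold entropyEst logEst; ring

/-- Almost sure convergence of the estimator. -/
lemma ae_tendsto_entropyEst (hd : 0 < d) (hf : Measurable f) (hf0 : ∀ x, 0 ≤ f x)
    [IsProbabilityMeasure (densityMeasure f)]
    (hcont : ∀ᵐ x ∂(volume : Measure (Fin d → ℝ)), ContinuousAt f x)
    (hX : IsSample P (densityMeasure f) X)
    (hlog : Integrable (fun t => Real.log (f t)) (densityMeasure f))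
    (hdomi : Integrable (domFun f) (densityMeasure f))
    (hℓ : ∀ n, 1 ≤ ℓ n) (hℓo : (fun n => (ℓ n : ℝ) ^ d) =o[atTop] (fun n => (n : ℝ)))
    (hmesh : ∀ᵐ ω ∂P, ∀ j : Fin d,
      Tendsto (fun n => segWidth (fun v : Fin n => X v ω) (ℓ n) j) atTop (𝓝 0)) :
    ∀ᵐ ω ∂P, Tendsto (fun n => entropyEst (fun v : Fin n => X v ω) (ℓ n)) atTop
      (𝓝 (entropy f)) := by
  have h1 : ∀ᵐ ω ∂P, ∀ k : ℕ, ∀ᶠ n : ℕ in atTop,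
      |∑ v : Fin n, logEst (fun v : Fin n => X v ω) (ℓ n) v -
        ∑ v : Fin n, Real.log (f (X v ω))| ≤ 1 / ((k : ℝ) + 1) * n :=
    ae_all_iff.2 fun k => ae_eventually_abs_sum_logEst_sub_le hd hf hf0 hcont hX hdomi hℓ hℓo
      hmesh (by positivity)
  filter_upwards [h1, hX.ae_tendsto_average hf.log hlog] with ω w1 w2
  have h2 : Tendsto (fun n : ℕ => (∑ v : Fin n, logEst (fun v : Fin n => X v ω) (ℓ n) v -
      ∑ v : Fin n, Real.log (f (X v ω))) / n) atTop (𝓝 0) := by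
    rw [Metric.tendsto_atTop']
    intro ε hε
    obtain ⟨k, hk⟩ := exists_nat_one_div_lt hε
    obtain ⟨N, hN⟩ := eventually_atTop.1 ((w1 k).and (eventually_gt_atTop 0))
    refine ⟨N, fun n hn => ?_⟩
    obtain ⟨h3, h4⟩ := hN n hn.le
    have h5 : (0 : ℝ) < n := by exact_mod_cast h4
    rw [Real.dist_eq, sub_zero, abs_div, abs_of_pos h5]
    exact ((div_le_iff₀ h5).2 h3).trans_lt hk
  have h3 := (h2.add w2).neg
  have h4 : -(0 + ∫ t, Real.log (f t) ∂(densityMeasure f)) = entropy f := by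
    unfold entropy; rw [integral_neg, zero_add]
  rw [h4] at h3
  refine h3.congr fun n => ?_
  rw [entropyEst_eq]; ring

end AlmostSure

end

end PSS

namespace PSS

noncomputable section

variable {d n : ℕ}

/-! ### Measurability of the estimator -/

/-- Sublevel sets are described by counting the coordinates below `t`, which avoids measurability of
sorting. -/
lemma measurable_orderStat (C : Finset (Fin n)) (j : Fin d) (r : ℤ) :
    Measurable fun x : Fin n → Fin d → ℝ => orderStat (C.val.map fun u => x u j) r := by
  classical
  have hcard : ∀ x : Fin n → Fin d → ℝ, (C.val.map fun u => x u j).card = C.card := fun x => by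
    rw [Multiset.card_map]; rfl
  have hmid : ∀ r : ℤ, 1 ≤ r → r ≤ C.card →
      Measurable fun x : Fin n → Fin d → ℝ => orderStat (C.val.map fun u => x u j) r := by
    intro r h1 h2
    refine measurable_of_Iic fun t => ?_
    have hset : (fun x : Fin n → Fin d → ℝ => orderStat (C.val.map fun u => x u j) r) ⁻¹' Set.Iic t =
        {x | r ≤ ((∑ u ∈ C, if x u j ≤ t then 1 else 0 : ℕ) : ℤ)} := by
      ext x
      rw [Set.mem_preimage, Set.mem_Iic, orderStat_le_iff h1 (by rw [hcard]; exact h2)]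
      have : ((C.val.map fun u => x u j).filter (· ≤ t)).card =
          ∑ u ∈ C, if x u j ≤ t then 1 else 0 := by
        rw [← Finset.card_filter, Multiset.filter_map, Multiset.card_map]; rfl
      rw [this]; rfl
    rw [hset]
    have hm : Measurable fun x : Fin n → Fin d → ℝ => ∑ u ∈ C, if x u j ≤ t then 1 else 0 :=
      Finset.measurable_sum _ fun u _ => Measurable.ite
        (measurableSet_le ((measurable_pi_apply j).comp (measurable_pi_apply u)) measurable_const)
        measurable_const measurable_const
    exact hm (Set.to_countable {k : ℕ | r ≤ (k : ℤ)}).measurableSet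
  rcases C.eq_empty_or_nonempty with rfl | hC
  · simp
  have hpos := hC.card_pos
  rcases le_total r 1 with h | h
  · simp only [orderStat_of_le_one _ h]
    exact hmid 1 le_rfl (by omega)
  rcases le_total (C.card : ℤ) r with h' | h'
  · have : ∀ x : Fin n → Fin d → ℝ, orderStat (C.val.map fun u => x u j) r =
        orderStat (C.val.map fun u => x u j) C.card := fun x => by
      rw [orderStat_of_card_le _ (by rw [hcard]; exact h'), hcard]
    simp only [this]
    exact hmid _ (by omega) le_rfl
  · exact hmid r h h'

lemma measurable_gridPoint (C : Finset (Fin n)) (j : Fin d) (m a : ℕ) :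
    Measurable fun x : Fin n → Fin d → ℝ => gridPoint (C.val.map fun u => x u j) m a := by
  unfold gridPoint
  simp only [Multiset.card_map]
  split_ifs
  · exact measurable_orderStat C j 1
  · exact measurable_orderStat C j _
  · exact (Finset.measurable_sum _ fun i _ => measurable_orderStat C j _).div_const _

lemma measurable_spacingDensity (C : Finset (Fin n)) (j : Fin d) (m : ℕ) (v : Fin n) :
    Measurable fun x : Fin n → Fin d → ℝ =>
      spacingDensity (C.val.map fun u => x u j) m (x v j) := by
  classical
  unfold spacingDensity
  simp only [Multiset.card_map]
  refine Finset.measurable_sum _ fun a _ => ?_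
  simp only [Set.indicator_apply]
  have ht : Measurable fun x : Fin n → Fin d → ℝ => x v j :=
    (measurable_pi_apply j).comp (measurable_pi_apply v)
  refine Measurable.ite ?_ ?_ measurable_const
  · unfold gridInterval
    split_ifs
    · exact (measurableSet_le (measurable_gridPoint C j m 0) ht).inter
        (measurableSet_le ht (measurable_gridPoint C j m 1))
    · exact (measurableSet_lt (measurable_gridPoint C j m a) ht).inter
        (measurableSet_le ht (measurable_gridPoint C j m (a + 1)))
  · exact (((measurable_orderStat C j _).sub (measurable_orderStat C j _)).const_mul _).const_div _

lemma measurableSet_pts_eq (l : ℕ) (v : Fin n) (C : Finset (Fin n)) :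
    MeasurableSet {x : Fin n → Fin d → ℝ | pts x l v = C} := by
  have h1 : ∀ u : Fin n, MeasurableSet {x : Fin n → Fin d → ℝ | u ∈ pts x l v} := by
    intro u
    have : {x : Fin n → Fin d → ℝ | u ∈ pts x l v} =
        {x | cellOn Finset.univ x l (x u) = cellOn Finset.univ x l (x v)} := by
      ext x
      rw [Set.mem_ofPred_eq, Set.mem_ofPred_eq, mem_pts, cellIndex_eq_cellOn, cellIndex_eq_cellOn]
    rw [this]
    exact measurableSet_cellOn_eq Finset.univ l measurable_id (measurable_pi_apply u)
      (measurable_pi_apply v)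
  have h2 : {x : Fin n → Fin d → ℝ | pts x l v = C} =
      ⋂ u, {x | u ∈ pts x l v ↔ u ∈ C} := by
    ext x
    simp only [Set.mem_ofPred_eq, Set.mem_iInter, Finset.ext_iff]
  rw [h2]
  refine MeasurableSet.iInter fun u => ?_
  by_cases hu : u ∈ C
  · simpa only [hu, iff_true] using h1 u
  · simp only [hu, iff_false]
    exact (h1 u).compl

/-- The set of points sharing the cell takes finitely many values; once it is fixed, the estimate is
an explicit function of order statistics. -/
lemma measurable_densityEst (l : ℕ) (v : Fin n) :
    Measurable fun x : Fin n → Fin d → ℝ => densityEst x l (x v) := by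
  classical
  have h : ∀ x : Fin n → Fin d → ℝ, densityEst x l (x v) =
      ∑ C : Finset (Fin n), if pts x l v = C then (if 2 ≤ C.card then (C.card : ℝ) / n *
        ∏ j, spacingDensity (C.val.map fun u => x u j) (spacingParam C.card) (x v j) else 0)
        else 0 := by
    intro x
    rw [Finset.sum_ite_eq, if_pos (Finset.mem_univ _)]
    rfl
  simp only [h]
  refine Finset.measurable_sum _ fun C _ =>
    Measurable.ite (measurableSet_pts_eq l v C) ?_ measurable_const
  split_ifs
  · exact (Finset.measurable_prod _ fun j _ =>
      measurable_spacingDensity C j (spacingParam C.card) v).const_mul _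
  · exact measurable_const

lemma measurable_entropyEst (l : ℕ) :
    Measurable fun x : Fin n → Fin d → ℝ => entropyEst x l := by
  unfold entropyEst
  exact (Finset.measurable_sum _ fun v _ => Measurable.ite
    (measurable_densityEst l v (measurableSet_singleton 0)) measurable_const
    (measurable_densityEst l v).log).const_mul _

/-! ### Bounds for the estimator in mean -/

lemma sum_inv_cnt_le {x : Fin n → Fin d → ℝ} {l : ℕ} (hl : 1 ≤ l) :
    ∑ v, (1 : ℝ) / cnt x l v ≤ l ^ d := by
  classical
  have h1 : ∀ v ∈ (Finset.univ : Finset (Fin n)), cellIndex x l (x v) ∈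
      Fintype.piFinset fun _ : Fin d => Finset.range l := by
    intro v _
    refine Fintype.mem_piFinset.2 fun j => Finset.mem_range.2 ?_
    have : cellIndex x l (x v) j ≤ l - 1 := min_le_right _ _
    omega
  rw [← Finset.sum_fiberwise_of_maps_to h1]
  have h2 : ∀ k ∈ Fintype.piFinset fun _ : Fin d => Finset.range l,
      ∑ v : Fin n with cellIndex x l (x v) = k, (1 : ℝ) / cnt x l v ≤ 1 := by
    intro k _
    have h3 : ∀ v ∈ Finset.univ.filter fun v : Fin n => cellIndex x l (x v) = k,
        (1 : ℝ) / cnt x l v = 1 / (Finset.univ.filter fun v : Fin n =>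
          cellIndex x l (x v) = k).card := by
      intro v hv
      have h4 : cnt x l v = (Finset.univ.filter fun v : Fin n => cellIndex x l (x v) = k).card := by
        unfold cnt pts cellPoints
        rw [(Finset.mem_filter.1 hv).2]
      rw [h4]
    rw [Finset.sum_congr rfl h3, Finset.sum_const, nsmul_eq_mul, mul_one_div]
    exact div_self_le_one _
  refine (Finset.sum_le_sum h2).trans (le_of_eq ?_)
  simp

/-- Each term is at most `2 / √N ≤ √ρ + 1 / (√ρ N)`, and the reciprocals `1 / N` add up to at most
the number of cells, `ρ n`. With `ρ → 0` this is the small factor in front of the mesh. -/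
lemma sum_par_div_cnt_le {x : Fin n → Fin d → ℝ} {l : ℕ} (hl : 1 ≤ l) (hn : 0 < n) :
    ∑ v, (par x l v : ℝ) / cnt x l v ≤ 2 * √((l : ℝ) ^ d / n) * n := by
  set ρ : ℝ := (l : ℝ) ^ d / n with hρ
  have hl0 : (0 : ℝ) < l := by exact_mod_cast hl
  have hn0 : (0 : ℝ) < n := by exact_mod_cast hn
  have hρ0 : 0 < ρ := by positivity
  have hs0 : 0 < √ρ := Real.sqrt_pos.2 hρ0
  have h1 : ∀ v ∈ (Finset.univ : Finset (Fin n)), (par x l v : ℝ) / cnt x l v ≤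
      √ρ + 1 / √ρ * (1 / cnt x l v) := by
    intro v _
    have hN : (0 : ℝ) < cnt x l v := by exact_mod_cast one_le_cnt x l v
    have h2 := par_le_two_sqrt x l v
    set N : ℝ := (cnt x l v : ℝ)
    have hN2 : √N * √N = N := Real.mul_self_sqrt hN.le
    have hsN : 0 < √N := Real.sqrt_pos.2 hN
    have h3 : √ρ + 1 / √ρ * (1 / N) = (√ρ * √ρ * N + 1) / (√ρ * N) := by
      field_simp
    rw [h3, div_le_div_iff₀ hN (by positivity)]
    have h4 : (par x l v : ℝ) * √ρ ≤ √ρ * √ρ * N + 1 := by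
      nlinarith [sq_nonneg (√ρ * √N - 1), mul_le_mul_of_nonneg_right h2 hs0.le]
    nlinarith
  refine (Finset.sum_le_sum h1).trans ?_
  rw [Finset.sum_add_distrib, ← Finset.mul_sum, Finset.sum_const, Finset.card_univ,
    Fintype.card_fin, nsmul_eq_mul]
  have h2 : 1 / √ρ * ∑ v, (1 : ℝ) / cnt x l v ≤ 1 / √ρ * l ^ d := by
    gcongr; exact sum_inv_cnt_le hl
  have h3 : 1 / √ρ * (l : ℝ) ^ d = √ρ * n := by
    have : (l : ℝ) ^ d = √ρ * √ρ * n := by rw [Real.mul_self_sqrt hρ0.le, hρ]; field_simp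
    rw [this]; field_simp
  linarith

lemma log_one_add_le_four_sqrt {y : ℝ} (hy : 0 ≤ y) : Real.log (1 + y) ≤ 4 * √√(1 + y) := by
  have h1 : Real.log √√(1 + y) = Real.log (1 + y) / 4 := by
    rw [Real.log_sqrt (Real.sqrt_nonneg _), Real.log_sqrt (by linarith)]; ring
  have h2 : 0 < √√(1 + y) := by positivity
  have h3 := Real.log_le_sub_one_of_pos h2
  linarith

/-- The sum of the `d`-th powers of the coordinates. -/
def powSum (t : Fin d → ℝ) : ℝ := ∑ j, |t j| ^ d

lemma powSum_nonneg (t : Fin d → ℝ) : 0 ≤ powSum t := Finset.sum_nonneg fun _ _ => by positivity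

lemma segWidth_pow_le {x : Fin n → Fin d → ℝ} {l : ℕ} (hn : 0 < n) (j : Fin d) :
    segWidth x l j ^ d ≤ 2 ^ d * (∑ v, powSum (x v)) / l ^ d := by
  have : Nonempty (Fin n) := ⟨⟨0, hn⟩⟩
  obtain ⟨p, hp⟩ := Finite.exists_max fun v => x v j
  obtain ⟨q, hq⟩ := Finite.exists_min fun v => x v j
  have h1 : (⨆ v, x v j) = x p j :=
    le_antisymm (ciSup_le hp) (le_ciSup (Set.finite_range fun v => x v j).bddAbove p)
  have h2 : (⨅ v, x v j) = x q j :=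
    le_antisymm (ciInf_le (Set.finite_range fun v => x v j).bddBelow q) (le_ciInf hq)
  unfold segWidth
  rw [h1, h2, div_pow]
  gcongr
  have hpow : ∀ v, |x v j| ^ d ≤ ∑ v, powSum (x v) := fun v =>
    (Finset.single_le_sum (f := fun j => |x v j| ^ d) (fun _ _ => by positivity)
      (Finset.mem_univ j)).trans
    (Finset.single_le_sum (f := fun v => powSum (x v)) (fun _ _ => powSum_nonneg _)
      (Finset.mem_univ v))
  set m := max |x p j| |x q j| with hm
  have h3 : x p j - x q j ≤ 2 * m := by
    have := le_abs_self (x p j)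
    have := neg_abs_le (x q j)
    have := le_max_left |x p j| |x q j|
    have := le_max_right |x p j| |x q j|
    linarith
  have h4 : m ^ d ≤ ∑ v, powSum (x v) := by
    rcases max_choice |x p j| |x q j| with h | h <;> rw [hm, h] <;> exact hpow _
  calc (x p j - x q j) ^ d ≤ (2 * m) ^ d := by
        gcongr
        exact sub_nonneg.2 (hq p)
    _ = 2 ^ d * m ^ d := mul_pow _ _ _
    _ ≤ _ := by gcongr

/-- The mesh tends to zero only almost surely, so in mean its logarithm must be bounded otherwise.
By moments `w ^ d` is at most an average divided by `ρ`, and `√ρ * log (1 + 1 / ρ)` vanishes with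
`ρ`. -/
lemma sqrt_mul_log_segWidth_le (hd : 0 < d) {x : Fin n → Fin d → ℝ} {l : ℕ} (hl : 1 ≤ l)
    (hn : 0 < n) (j : Fin d) :
    √((l : ℝ) ^ d / n) * Real.log (1 + segWidth x l j) ≤
      √((l : ℝ) ^ d / n) * (1 + 2 ^ d * ((∑ v, powSum (x v)) / n)) +
        4 * √√(((l : ℝ) ^ d / n) ^ 2 + (l : ℝ) ^ d / n) := by
  set ρ : ℝ := (l : ℝ) ^ d / n with hρ
  have hl0 : (0 : ℝ) < l := by exact_mod_cast hl
  have hn0 : (0 : ℝ) < n := by exact_mod_cast hn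
  have hρ0 : 0 < ρ := by positivity
  set w := segWidth x l j
  have hw0 : 0 ≤ w := segWidth_nonneg x l j
  set S := ∑ v, powSum (x v)
  have hS0 : 0 ≤ S := Finset.sum_nonneg fun _ _ => powSum_nonneg _
  set b := 2 ^ d * (S / n) with hb
  have hb0 : 0 ≤ b := by positivity
  have h1 : w ^ d ≤ b * (1 / ρ) := by
    refine (segWidth_pow_le hn j).trans (le_of_eq ?_)
    rw [hb, hρ]; field_simp; rfl
  have h2 : 1 + w ≤ 2 * ((1 + b) * (1 + 1 / ρ)) := by
    have h3 : 1 + w ^ d ≤ (1 + b) * (1 + 1 / ρ) := by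
      have : 0 ≤ 1 / ρ := by positivity
      nlinarith
    have h4 : w ≤ 1 + w ^ d := by
      rcases le_total w 1 with h | h
      · have : 0 ≤ w ^ d := by positivity
        linarith
      · linarith [le_self_pow₀ h hd.ne']
    have : 0 ≤ w ^ d := by positivity
    linarith
  have h3 := Real.log_le_log (by linarith) h2
  rw [Real.log_mul two_ne_zero (by positivity), Real.log_mul (by positivity) (by positivity)] at h3
  have h4 := Real.log_le_sub_one_of_pos (show 0 < 1 + b by linarith)
  have h5 := log_one_add_le_four_sqrt (show 0 ≤ 1 / ρ by positivity)
  have h6 : Real.log (1 + w) ≤ 1 + b + 4 * √√(1 + 1 / ρ) := by linarith [Real.log_two_lt_d9]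
  have h7 : √ρ * √√(1 + 1 / ρ) = √√(ρ ^ 2 + ρ) := by
    rw [← Real.sqrt_mul hρ0.le]
    congr 1
    have : ρ * √(1 + 1 / ρ) = √(ρ ^ 2) * √(1 + 1 / ρ) := by rw [Real.sqrt_sq hρ0.le]
    rw [this, ← Real.sqrt_mul (by positivity)]
    congr 1; field_simp
  have h8 := mul_le_mul_of_nonneg_left h6 (Real.sqrt_nonneg ρ)
  rw [← h7]
  linarith

variable {f : (Fin d → ℝ) → ℝ}

/-- The estimator is dominated by averages. -/
lemma abs_sum_logEst_le (hd : 0 < d) {l : ℕ} {x : Fin n → Fin d → ℝ} (hl : 1 ≤ l) (hn : 0 < n)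
    (hinj : ∀ j, Function.Injective fun v => x v j) (hpos : ∀ v, 0 < f (x v))
    (hz : potSum f l n Finset.univ x ≠ ⊤) :
    |(∑ v, logEst x l v) / n| ≤ (20 * d + 12 * d ^ 2 + (2 * d + 1) * Real.pi ^ d + 2 * d) +
      (4 * d + 8) * ((∑ v, domFun f (x v)) / n) +
      ((4 * d + 4 * d ^ 2) * ((potSum f l n Finset.univ x).toReal * Real.exp (-(2 * n)) / n) +
      16 * d * (√((l : ℝ) ^ d / n) * (1 + 2 ^ d * ((∑ v, powSum (x v)) / n)) +
        4 * √√(((l : ℝ) ^ d / n) ^ 2 + (l : ℝ) ^ d / n))) := by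
  classical
  have hn0 : (0 : ℝ) < n := by exact_mod_cast hn
  -- The potential sum has mean of order `exp (2 n)`, so `z` has bounded mean. The random exponent
  -- `L = 2 n + z` is admissible by `z ≤ exp z` and, once divided by `n`, exceeds the constant 2
  -- only by `z / n`.
  set z := (potSum f l n Finset.univ x).toReal * Real.exp (-(2 * n)) with hzdef
  have hz0 : 0 ≤ z := by positivity
  set L : ℝ := 2 * n + z with hL
  have hL0 : 0 ≤ L := by positivity
  have hzL : potSum f l n Finset.univ x ≤ ENNReal.ofReal (Real.exp L) := by
    rw [← ENNReal.ofReal_toReal hz]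
    refine ENNReal.ofReal_le_ofReal ?_
    have h1 : (potSum f l n Finset.univ x).toReal = Real.exp (2 * n) * z := by
      rw [hzdef, mul_left_comm, ← Real.exp_add]; simp
    rw [h1, hL, Real.exp_add]
    gcongr
    linarith [Real.add_one_le_exp z]
  set B : Finset (Fin n) := Finset.univ.filter fun v => densityEst x l (x v) ≠ 0 with hB
  have hB0 : ∀ v ∈ B, densityEst x l (x v) ≠ 0 := fun v hv => (Finset.mem_filter.1 hv).2
  have hsum : ∑ v, logEst x l v = ∑ v ∈ B, Real.log (densityEst x l (x v)) := sum_logEst_eq x l _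
  have hup := sum_log_densityEst_le hd hinj B hB0 hpos hL0
    (fun C _ j => (prod_potential_le_potSum f l x (Finset.mem_univ C) j).trans hzL)
    (fun u v huv j => (pair_potential_le_potSum f l _ x huv j).trans hzL) le_rfl
  have hlo := neg_le_sum_log_densityEst_all hl hinj B hB0
  set D := ∑ v, domFun f (x v) with hD
  have hD0 : 0 ≤ D := Finset.sum_nonneg fun v _ => domFun_nonneg f _
  have hup' : ∑ v ∈ B, (4 * d * domFun f (x v) + 12 * d + 4 * d ^ 2) ≤
      4 * d * D + n * (12 * d + 4 * d ^ 2) := by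
    refine (Finset.sum_le_sum_of_subset_of_nonneg (Finset.filter_subset _ _) fun v _ _ => ?_).trans
      (le_of_eq ?_)
    · have := domFun_nonneg f (x v)
      positivity
    · simp only [add_assoc]
      rw [Finset.sum_add_distrib, ← Finset.mul_sum, Finset.sum_const, Finset.card_univ,
        Fintype.card_fin, nsmul_eq_mul]
  have hlo1 : 16 * ∑ v, ∑ j, Real.log (1 + |x v j|) ≤ 8 * D := by
    rw [hD, Finset.mul_sum, Finset.mul_sum]
    refine Finset.sum_le_sum fun v _ => ?_
    unfold domFun
    rw [← Finset.mul_sum]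
    have := abs_nonneg (Real.log (f (x v)))
    linarith
  set Q := √((l : ℝ) ^ d / n) * (1 + 2 ^ d * ((∑ v, powSum (x v)) / n)) +
        4 * √√(((l : ℝ) ^ d / n) ^ 2 + (l : ℝ) ^ d / n) with hQ
  have hQ0 : 0 ≤ Q := by
    have : 0 ≤ ∑ v, powSum (x v) := Finset.sum_nonneg fun _ _ => powSum_nonneg _
    positivity
  have hlo2 : 8 * (∑ v, (par x l v : ℝ) / cnt x l v) * ∑ j, Real.log (1 + segWidth x l j) ≤
      16 * d * Q * n := by
    have h1 : ∀ j ∈ (Finset.univ : Finset (Fin d)),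
        √((l : ℝ) ^ d / n) * Real.log (1 + segWidth x l j) ≤ Q :=
      fun j _ => sqrt_mul_log_segWidth_le hd hl hn j
    have h2 := Finset.sum_le_sum h1
    rw [← Finset.mul_sum, Finset.sum_const, Finset.card_univ, Fintype.card_fin, nsmul_eq_mul] at h2
    have h3 : 0 ≤ ∑ j, Real.log (1 + segWidth x l j) := Finset.sum_nonneg fun j _ =>
      Real.log_nonneg (by linarith [segWidth_nonneg x l j])
    calc 8 * (∑ v, (par x l v : ℝ) / cnt x l v) * ∑ j, Real.log (1 + segWidth x l j)
        ≤ 8 * (2 * √((l : ℝ) ^ d / n) * n) * ∑ j, Real.log (1 + segWidth x l j) := by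
          gcongr; exact sum_par_div_cnt_le hl hn
      _ = 16 * n * (√((l : ℝ) ^ d / n) * ∑ j, Real.log (1 + segWidth x l j)) := by ring
      _ ≤ 16 * n * (d * Q) := by gcongr
      _ = _ := by ring
  rw [hsum, abs_div, abs_of_pos hn0, div_le_iff₀ hn0]
  have e1 : (20 * d + 12 * d ^ 2 + (2 * d + 1) * Real.pi ^ d + 2 * d +
      (4 * d + 8) * (D / n) + ((4 * d + 4 * d ^ 2) * (z / n) + 16 * d * Q)) * n =
      (22 * d + 12 * d ^ 2) * n + (2 * d + 1) * (Real.pi ^ d * n) + (4 * d + 8) * D +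
        (4 * d + 4 * d ^ 2) * z + 16 * d * Q * n := by
    field_simp; ring
  rw [e1]
  have hd0 : (0 : ℝ) ≤ d := by positivity
  have k1 := mul_nonneg hd0 hD0
  have k2 := mul_nonneg hd0 hn0.le
  have k3 := mul_nonneg (sq_nonneg (d : ℝ)) hn0.le
  have k4 : 0 ≤ Real.pi ^ d * n := by positivity
  have k5 := mul_nonneg hd0 k4
  have k6 := mul_nonneg hd0 hz0
  have k7 := mul_nonneg (sq_nonneg (d : ℝ)) hz0
  have k8 : 0 ≤ d * Q * n := by positivity
  have e2 : (n : ℝ) * Real.pi ^ d / 1 = Real.pi ^ d * n := by ring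
  rw [Real.log_one, mul_zero, zero_add, e2, hL] at hup
  rw [abs_le]
  constructor <;> nlinarith

end

end PSS

/-! ### Convergence in `L¹` -/

namespace PSS

noncomputable section

/-- Convergence in `L¹` from almost sure convergence and a bound by a constant up to an error
that vanishes in `L¹`. -/
lemma tendsto_eLpNorm_one_sub {Ω : Type*} [MeasurableSpace Ω] {P : Measure Ω}
    [IsFiniteMeasure P] {Y : ℕ → Ω → ℝ} {c : ℝ} (hY : ∀ n, Measurable (Y n))
    (hlim : ∀ᵐ ω ∂P, Tendsto (fun n => Y n ω) atTop (𝓝 c)) {K : ℝ≥0∞} (hK : K ≠ ⊤)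
    {R : ℕ → Ω → ℝ≥0∞} (hR : Tendsto (fun n => ∫⁻ ω, R n ω ∂P) atTop (𝓝 0))
    (hle : ∀ᶠ n in atTop, ∀ᵐ ω ∂P, ‖Y n ω - c‖ₑ ≤ K + R n ω) :
    Tendsto (fun n => eLpNorm (fun ω => Y n ω - c) 1 P) atTop (𝓝 0) := by
  have hm : ∀ n, Measurable fun ω => min ‖Y n ω - c‖ₑ K := fun n =>
    ((hY n).sub_const c).enorm.min measurable_const
  -- Bounded convergence handles the error truncated at `K`; whatever exceeds `K` is at most `R`.
  have h1 : Tendsto (fun n => ∫⁻ ω, min ‖Y n ω - c‖ₑ K ∂P) atTop (𝓝 0) := by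
    have h := tendsto_lintegral_of_dominated_convergence (μ := P) (f := fun _ => 0)
      (fun _ => K) hm (fun n => Eventually.of_forall fun ω => min_le_right _ _)
      (by rw [lintegral_const]; exact ENNReal.mul_ne_top hK (measure_ne_top _ _)) (by
        filter_upwards [hlim] with ω hω
        have h2 : Tendsto (fun n => ‖Y n ω - c‖ₑ) atTop (𝓝 0) := by
          have := (hω.sub_const c).enorm
          simpa using this
        have h3 := h2.min (tendsto_const_nhds (x := K))
        simpa using h3)
    simpa using h
  have h2 := h1.add hR
  rw [add_zero] at h2
  refine tendsto_of_tendsto_of_tendsto_of_le_of_le' tendsto_const_nhds h2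
    (Eventually.of_forall fun _ => zero_le) ?_
  filter_upwards [hle] with n hn
  rw [eLpNorm_one_eq_lintegral_enorm, ← lintegral_add_left (hm n)]
  refine lintegral_mono_ae ?_
  filter_upwards [hn] with ω hω
  rcases le_total ‖Y n ω - c‖ₑ K with h | h
  · rw [min_eq_left h]; exact le_self_add
  · rwa [min_eq_right h]

variable {Ω : Type*} [MeasurableSpace Ω] {P : Measure Ω} {d : ℕ}
  {f : (Fin d → ℝ) → ℝ} {X : ℕ → Ω → Fin d → ℝ} {ℓ : ℕ → ℕ}

/-- Over all subsets the weights `5 ^ |B|` add up to `6 ^ n`, and `6 < exp 2`. -/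
lemma lintegral_potSum_univ_le [IsProbabilityMeasure P] (hf : Measurable f) (hf0 : ∀ x, 0 ≤ f x)
    [IsProbabilityMeasure (densityMeasure f)] (hX : IsSample P (densityMeasure f) X) (l n : ℕ) :
    ∫⁻ ω, potSum f l n Finset.univ (fun v => X v ω) ∂P ≤
      ENNReal.ofReal (6 * d * Real.exp (2 * n)) := by
  rw [hX.lintegral_fin (measurable_potSum hf l n _)]
  refine (lintegral_potSum_le hf hf0 l n _).trans (ENNReal.ofReal_le_ofReal ?_)
  have h1 : ∑ B : Finset (Fin n), (5 : ℝ) ^ B.card ≤ Real.exp (2 * n) := by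
    have h := Fin.sum_pow_mul_eq_add_pow (n := n) (5 : ℝ) 1
    simp only [one_pow, mul_one] at h
    rw [h, mul_comm, Real.exp_nat_mul]
    refine pow_le_pow_left₀ (by norm_num) ?_ n
    have : Real.exp 2 = Real.exp 1 * Real.exp 1 := by rw [← Real.exp_add]; norm_num
    rw [this]
    nlinarith [Real.exp_one_gt_d9]
  have h2 : (n : ℝ) ^ 3 ≤ Real.exp (2 * n) := by
    have h := Real.pow_div_factorial_le_exp (2 * n : ℝ) (by positivity) 3
    have h' : (Nat.factorial 3 : ℕ) = 6 := rfl
    rw [h', mul_pow] at h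
    have : (0 : ℝ) ≤ (n : ℝ) ^ 3 := by positivity
    push_cast at h
    linarith
  have hd0 : (0 : ℝ) ≤ d := by positivity
  nlinarith [mul_le_mul_of_nonneg_left h1 hd0, mul_le_mul_of_nonneg_left h2 hd0]

lemma measurable_powSum : Measurable (powSum (d := d)) :=
  Finset.measurable_sum _ fun j _ => (measurable_pi_apply j).abs.pow_const d

lemma integrable_powSum (hpow : ∀ j : Fin d,
    Integrable (fun t : Fin d → ℝ => |t j| ^ d) (densityMeasure f)) :
    Integrable powSum (densityMeasure f) :=
  integrable_finsetSum _ fun j _ => hpow j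

lemma IsSample.integral_sum_div {g : (Fin d → ℝ) → ℝ}
    (hX : IsSample P (densityMeasure f) X) (hg : Measurable g)
    (hgi : Integrable g (densityMeasure f)) {n : ℕ} (hn : 0 < n) :
    ∫ ω, (∑ v : Fin n, g (X v ω)) / n ∂P = ∫ t, g t ∂(densityMeasure f) := by
  have hn0 : (n : ℝ) ≠ 0 := by exact_mod_cast hn.ne'
  rw [integral_div, integral_finsetSum (f := fun (v : Fin n) ω => g (X v ω)) _
    fun v _ => hX.integrable_comp hgi v]
  simp only [hX.integral_comp hg]
  rw [Finset.sum_const, Finset.card_univ, Fintype.card_fin, nsmul_eq_mul]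
  field_simp

/-- Convergence of the estimator in `L¹`. -/
lemma tendsto_eLpNorm_entropyEst [IsProbabilityMeasure P] (hd : 0 < d) (hf : Measurable f) (hf0 : ∀ x, 0 ≤ f x)
    [IsProbabilityMeasure (densityMeasure f)] (hX : IsSample P (densityMeasure f) X)
    (hpow : ∀ j : Fin d, Integrable (fun t : Fin d → ℝ => |t j| ^ d) (densityMeasure f))
    (hdomi : Integrable (domFun f) (densityMeasure f))
    (hℓ : ∀ n, 1 ≤ ℓ n) (hℓo : (fun n => (ℓ n : ℝ) ^ d) =o[atTop] (fun n => (n : ℝ)))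
    (hlim : ∀ᵐ ω ∂P, Tendsto (fun n => entropyEst (fun v : Fin n => X v ω) (ℓ n)) atTop
      (𝓝 (entropy f))) :
    Tendsto (fun n => eLpNorm
      (fun ω => entropyEst (fun v : Fin n => X v ω) (ℓ n) - entropy f) 1 P) atTop (𝓝 0) := by
  set C0 : ℝ := 20 * d + 12 * d ^ 2 + (2 * d + 1) * Real.pi ^ d + 2 * d with hC0
  set C1 : ℝ := 4 * d + 8 with hC1
  set C2 : ℝ := 4 * d + 4 * d ^ 2 with hC2
  set m := ∫ t, domFun f t ∂(densityMeasure f) with hm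
  set M := ∫ t, powSum t ∂(densityMeasure f) with hM
  set ρ : ℕ → ℝ := fun n => (ℓ n : ℝ) ^ d / n with hρ
  have hC0' : 0 ≤ C0 := by positivity
  have hC1' : 0 ≤ C1 := by positivity
  have hC2' : 0 ≤ C2 := by positivity
  have hdom := measurable_domFun hf
  have hm0 : 0 ≤ m := integral_nonneg fun t => domFun_nonneg f t
  have hM0 : 0 ≤ M := integral_nonneg fun t => powSum_nonneg t
  have hpowi := integrable_powSum hpow
  -- the three errors
  set R1 : ℕ → Ω → ℝ≥0∞ := fun n ω =>
    ENNReal.ofReal C1 * ‖(∑ v : Fin n, domFun f (X v ω)) / n - m‖ₑ with hR1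
  set R2 : ℕ → Ω → ℝ≥0∞ := fun n ω => ENNReal.ofReal (C2 * (Real.exp (-(2 * n)) / n)) *
    potSum f (ℓ n) n Finset.univ (fun v => X v ω) with hR2
  set R3 : ℕ → Ω → ℝ≥0∞ := fun n ω => ENNReal.ofReal (16 * d * (√(ρ n) *
    (1 + 2 ^ d * ((∑ v : Fin n, powSum (X v ω)) / n)) + 4 * √√(ρ n ^ 2 + ρ n))) with hR3
  have hS : ∀ (n : ℕ) {g : (Fin d → ℝ) → ℝ}, Measurable g →
      Measurable fun ω => (∑ v : Fin n, g (X v ω)) / (n : ℝ) := fun n g hg =>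
    (Finset.measurable_sum (f := fun (v : Fin n) ω => g (X v ω)) _
      fun v _ => hg.comp (hX.meas v)).div_const _
  have hR1m : ∀ n, Measurable (R1 n) := fun n => ((hS n hdom).sub_const m).enorm.const_mul _
  have hR2m : ∀ n, Measurable (R2 n) := fun n =>
    ((measurable_potSum hf (ℓ n) n _).comp (hX.measurable_fin n)).const_mul _
  have hL1 : Tendsto (fun n => ∫⁻ ω, R1 n ω ∂P) atTop (𝓝 0) := by
    -- The averages of the dominating function are not bounded; the strong law in `L¹` makes their
    -- fluctuation around the mean `m` part of the vanishing error, and `m` part of the constant.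
    have h := strong_law_Lp (μ := P) le_rfl ENNReal.one_ne_top (fun i ω => domFun f (X i ω))
      (memLp_one_iff_integrable.2 (hX.integrable_comp hdomi 0)) (hX.indepFun_comp hdom)
      (hX.identDistrib_comp hdom)
    rw [hX.integral_comp hdom 0] at h
    have h2 := ENNReal.Tendsto.const_mul (a := ENNReal.ofReal C1) h (Or.inr ENNReal.ofReal_ne_top)
    rw [mul_zero] at h2
    refine h2.congr fun n => ?_
    rw [lintegral_const_mul _ ((hS n hdom).sub_const m).enorm, eLpNorm_one_eq_lintegral_enorm]
    congr 1
    refine lintegral_congr fun ω => ?_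
    rw [Finset.sum_range, smul_eq_mul, div_eq_inv_mul]
  have hL2 : Tendsto (fun n => ∫⁻ ω, R2 n ω ∂P) atTop (𝓝 0) := by
    have h : Tendsto (fun n : ℕ => ENNReal.ofReal (C2 * (6 * d) / n)) atTop (𝓝 0) := by
      rw [← ENNReal.ofReal_zero]
      exact (ENNReal.continuous_ofReal.tendsto 0).comp (tendsto_const_div_atTop_nhds_zero_nat _)
    refine tendsto_of_tendsto_of_tendsto_of_le_of_le tendsto_const_nhds h
      (fun _ => zero_le) fun n => ?_
    change ∫⁻ ω, _ * potSum f (ℓ n) n Finset.univ (fun v => X v ω) ∂P ≤ _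
    have hzm : Measurable fun ω => potSum f (ℓ n) n Finset.univ (fun v : Fin n => X v ω) :=
      (measurable_potSum hf (ℓ n) n _).comp (hX.measurable_fin n)
    rw [lintegral_const_mul _ hzm]
    refine (mul_le_mul_right (lintegral_potSum_univ_le hf hf0 hX (ℓ n) n) _).trans (le_of_eq ?_)
    rw [← ENNReal.ofReal_mul (by positivity)]
    congr 1
    rw [Real.exp_neg]
    have := Real.exp_ne_zero (2 * (n : ℝ))
    field_simp
  have hρ0 : ∀ n, 0 ≤ ρ n := fun n => by positivity
  have hρl : Tendsto ρ atTop (𝓝 0) := hℓo.tendsto_div_nhds_zero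
  have hL3 : Tendsto (fun n => ∫⁻ ω, R3 n ω ∂P) atTop (𝓝 0) := by
    have h : Tendsto (fun n : ℕ => ENNReal.ofReal (16 * d * (√(ρ n) * (1 + 2 ^ d * M) +
        4 * √√(ρ n ^ 2 + ρ n)))) atTop (𝓝 0) := by
      have hc : Continuous fun r : ℝ => ENNReal.ofReal (16 * d * (√r * (1 + 2 ^ d * M) +
        4 * √√(r ^ 2 + r))) :=
        ENNReal.continuous_ofReal.comp (by fun_prop)
      have h := (hc.tendsto 0).comp hρl
      simpa [Function.comp_def] using h
    refine h.congr' ?_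
    filter_upwards [eventually_gt_atTop 0] with n hn
    have hi : Integrable (fun ω => (∑ v : Fin n, powSum (X v ω)) / (n : ℝ)) P :=
      (integrable_finsetSum (f := fun (v : Fin n) ω => powSum (X v ω)) _
        fun v _ => hX.integrable_comp hpowi v).div_const _
    have hi2 : Integrable (fun ω => √(ρ n) *
        (1 + 2 ^ d * ((∑ v : Fin n, powSum (X v ω)) / (n : ℝ)))) P :=
      ((integrable_const _).add (hi.const_mul _)).const_mul _
    have hi3 : Integrable (fun ω => 16 * (d : ℝ) * (√(ρ n) *
        (1 + 2 ^ d * ((∑ v : Fin n, powSum (X v ω)) / n)) + 4 * √√(ρ n ^ 2 + ρ n))) P :=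
      (hi2.add (integrable_const _)).const_mul _
    rw [hR3, ← ofReal_integral_eq_lintegral_ofReal hi3]
    · rw [integral_const_mul]
      congr 3
      rw [integral_add hi2 (integrable_const _), integral_const_mul,
        integral_add (integrable_const _) (hi.const_mul _), integral_const_mul,
        hX.integral_sum_div measurable_powSum hpowi hn]
      simp only [integral_const, probReal_univ, one_smul]
      rfl
    · refine Eventually.of_forall fun ω => ?_
      have : 0 ≤ ∑ v : Fin n, powSum (X v ω) := Finset.sum_nonneg fun _ _ => powSum_nonneg _
      change 0 ≤ 16 * (d : ℝ) * _
      positivity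
  refine tendsto_eLpNorm_one_sub (K := ENNReal.ofReal (|entropy f| + C0 + C1 * m))
    (R := fun n ω => R1 n ω + (R2 n ω + R3 n ω))
    (fun n => (measurable_entropyEst (ℓ n)).comp (hX.measurable_fin n)) hlim
    ENNReal.ofReal_ne_top ?_ ?_
  · have h := hL1.add (hL2.add hL3)
    rw [add_zero, add_zero] at h
    refine h.congr fun n => ?_
    rw [lintegral_add_left (hR1m n), lintegral_add_left (hR2m n)]
  filter_upwards [eventually_gt_atTop 0] with n hn
  have hfin : ∀ᵐ ω ∂P, potSum f (ℓ n) n Finset.univ (fun v => X v ω) < ⊤ :=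
    ae_lt_top ((measurable_potSum hf (ℓ n) n _).comp (hX.measurable_fin n))
      (ne_top_of_le_ne_top ENNReal.ofReal_ne_top (lintegral_potSum_univ_le hf hf0 hX (ℓ n) n))
  filter_upwards [hfin, ae_injective hf hf0 hX, ae_pos hf hX] with ω hz hinj hpos
  have hn0 : (0 : ℝ) < n := by exact_mod_cast hn
  have key := abs_sum_logEst_le (f := f) hd (hℓ n) hn (x := fun v : Fin n => X v ω) (hinj n)
    (fun v => hpos v) hz.ne
  set z := potSum f (ℓ n) n Finset.univ (fun v => X v ω) with hzdef
  have hR3nn : 0 ≤ 16 * (d : ℝ) * (√(ρ n) *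
      (1 + 2 ^ d * ((∑ v : Fin n, powSum (X v ω)) / n)) + 4 * √√(ρ n ^ 2 + ρ n)) := by
    have : 0 ≤ ∑ v : Fin n, powSum (X v ω) := Finset.sum_nonneg fun _ _ => powSum_nonneg _
    positivity
  have hR2e : R2 n ω = ENNReal.ofReal (C2 * (Real.exp (-(2 * n)) / n) * z.toReal) := by
    rw [ENNReal.ofReal_mul (by positivity), ENNReal.ofReal_toReal hz.ne]
  have hR1e : R1 n ω =
      ENNReal.ofReal (C1 * |(∑ v : Fin n, domFun f (X v ω)) / n - m|) := by
    rw [ENNReal.ofReal_mul hC1', ← Real.norm_eq_abs, ofReal_norm]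
  change _ ≤ _ + (R1 n ω + (R2 n ω + R3 n ω))
  rw [hR2e, hR1e, hR3, ← ENNReal.ofReal_add (by positivity) hR3nn,
    ← ENNReal.ofReal_add (by positivity) (by positivity),
    ← ENNReal.ofReal_add (by positivity) (by positivity), ← ofReal_norm,
    Real.norm_eq_abs]
  refine ENNReal.ofReal_le_ofReal ?_
  have t1 := abs_sub (entropyEst (fun v : Fin n => X v ω) (ℓ n)) (entropy f)
  rw [entropyEst_eq, abs_neg] at t1
  have t2 := mul_le_mul_of_nonneg_left
    (le_abs_self ((∑ v : Fin n, domFun f (X v ω)) / n - m)) hC1'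
  have t3 : C2 * (z.toReal * Real.exp (-(2 * n)) / n) =
      C2 * (Real.exp (-(2 * n)) / n) * z.toReal := by ring
  rw [t3] at key
  rw [entropyEst_eq]
  change _ ≤ _ + _ + (_ + 16 * d * (√(ρ n) *
      (1 + 2 ^ d * ((∑ v : Fin n, powSum (X v ω)) / n)) + 4 * √√(ρ n ^ 2 + ρ n))) at key
  linarith

end

end PSS

theorem theorem11 {Ω : Type*} [MeasurableSpace Ω] (P : Measure Ω) [IsProbabilityMeasure P]
    (d : ℕ) (hd : 0 < d)
    -- the true density
    (f : (Fin d → ℝ) → ℝ) (hf_meas : Measurable f) (hf_nonneg : ∀ x, 0 ≤ f x)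
    (hf_cont : ∀ᵐ x ∂(volume : Measure (Fin d → ℝ)), ContinuousAt f x)
    -- an i.i.d. sequence with density `f`
    (X : ℕ → Ω → Fin d → ℝ) (hX_meas : ∀ i, Measurable (X i)) (hX_indep : iIndepFun X P)
    (hX_law : ∀ i, P.map (X i) = PSS.densityMeasure f)
    -- `log f ∈ L^{1+δ}`
    (δ : ℝ) (hδ : δ ∈ Set.Ioo (0 : ℝ) 1)
    (hf_log : MemLp (fun x => Real.log (f x)) (ENNReal.ofReal (1 + δ)) (PSS.densityMeasure f))
    -- the number of segments per axis: `ℓ(n)^d = o(n)`, and the partitions shrink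
    (ℓ : ℕ → ℕ) (hℓ_pos : ∀ n, 1 ≤ ℓ n)
    (hℓ : (fun n => (ℓ n : ℝ) ^ d) =o[atTop] (fun n => (n : ℝ)))
    (hmesh : ∀ᵐ ω ∂P, ∀ j : Fin d,
      Tendsto (fun n => PSS.segWidth (fun v : Fin n => X v ω) (ℓ n) j) atTop (𝓝 0)) :
    (∀ᵐ ω ∂P, Tendsto (fun n => PSS.entropyEst (fun v : Fin n => X v ω) (ℓ n)) atTop
      (𝓝 (PSS.entropy f))) ∧
    (∀ᶠ n in atTop, MemLp (fun ω => PSS.entropyEst (fun v : Fin n => X v ω) (ℓ n)) 1 P) ∧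
    Tendsto (fun n => eLpNorm
      (fun ω => PSS.entropyEst (fun v : Fin n => X v ω) (ℓ n) - PSS.entropy f) 1 P)
      atTop (𝓝 0) := by
  have hX : PSS.IsSample P (PSS.densityMeasure f) X := ⟨hX_meas, hX_indep, hX_law⟩
  have hprob : IsProbabilityMeasure (PSS.densityMeasure f) := by
    rw [← hX_law 0]
    exact Measure.isProbabilityMeasure_map (hX_meas 0).aemeasurable
  -- On a probability space `L^{1+δ}` is contained in `L¹`.
  have hlog : Integrable (fun x => Real.log (f x)) (PSS.densityMeasure f) :=
    hf_log.integrable (by rw [ENNReal.one_le_ofReal]; linarith [hδ.1])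
  have hpow := PSS.integrable_pow_abs hX hℓ_pos hℓ hmesh
  have hdomi := PSS.integrable_domFun hd hlog hpow
  have hlim := PSS.ae_tendsto_entropyEst hd hf_meas hf_nonneg hf_cont hX hlog hdomi hℓ_pos hℓ
    hmesh
  have hL1 := PSS.tendsto_eLpNorm_entropyEst hd hf_meas hf_nonneg hX hpow hdomi hℓ_pos hℓ hlim
  refine ⟨hlim, ?_, hL1⟩
  -- Eventually the `L¹` distance to the constant `entropy f` is below 1, hence finite, and adding
  -- back the constant gives membership in `L¹`.
  filter_upwards [hL1.eventually (gt_mem_nhds one_pos)] with n hn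
  have hm : Measurable fun ω => PSS.entropyEst (fun v : Fin n => X v ω) (ℓ n) :=
    (PSS.measurable_entropyEst (ℓ n)).comp (hX.measurable_fin n)
  have h1 : MemLp (fun ω => PSS.entropyEst (fun v : Fin n => X v ω) (ℓ n) - PSS.entropy f) 1 P :=
    ⟨(hm.sub_const _).aestronglyMeasurable, hn.trans ENNReal.one_lt_top⟩
  exact (h1.add (memLp_const (PSS.entropy f))).congr_norm hm.aestronglyMeasurable
    (Eventually.of_forall fun ω => by simp)
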